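/- Fix integers $r\ge 2$ and coprime $n,m\ge 1$. An $r$-uniform hypergraph is a set $A$ with a set $R[A]$ of $r$-element subsets of $A$; substructures are induced. For finite $A$ put $\delta(A)=n|A|-m|R[A]|$. For $A\subseteq B$ with $B$ finite write $A\le B$ if $\delta(A)\le\delta(B')$ for all $A\subseteq B'\subseteq B$. Let $\mathcal C_0$ be the class of finite $r$-uniform hypergraphs $B$ with $\emptyset\le B$, and $\bar{\mathcal C}_0$ the class of those $r$-uniform hypergraphs all of whose finite substructures are in $\mathcal C_0$; for $C\subseteq B\in\bar{\mathcal C}_0$ write $C\le B$ if $X\cap C\le X$ for all finite $X\subseteq B$. Let $M_0$ be the generic structure for $(\mathcal C_0,\le)$, i.e. the countable structure $M_0\in\bar{\mathcal C}_0$, unique up to isomorphism, such that $M_0$ is the union of a chain of finite $\le$-substructures and, whenever $X\le M_0$ is finite and $X\le A\in\mathcal C_0$, there is an embedding $\alpha:A\to M_0$ that is the identity on $X$ and satisfies $\alpha(A)\le M_0$. For finite $X\subseteq M_0$ let ${\rm cl}_0(X)$ be the smallest $Y$ with $X\subseteq Y\le M_0$ (it is finite), $d(X)=\delta({\rm cl}_0(X))$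 and ${\rm cl}^d(X)=\{a\in M_0: d(X\cup\{a\})=d(X)\}$. Let $G={\rm Aut}(M_0/{\rm cl}^d(\emptyset))$ be the group of automorphisms of $M_0$ that fix every element of ${\rm cl}^d(\emptyset)$. Suppose that either $r=2$ and $n>m$, or $r\ge 3$ and $n\ge m$. Then $G$ is a simple group. In fact, if $g\in G$ and $g\ne 1$, then every element of $G$ is a product of 96 elements, each of which is a conjugate in $G$ of $g$ or of $g^{-1}$. -/

import Mathlib

/-- An `r`-uniform hypergraph on `V`: a set of `r`-element subsets of `V`, i.e. an `r`-ary relation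
that is symmetric and holds only of tuples of distinct elements. -/
structure UHypergraph (r : ℕ) (V : Type*) where
  /-- the hyperedges -/
  edges : Set (Finset V)
  card_edge : ∀ e ∈ edges, e.card = r

namespace UHypergraph

variable {r : ℕ} {V W : Type*}

/-- The hyperedges `R[S]` contained in `S`. -/
def edgesIn (H : UHypergraph r V) (S : Set V) : Set (Finset V) :=
  {e | e ∈ H.edges ∧ (e : Set V) ⊆ S}

/-- The induced substructure on `X`. -/
def induce (H : UHypergraph r V) (X : Set V) : UHypergraph r X where
  edges := {e | e.map (Function.Embedding.subtype (· ∈ X)) ∈ H.edges}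
  card_edge e he := by
    have h := H.card_edge _ he
    rwa [Finset.card_map] at h

/-- `f` is an embedding of structures: an injection that preserves and reflects the relation. -/
def IsEmbedding (H : UHypergraph r V) (K : UHypergraph r W) (f : V ↪ W) : Prop :=
  ∀ e : Finset V, e.map f ∈ K.edges ↔ e ∈ H.edges

/-- The pointwise stabiliser `Aut(H/X)` of `X` in the automorphism group of `H`. -/
def autFixing (H : UHypergraph r V) (X : Set V) : Subgroup (Equiv.Perm V) where
  carrier := {g | H.IsEmbedding H g.toEmbedding ∧ ∀ x ∈ X, g x = x}
  one_mem' := by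
    refine ⟨fun e => ?_, fun x _ => rfl⟩
    have h : e.map (1 : Equiv.Perm V).toEmbedding = e := Finset.map_refl
    rw [h]
  mul_mem' := by
    rintro a b ⟨ha, ha'⟩ ⟨hb, hb'⟩
    refine ⟨fun e => ?_, fun x hx => ?_⟩
    · have h : e.map (a * b).toEmbedding = (e.map b.toEmbedding).map a.toEmbedding := by
        rw [Finset.map_map]; rfl
      rw [h, ha, hb]
    · rw [Equiv.Perm.mul_apply, hb' x hx, ha' x hx]
  inv_mem' := by
    rintro a ⟨ha, ha'⟩
    refine ⟨fun e => ?_, fun x hx => ?_⟩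
    · have h : (e.map (a⁻¹).toEmbedding).map a.toEmbedding = e := by
        rw [Finset.map_map]
        have h' : (a⁻¹).toEmbedding.trans a.toEmbedding = Function.Embedding.refl V := by
          ext x; exact Equiv.apply_symm_apply a x
        rw [h', Finset.map_refl]
      rw [← ha (e.map (a⁻¹).toEmbedding), h]
    · rw [Equiv.Perm.inv_eq_iff_eq, ha' x hx]

/-- The predimension `δ(S) = n |S| - m |R[S]|`; only meaningful for finite `S`. -/
noncomputable def predim (n m : ℕ) (H : UHypergraph r V) (S : Set V) : ℤ :=
  (n : ℤ) * S.ncard - (m : ℤ) * (H.edgesIn S).ncard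

/-- `A ≤ B` for subsets `A ⊆ B` with `B` finite. -/
def FinLe (n m : ℕ) (H : UHypergraph r V) (A B : Set V) : Prop :=
  A ⊆ B ∧ ∀ B' : Set V, A ⊆ B' → B' ⊆ B → H.predim n m A ≤ H.predim n m B'

/-- `H` belongs to the class of structures all of whose finite substructures `X` satisfy
`∅ ≤ X`. For finite `V` this is the class `𝒞₀`. -/
def InC0 (n m : ℕ) (H : UHypergraph r V) : Prop :=
  ∀ X : Set V, X.Finite → H.FinLe n m ∅ X

/-- `C ≤ H`: `X ∩ C ≤ X` for every finite subset `X` of the structure. -/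
def Strong (n m : ℕ) (H : UHypergraph r V) (C : Set V) : Prop :=
  ∀ X : Set V, X.Finite → H.FinLe n m (X ∩ C) X

/-- The smallest `Y ⊇ X` with `Y ≤ H`. -/
def cl0 (n m : ℕ) (H : UHypergraph r V) (X : Set V) : Set V :=
  ⋂₀ {Y | X ⊆ Y ∧ H.Strong n m Y}

/-- The dimension `d(X) = δ(cl₀(X))` of a finite subset `X`. -/
noncomputable def dim (n m : ℕ) (H : UHypergraph r V) (X : Set V) : ℤ :=
  H.predim n m (H.cl0 n m X)

/-- The `d`-closure `cl^d(X) = {a | d(X ∪ {a}) = d(X)}` of a finite subset `X`. -/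
def clD (n m : ℕ) (H : UHypergraph r V) (X : Set V) : Set V :=
  {a | H.dim n m (X ∪ {a}) = H.dim n m X}

/-- `H` is (a copy of) the generic structure for `(𝒞₀, ≤)`. Finite structures are taken in `Type`,
which contains a copy of every one of them. -/
structure IsGeneric (n m : ℕ) (H : UHypergraph r V) : Prop where
  countable : Countable V
  inC0 : H.InC0 n m
  chain : ∃ A : ℕ → Set V, Monotone A ∧ (∀ i, (A i).Finite ∧ H.Strong n m (A i)) ∧
    ⋃ i, A i = Set.univ
  extension : ∀ X : Set V, X.Finite → H.Strong n m X →
    ∀ (W : Type) [Finite W] (K : UHypergraph r W), K.InC0 n m →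
    ∀ j : X ↪ W, (H.induce X).IsEmbedding K j → K.Strong n m (Set.range j) →
    ∃ α : W ↪ V, K.IsEmbedding H α ∧ (∀ x : X, α (j x) = x) ∧ H.Strong n m (Set.range α)

end UHypergraph

/-! The proof has two halves: an abstract one about groups preserving a dimension function, and a
combinatorial one showing that `G` is such a group.

The dimension is monotone and submodular, and `A` is independent from `C` over `B` when
submodularity is an equality. `DimAction` records what is used of the action: independent conjugates
exist, independence is stationary, suitable limits exist, and (`mov`) every `f ≠ 1` moves types
maximally, that is, any `A` has a copy over `X` that is independent over `X` from its image under
`f`, and conversely over `f • X`. Then every partial isomorphism extending a piece of `f`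
independently is induced by a conjugate of `f` (`realize`). Working from both ends towards the
middle, a product of four conjugates can be adjusted to agree with a prescribed element on any
finitely generated closure, provided that this element already agrees with the product on a suitable
small set (`adjust_of_ind`, `exists_trajectory`, `Good`). So the map sending four conjugators to the
product of conjugates has, locally, dense image. As in the open mapping theorem, successive
approximation upgrades density to equality: for given `k`, two sequences of conjugators are
corrected alternately (`half_step`, `full_step`) until in the limit `prodConj g q = prodConj g q' *
k`. Hence `k` is a product of eight conjugates of `g` and `g⁻¹`. Padding with pairs `g`, `g⁻¹` gives
length 96, and simplicity follows.

In the generic structure, extension and stationarity come from free amalgamation and back-and-forth;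
since closures are infinite, partial maps on them are controlled by `Coherent`. The heart is `mov`,
proved in two steps. First, `exists_mover`: over any finite `X`, a non-trivial `g` moves some free
point `a` so that `a` and `g a` together have dimension at least `n + m` over `X`. If not, let `n +
β` with `β < m` be the least bound that holds over some `X`. Attaching a new point by one edge to `r
- 1` points and counting edges with its image forces every free point attaining the bound to be
fixed (`fix_of_bound`). So `β = 0`, all points free over some finite set are fixed, and then `g = 1`
(`eq_one_of_fix_free`). The numerical hypotheses on `r`, `n`, `m` enter here. Second,
`exists_algebraic_conj`: iterating `exists_mover` gives a supply `C` of points, each of dimension at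
least `m` over the earlier ones together with all of `g C`. Starting from an independent copy of a
strong set `F`, edges through points of `C` are added until `F` is algebraic over `X ∪ C`. An edge
costs `m`, and this is paid for either by a point of `C` or by a new free point, so `F` remains
independent over `X` from a set containing `X ∪ g X ∪ g C`. Coprimality of `n` and `m` allows the
dimension to be brought down to exactly zero. The new structure embeds into the generic one. There
`g F` is algebraic over `g (X ∪ C)`, from which `F` is independent over `X`; this is maximal
movement. -/

noncomputable section

open scoped Pointwise Classical

/-! ### Integer-valued dimension functions on finite sets -/

/-- A monotone submodular function on the finite subsets of `V`. -/
structure IsDim {V : Type*} (d : Finset V → ℤ) : Prop where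
  mono : ∀ A B, A ⊆ B → d A ≤ d B
  submod : ∀ A B, d (A ∪ B) + d (A ∩ B) ≤ d A + d B

/-- The closure of a finite set: the points which do not increase the dimension. -/
def dcl {V : Type*} (d : Finset V → ℤ) (A : Finset V) : Set V :=
  {a | d (insert a A) = d A}

/-- `A` is independent from `C` over `B`. -/
def DInd {V : Type*} (d : Finset V → ℤ) (A B C : Finset V) : Prop :=
  d (A ∪ B) + d (B ∪ C) ≤ d (A ∪ B ∪ C) + d B

namespace IsDim

variable {V : Type*} {d : Finset V → ℤ} (hd : IsDim d)
include hd

theorem submod_of_subset {A B C D : Finset V} (h₁ : C ⊆ A) (h₂ : C ⊆ B) (h₃ : D ⊆ A ∪ B) :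
    d D + d C ≤ d A + d B := by
  have := hd.submod A B
  have := hd.mono _ _ (Finset.subset_inter h₁ h₂)
  have := hd.mono _ _ h₃
  omega

omit hd in
theorem _root_.subset_dcl (d : Finset V → ℤ) (A : Finset V) : (A : Set V) ⊆ dcl d A := by
  intro a ha
  simp only [dcl, Set.mem_ofPred_eq]
  rw [Finset.insert_eq_of_mem (by simpa using ha)]

theorem mem_dcl_iff {A : Finset V} {a : V} : a ∈ dcl d A ↔ d (insert a A) ≤ d A := by
  have := hd.mono A (insert a A) (Finset.subset_insert _ _)
  simp only [dcl, Set.mem_ofPred_eq]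
  omega

theorem dcl_mono {A B : Finset V} (h : A ⊆ B) : dcl d A ⊆ dcl d B := by
  intro a ha
  rw [hd.mem_dcl_iff] at ha ⊢
  have := hd.submod_of_subset (A := insert a A) (B := B) (C := A) (D := insert a B)
    (Finset.subset_insert _ _) h (by intro x; simp; tauto)
  omega

theorem union_of_subset_dcl {A C : Finset V} (h : (C : Set V) ⊆ dcl d A) : d (A ∪ C) = d A := by
  induction C using Finset.induction_on with
  | empty => simp
  | insert c C hc ih =>
    have ih := ih (fun x hx => h (by simp at hx ⊢; tauto))
    have h1 := (hd.mem_dcl_iff).1 (hd.dcl_mono (B := A ∪ C) Finset.subset_union_left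
      (h (show c ∈ _ by simp)))
    have h2 := hd.mono (A ∪ C) (A ∪ insert c C) (by intro x; simp; tauto)
    rw [show insert c (A ∪ C) = A ∪ insert c C by ext x; simp] at h1
    omega

theorem subset_dcl_of_le {A C : Finset V} (h : d (A ∪ C) ≤ d A) : (C : Set V) ⊆ dcl d A := by
  intro c hc
  rw [hd.mem_dcl_iff]
  refine le_trans (hd.mono _ _ ?_) h
  intro x; simp only [Finset.mem_insert, Finset.mem_union]
  rintro (rfl | hx)
  · exact Or.inr hc
  · exact Or.inl hx

/-- Adding points of the closure of a part does not change the dimension. -/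
theorem union_eq_of_subset_dcl {A B C : Finset V} (hA : A ⊆ B) (h : (C : Set V) ⊆ dcl d A) :
    d (B ∪ C) = d B :=
  hd.union_of_subset_dcl (h.trans (hd.dcl_mono hA))

/-! #### Calculus of independence -/

theorem ind_eq {A B C : Finset V} (h : DInd d A B C) :
    d (A ∪ B ∪ C) + d B = d (A ∪ B) + d (B ∪ C) := by
  have := hd.submod_of_subset (A := A ∪ B) (B := B ∪ C) (C := B) (D := A ∪ B ∪ C)
    Finset.subset_union_right Finset.subset_union_left (by intro x; simp)
  unfold DInd at h
  omega

omit hd in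
theorem _root_.DInd.symm {A B C : Finset V} (h : DInd d A B C) : DInd d C B A := by
  unfold DInd at *
  rw [show C ∪ B ∪ A = A ∪ B ∪ C by ext; simp; tauto, Finset.union_comm C B,
    Finset.union_comm B A]
  omega

theorem ind_mono_right {A B C C' : Finset V} (h : DInd d A B C)
    (hC : C' ⊆ B ∪ C) : DInd d A B C' := by
  unfold DInd at *
  have := hd.submod_of_subset (A := A ∪ B ∪ C') (B := B ∪ C) (C := B ∪ C') (D := A ∪ B ∪ C)
    (by intro x; simp; tauto)
    (by intro x hx; have := @hC x; simp at hx this ⊢; tauto)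
    (by intro x; simp; tauto)
  omega

theorem ind_mono {A B C A' C' : Finset V} (h : DInd d A B C)
    (hA : A' ⊆ A ∪ B) (hC : C' ⊆ B ∪ C) : DInd d A' B C' :=
  (hd.ind_mono_right (hd.ind_mono_right h hC).symm (by rwa [Finset.union_comm])).symm

omit hd in
theorem _root_.DInd.trans {A B C D : Finset V} (h₁ : DInd d A B C) (h₂ : DInd d A (B ∪ C) D) :
    DInd d A B (C ∪ D) := by
  unfold DInd at *
  rw [← Finset.union_assoc] at h₂
  simp only [← Finset.union_assoc] at *
  omega

/-- Base monotonicity: independence from `B'` over `B` turns `d (A ∪ B')` into an explicit sum, and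
the inequality over `B'` is then the one over `B`. -/
theorem ind_base {A B B' C : Finset V} (h : DInd d A B C) (h₁ : B ⊆ B') (h₂ : B' ⊆ B ∪ C) :
    DInd d A B' C := by
  have h3 := hd.ind_eq (hd.ind_mono_right h (C' := B') h₂)
  rw [show A ∪ B ∪ B' = A ∪ B' by ext x; have := @h₁ x; simp; tauto,
    Finset.union_eq_right.2 h₁] at h3
  have h4 := hd.ind_eq h
  unfold DInd
  rw [show A ∪ B' ∪ C = A ∪ B ∪ C by
      ext x; have := @h₁ x; have := @h₂ x; simp at *; tauto,
    show B' ∪ C = B ∪ C by ext x; have := @h₁ x; have := @h₂ x; simp at *; tauto]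
  omega

omit hd in
/-- Independence transfers to a smaller base inside the old one. -/
theorem _root_.DInd.trans_of_subset {A B B' C : Finset V} (hB : B ⊆ B') (h₁ : DInd d A B B')
    (h₂ : DInd d A B' C) : DInd d A B (B' ∪ C) :=
  h₁.trans (by rwa [Finset.union_eq_right.2 hB])

omit hd in
theorem _root_.DInd.base_right (d : Finset V → ℤ) (A B : Finset V) : DInd d A B B := by
  unfold DInd; simp

/-- The left-hand set may be enlarged inside the closure. -/
theorem ind_dcl {A A' B C : Finset V} (h : DInd d A B C) (hA : (A' : Set V) ⊆ dcl d (A ∪ B)) :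
    DInd d A' B C := by
  refine hd.ind_mono (A := A ∪ A') (C := C) ?_ (by intro x; simp; tauto) (by intro x; simp; tauto)
  unfold DInd at *
  rw [show A ∪ A' ∪ B = (A ∪ B) ∪ A' by ext; simp; tauto, hd.union_of_subset_dcl hA]
  have := hd.mono (A ∪ B ∪ C) (A ∪ B ∪ A' ∪ C) (by intro x; simp; tauto)
  omega

theorem ind_dcl_right {A B C C' : Finset V} (h : DInd d A B C)
    (hC : (C' : Set V) ⊆ dcl d (B ∪ C)) : DInd d A B C' :=
  (hd.ind_dcl h.symm (by rwa [Finset.union_comm])).symm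

/-- A common point raising the dimension of `B` would be counted twice and contradict submodularity.
This makes maps given separately on two independent closures compatible. -/
theorem dcl_inter_subset {A B C : Finset V} (hA : B ⊆ A) (hC : B ⊆ C) (h : DInd d A B C) :
    dcl d A ∩ dcl d C ⊆ dcl d B := by
  rintro x ⟨h1, h2⟩
  rw [hd.mem_dcl_iff] at *
  have h3 := hd.submod_of_subset (A := insert x A) (B := insert x C) (C := insert x B)
    (D := A ∪ C) (Finset.insert_subset_insert _ hA) (Finset.insert_subset_insert _ hC)
    (by intro y; simp; tauto)
  unfold DInd at h
  rw [Finset.union_eq_left.2 hA, Finset.union_eq_right.2 hC] at h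
  omega

end IsDim

/-! ### Groups acting with a stationary independence relation -/

section FixPointwise

variable {Γ V : Type*} [Group Γ] [MulAction Γ V]

/-- `h` fixes the closure of `B` pointwise. -/
def Fx (d : Finset V → ℤ) (B : Finset V) (h : Γ) : Prop :=
  ∀ x ∈ dcl d B, h • x = x

/-- `f'` is the conjugate of `f` by an element fixing the closure of `P` pointwise. -/
def Cj (d : Finset V → ℤ) (P : Finset V) (f f' : Γ) : Prop :=
  ∃ b : Γ, Fx d P b ∧ f' = b * f * b⁻¹

end FixPointwise

/-- A group acting on `V` preserving a dimension function whose independence relation has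
extensions and is stationary, whose non-trivial elements move all types maximally, and which is
closed under limits. -/
structure DimAction (Γ : Type*) {V : Type*} [Group Γ] [MulAction Γ V] (d : Finset V → ℤ) :
    Prop where
  dim : IsDim d
  inv : ∀ (g : Γ) (A : Finset V), d (g • A) = d A
  ext : ∀ A B C : Finset V, ∃ h : Γ, Fx d B h ∧ DInd d (h • A) B C
  stat : ∀ (A B C : Finset V) (h : Γ), B ⊆ A → B ⊆ C → Fx d B h → DInd d A B C →
    DInd d (h • A) B C → ∃ k : Γ, (∀ x ∈ dcl d A, k • x = h • x) ∧ Fx d C k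
  mov : ∀ f : Γ, f ≠ 1 → ∀ X A : Finset V, ∃ h : Γ, Fx d X h ∧
    DInd d (h • A) X (f • X ∪ f • h • A) ∧ DInd d (f • h • A) (f • X) (X ∪ h • A)
  lim : ∀ (p : ℕ → Γ) (F : ℕ → Finset V), Monotone F → (∀ x, ∃ i, x ∈ F i) →
    (∀ i, ∀ x ∈ F i, p (i + 1) • x = p i • x) → (∀ x, ∃ i, (p i)⁻¹ • x ∈ F i) →
    ∃ q : Γ, ∀ i, ∀ x ∈ F i, q • x = p i • x
  fix_empty : ∀ g : Γ, Fx d ∅ g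
  faithful : ∀ g h : Γ, (∀ x : V, g • x = h • x) → g = h

namespace DimAction

variable {Γ V : Type*} [Group Γ] [MulAction Γ V] {d : Finset V → ℤ} (hΓ : DimAction Γ d)
include hΓ

theorem smul_mem_dcl {g : Γ} {A : Finset V} {x : V} (hx : x ∈ dcl d A) :
    g • x ∈ dcl d (g • A) := by
  have h1 := hΓ.inv g (insert x A)
  have h2 := hΓ.inv g A
  rw [Finset.smul_finset_insert] at h1
  change d (insert x A) = d A at hx
  change d (insert (g • x) (g • A)) = d (g • A)
  omega

theorem smul_mem_dcl_iff {g : Γ} {A : Finset V} {x : V} :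
    g • x ∈ dcl d (g • A) ↔ x ∈ dcl d A := by
  refine ⟨fun h => ?_, hΓ.smul_mem_dcl⟩
  have := hΓ.smul_mem_dcl (g := g⁻¹) h
  rwa [inv_smul_smul, inv_smul_smul] at this

theorem fx_mono {B C : Finset V} {h : Γ} (hB : B ⊆ C) (hh : Fx d C h) : Fx d B h :=
  fun x hx => hh x (hΓ.dim.dcl_mono hB hx)

omit hΓ in
theorem _root_.Fx.mul {B : Finset V} {g h : Γ} (hg : Fx d B g) (hh : Fx d B h) :
    Fx d B (g * h) :=
  fun x hx => by rw [mul_smul, hh x hx, hg x hx]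

omit hΓ in
theorem _root_.Fx.inv {B : Finset V} {h : Γ} (hh : Fx d B h) : Fx d B h⁻¹ :=
  fun x hx => by rw [inv_smul_eq_iff, hh x hx]

omit hΓ in
theorem _root_.Fx.smul_eq {B A : Finset V} {h : Γ} (hh : Fx d B h) (hA : A ⊆ B) : h • A = A := by
  ext x
  rw [Finset.mem_smul_finset]
  constructor
  · rintro ⟨y, hy, rfl⟩
    rwa [hh y (subset_dcl d B (hA hy))]
  · intro hx
    exact ⟨x, hx, hh x (subset_dcl d B (hA hx))⟩

omit hΓ in
theorem _root_.Cj.trans {P : Finset V} {f f' f'' : Γ} (h : Cj d P f f') (h' : Cj d P f' f'') :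
    Cj d P f f'' := by
  obtain ⟨b, hb, rfl⟩ := h
  obtain ⟨c, hc, rfl⟩ := h'
  exact ⟨c * b, hc.mul hb, by group⟩

omit hΓ in
theorem _root_.Cj.inv {P : Finset V} {f f' : Γ} (h : Cj d P f f') : Cj d P f⁻¹ f'⁻¹ := by
  obtain ⟨b, hb, rfl⟩ := h
  exact ⟨b, hb, by group⟩

omit hΓ in
theorem _root_.Cj.ne_one {P : Finset V} {f f' : Γ} (h : Cj d P f f') (hf : f ≠ 1) : f' ≠ 1 := by
  obtain ⟨b, hb, rfl⟩ := h
  simpa using hf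

theorem cj_mono {B C : Finset V} {f f' : Γ} (hB : B ⊆ C) (h : Cj d C f f') : Cj d B f f' := by
  obtain ⟨b, hb, rfl⟩ := h
  exact ⟨b, hΓ.fx_mono hB hb, rfl⟩

theorem ind_smul (g : Γ) {A B C : Finset V} (h : DInd d A B C) :
    DInd d (g • A) (g • B) (g • C) := by
  unfold DInd at *
  simp only [← Finset.smul_finset_union, hΓ.inv]
  exact h

theorem ind_smul_fx {K A B C : Finset V} {g : Γ} (hg : Fx d K g) (hB : B ⊆ K) (hC : C ⊆ K)
    (h : DInd d A B C) : DInd d (g • A) B C := by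
  have := hΓ.ind_smul g h
  rwa [hg.smul_eq hB, hg.smul_eq hC] at this

/-! ### Conjugates with prescribed partial behaviour -/

/-- A partial isomorphism which is an independent extension of a restriction of `f` is a
restriction of a conjugate of `f`. -/
theorem realize {f τ : Γ} (hf : f ≠ 1) {P X A : Finset V} (hXA : X ⊆ A)
    (hτ : ∀ x ∈ dcl d X, τ • x = f • x) (h1 : DInd d A X (P ∪ f • X))
    (h2 : DInd d (τ • A) (f • X) (P ∪ X ∪ A)) :
    ∃ f', Cj d P f f' ∧ ∀ x ∈ dcl d A, f' • x = τ • x := by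
  -- `K` contains everything the conjugator must fix. By `mov` and transitivity, `f' = h⁻¹ * f * h`
  -- extends `f` on the closure of `X` with `f' • A` independent over `f • X` from `K ∪ A`, just
  -- like `τ • A`.
  set K := P ∪ X ∪ f • X with hK
  obtain ⟨h, hh, -, hm⟩ := hΓ.mov f hf K A
  have hXK : X ⊆ K := by grind
  have hfXK : f • X ⊆ K := by grind
  have e1 : DInd d (h • A) X K :=
    hΓ.ind_smul_fx hh hXK subset_rfl (hΓ.dim.ind_mono_right h1 (by grind))
  have e2 : DInd d (f • h • A) (f • X) (K ∪ h • A) :=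
    hΓ.dim.ind_mono_right ((hΓ.ind_smul f e1).trans_of_subset
      (Finset.smul_finset_subset_smul_finset hXK) hm) (by grind)
  have e3 := hΓ.ind_smul h⁻¹ e2
  rw [hh.inv.smul_eq hfXK, Finset.smul_finset_union, hh.inv.smul_eq subset_rfl,
    inv_smul_smul] at e3
  set f' := h⁻¹ * f * h with hf'
  have e4 : h⁻¹ • f • h • A = f' • A := by simp [hf', mul_smul]
  rw [e4] at e3
  have e5 : ∀ x ∈ dcl d X, f' • x = f • x := by
    intro x hx
    rw [hf', mul_smul, mul_smul, hh x (hΓ.dim.dcl_mono hXK hx),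
      hh.inv _ (hΓ.dim.dcl_mono hfXK (hΓ.smul_mem_dcl hx))]
  have e6 : f' • X = f • X := by
    rw [hf', mul_smul, mul_smul, hh.smul_eq hXK, hh.inv.smul_eq hfXK]
  -- Stationarity replaces `τ * f'⁻¹` by an element `c` fixing the closure of `K ∪ A`. Conjugation
  -- by `c` leaves the source `A` alone and moves its image from `f' • A` to `τ • A`.
  obtain ⟨c, hc1, hc2⟩ := hΓ.stat (f' • A) (f • X) (K ∪ A) (τ * f'⁻¹)
    (by rw [← e6]; exact Finset.smul_finset_subset_smul_finset hXA)
    (hfXK.trans Finset.subset_union_left)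
    (by
      intro y hy
      obtain ⟨x, rfl⟩ : ∃ x, y = f • x := ⟨f⁻¹ • y, by simp⟩
      have hx := hΓ.smul_mem_dcl_iff.1 hy
      rw [mul_smul, ← e5 x hx, inv_smul_smul, hτ x hx, e5 x hx])
    e3
    (by
      rw [mul_smul, inv_smul_smul]
      exact hΓ.dim.ind_mono_right h2 (by grind))
  refine ⟨(c * h⁻¹) * f * (c * h⁻¹)⁻¹, ⟨c * h⁻¹, ?_, rfl⟩, ?_⟩
  · exact (hΓ.fx_mono (by grind) hc2).mul (hΓ.fx_mono (by grind) hh.inv)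
  · intro x hx
    have : (c * h⁻¹) * f * (c * h⁻¹)⁻¹ = c * f' * c⁻¹ := by simp only [hf']; group
    rw [this, mul_smul, mul_smul,
      hc2.inv x (hΓ.dim.dcl_mono Finset.subset_union_right hx),
      hc1 _ (hΓ.smul_mem_dcl hx), mul_smul, inv_smul_smul]

/-- The trajectory of `Z` can be made independent from a given set. -/
theorem conj_trajectory {a₁ a₂ : Γ} {Z : Finset V} (h : DInd d (a₁ • Z) Z (a₂ • a₁ • Z))
    (T : Finset V) :
    ∃ a₁' a₂', Cj d Z a₁ a₁' ∧ Cj d Z a₂ a₂' ∧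
      (∀ x ∈ dcl d Z, a₂' • a₁' • x = a₂ • a₁ • x) ∧
      DInd d (a₁' • Z) Z (a₂ • a₁ • Z ∪ T) := by
  -- Conjugating both maps by an element fixing the two ends of the trajectory moves only its
  -- midpoint.
  obtain ⟨c, hc, hi⟩ := hΓ.ext (a₁ • Z) (Z ∪ a₂ • a₁ • Z) T
  have hcZ : Fx d Z c := hΓ.fx_mono Finset.subset_union_left hc
  refine ⟨c * a₁ * c⁻¹, c * a₂ * c⁻¹, ⟨c, hcZ, rfl⟩, ⟨c, hcZ, rfl⟩, ?_, ?_⟩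
  · intro x hx
    simp only [mul_smul, inv_smul_smul]
    rw [hcZ.inv x hx]
    exact hc _ (hΓ.dim.dcl_mono Finset.subset_union_right
      (hΓ.smul_mem_dcl (hΓ.smul_mem_dcl hx)))
  · rw [mul_smul, mul_smul, hcZ.inv.smul_eq subset_rfl]
    exact (hΓ.ind_smul_fx hc (by grind) (by grind) h).trans hi

/-- If a trajectory is sufficiently independent, then the product can be adjusted freely outside
of its domain. -/
theorem adjust_of_ind {f₁ f₂ f₃ f₄ u : Γ} (h₁ : f₁ ≠ 1) (h₂ : f₂ ≠ 1) (h₃ : f₃ ≠ 1)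
    (h₄ : f₄ ≠ 1) {P Z₀ Z₁ Z₂ Z₃ Z₄ X : Finset V} (hZ₁ : f₁ • Z₀ = Z₁) (hZ₂ : f₂ • Z₁ = Z₂)
    (hZ₃ : f₃ • Z₂ = Z₃) (hZ₄ : f₄ • Z₃ = Z₄) (hP₀ : P ⊆ Z₀) (hP₄ : P ⊆ Z₄) (hX : Z₀ ⊆ X)
    (hi₁ : DInd d Z₁ Z₀ (Z₂ ∪ X)) (hi₃ : DInd d Z₃ Z₄ (Z₂ ∪ u • X))
    (hu : ∀ x ∈ dcl d Z₀, u • x = f₄ • f₃ • f₂ • f₁ • x) :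
    ∃ f₁' f₂' f₃' f₄', Cj d P f₁ f₁' ∧ Cj d P f₂ f₂' ∧ Cj d P f₃ f₃' ∧ Cj d P f₄ f₄' ∧
      ∀ x ∈ dcl d X, u • x = f₄' • f₃' • f₂' • f₁' • x := by
  -- New images of `X` are chosen as independently as possible: `x₁` from the front, `x₃` backwards
  -- from `u • X`, and `x₂` from `x₁`. What remains is a map from `x₃` to `x₂`.
  set W := Z₀ ∪ X ∪ Z₂ ∪ Z₃ ∪ Z₄ ∪ u • X with hW
  obtain ⟨e₁, he₁, hi1⟩ := hΓ.ext (f₁ • X) Z₁ W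
  obtain ⟨e₄, he₄, hi4⟩ := hΓ.ext (f₄⁻¹ • u • X) Z₃ (W ∪ Z₁ ∪ e₁ • f₁ • X)
  set x₁ := e₁ • f₁ • X with hx₁
  set x₃ := e₄ • f₄⁻¹ • u • X with hx₃
  obtain ⟨e₂, he₂, hi2⟩ := hΓ.ext (f₂ • x₁) Z₂ (W ∪ Z₁ ∪ x₁ ∪ x₃)
  set x₂ := e₂ • f₂ • x₁ with hx₂
  have huZ : u • Z₀ = Z₄ := by
    rw [← hZ₄, ← hZ₃, ← hZ₂, ← hZ₁]
    ext y
    simp only [Finset.mem_smul_finset, exists_exists_and_eq_and]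
    constructor <;> rintro ⟨x, hx, rfl⟩ <;> refine ⟨x, hx, ?_⟩ <;>
      rw [hu x (subset_dcl d _ hx)]
  have hZ₁x : Z₁ ⊆ x₁ := by
    rw [hx₁, ← he₁.smul_eq (subset_refl Z₁)]
    exact Finset.smul_finset_subset_smul_finset
      (hZ₁ ▸ Finset.smul_finset_subset_smul_finset hX)
  have hZ₃' : f₄⁻¹ • Z₄ = Z₃ := by rw [← hZ₄, inv_smul_smul]
  have hZ₂' : f₃⁻¹ • Z₃ = Z₂ := by rw [← hZ₃, inv_smul_smul]
  have hZ₄X : Z₄ ⊆ u • X := huZ ▸ Finset.smul_finset_subset_smul_finset hX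
  have hZ₃x : Z₃ ⊆ x₃ := by
    rw [hx₃, ← he₄.smul_eq (subset_refl Z₃)]
    exact Finset.smul_finset_subset_smul_finset
      (hZ₃' ▸ Finset.smul_finset_subset_smul_finset hZ₄X)
  have m₁ : ∀ x ∈ dcl d Z₀, f₁ • x ∈ dcl d Z₁ := fun x hx => hZ₁ ▸ hΓ.smul_mem_dcl hx
  have m₂ : ∀ x ∈ dcl d Z₁, f₂ • x ∈ dcl d Z₂ := fun x hx => hZ₂ ▸ hΓ.smul_mem_dcl hx
  have m₃ : ∀ x ∈ dcl d Z₃, f₃⁻¹ • x ∈ dcl d Z₂ := fun x hx => hZ₂' ▸ hΓ.smul_mem_dcl hx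
  have m₄ : ∀ x ∈ dcl d Z₄, f₄⁻¹ • x ∈ dcl d Z₃ := fun x hx => hZ₃' ▸ hΓ.smul_mem_dcl hx
  obtain ⟨f₁', c₁, r₁⟩ := hΓ.realize (τ := e₁ * f₁) h₁ (P := P) hX
    (fun x hx => by rw [mul_smul, he₁ _ (m₁ x hx)])
    (hZ₁.symm ▸ hΓ.dim.ind_mono hi₁.symm (by grind (ematch := 20)) (by grind (ematch := 20)))
    (by rw [hZ₁, mul_smul]; exact hΓ.dim.ind_mono_right hi1 (by grind (ematch := 20)))
  obtain ⟨f₂', c₂, r₂⟩ := hΓ.realize (τ := e₂ * f₂) h₂ (P := P) hZ₁x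
    (fun x hx => by rw [mul_smul, he₂ _ (m₂ x hx)])
    (hZ₂.symm ▸ hΓ.dim.ind_mono_right hi1 (by grind (ematch := 20)))
    (by rw [hZ₂, mul_smul]; exact hΓ.dim.ind_mono_right hi2 (by grind (ematch := 20)))
  obtain ⟨f₄', c₄, r₄⟩ := hΓ.realize (τ := e₄ * f₄⁻¹) (inv_ne_one.2 h₄) (P := P) hZ₄X
    (fun x hx => by rw [mul_smul, he₄ _ (m₄ x hx)])
    (hZ₃'.symm ▸ hΓ.dim.ind_mono hi₃.symm (by grind (ematch := 20)) (by grind (ematch := 20)))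
    (by rw [hZ₃', mul_smul]; exact hΓ.dim.ind_mono_right hi4 (by grind (ematch := 20)))
  -- The last map is forced: it goes from `x₃` back to `X`, then forward to `x₂`. It extends `f₃⁻¹`
  -- because `u` agrees with the original product on the closure of `Z₀`.
  obtain ⟨f₃', c₃, r₃⟩ := hΓ.realize (τ := e₂ * f₂ * (e₁ * f₁) * u⁻¹ * (e₄ * f₄⁻¹)⁻¹)
    (inv_ne_one.2 h₃) (P := P) hZ₃x
    (fun y hy => by
      obtain ⟨x, rfl⟩ : ∃ x, y = f₃ • f₂ • f₁ • x := ⟨f₁⁻¹ • f₂⁻¹ • f₃⁻¹ • y, by simp⟩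
      have hx : x ∈ dcl d Z₀ := by
        rw [← hZ₃, ← hZ₂, ← hZ₁] at hy
        simpa only [hΓ.smul_mem_dcl_iff] using hy
      have e : u⁻¹ • f₄ • f₃ • f₂ • f₁ • x = x := by rw [← hu x hx, inv_smul_smul]
      simp only [mul_smul, mul_inv_rev, inv_inv, inv_smul_smul]
      rw [he₄.inv _ hy, e, he₁ _ (m₁ x hx), he₂ _ (m₂ _ (m₁ x hx))])
    (hZ₂'.symm ▸ hΓ.dim.ind_mono_right hi4 (by grind (ematch := 20)))
    (by
      rw [hZ₂']
      simp only [hx₃, mul_smul, mul_inv_rev, inv_inv, inv_smul_smul, smul_inv_smul]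
      exact hΓ.dim.ind_mono_right hi2 (by grind (ematch := 20)))
  refine ⟨f₁', f₂', f₃'⁻¹, f₄'⁻¹, c₁, c₂, by simpa using c₃.inv, by simpa using c₄.inv, ?_⟩
  intro x hx
  have k₁ : (e₁ * f₁) • x ∈ dcl d x₁ := by
    rw [hx₁, ← mul_smul]; exact hΓ.smul_mem_dcl hx
  have k₃ : (e₄ * f₄⁻¹) • u • x ∈ dcl d x₃ := by
    rw [hx₃, ← mul_smul]; exact hΓ.smul_mem_dcl (hΓ.smul_mem_dcl hx)
  rw [r₁ x hx, r₂ _ k₁, eq_inv_smul_iff, eq_inv_smul_iff, r₄ _ (hΓ.smul_mem_dcl hx), r₃ _ k₃]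
  simp only [mul_smul, mul_inv_rev, inv_inv, inv_smul_smul, smul_inv_smul]

/-- Any element may be conjugated so that it moves a given type maximally. -/
theorem mov_conj {f : Γ} (hf : f ≠ 1) (X A : Finset V) :
    ∃ f', Cj d X f f' ∧ DInd d A X (f' • X ∪ f' • A) ∧ DInd d (f' • A) (f' • X) (X ∪ A) := by
  obtain ⟨h, hh, h1, h2⟩ := hΓ.mov f hf X A
  have e1 := hΓ.ind_smul h⁻¹ h1
  have e2 := hΓ.ind_smul h⁻¹ h2
  have hX := hh.inv.smul_eq (subset_refl X)
  have hX' := hh.smul_eq (subset_refl X)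
  refine ⟨h⁻¹ * f * h, ⟨h⁻¹, hh.inv, by simp⟩, ?_, ?_⟩
  · simpa only [Finset.smul_finset_union, inv_smul_smul, hX, mul_smul, hX'] using e1
  · simpa only [Finset.smul_finset_union, inv_smul_smul, hX, mul_smul, hX'] using e2

omit hΓ in
theorem _root_.Cj.smul_eq {Q B : Finset V} {f f' : Γ} (h : Cj d Q f f') (hB : B ⊆ Q)
    (hfB : f • B ⊆ Q) : f' • B = f • B := by
  obtain ⟨b, hb, rfl⟩ := h
  rw [mul_smul, mul_smul, hb.inv.smul_eq hB, hb.smul_eq hfB]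

/-- Applying a maximally moving conjugate of `a` to a set independent over `P` gives an image
independent over `a • P`. This base lies in `Q` and so does not change under conjugation. An extra
conjugation avoids `R`. -/
theorem conj_second {a : Γ} (ha : a ≠ 1) {P Q D : Finset V} (hP : P ⊆ Q) (haP : a • P ⊆ Q)
    (hD : DInd d D P Q) (R : Finset V) :
    ∃ a', Cj d Q a a' ∧ DInd d (a' • D) (a • P) (Q ∪ D ∪ R) := by
  obtain ⟨a', ca, -, h1⟩ := hΓ.mov_conj ha Q D
  have h2 : DInd d (a' • D) (a' • P) (Q ∪ D) :=
    hΓ.dim.ind_mono_right ((hΓ.ind_smul a' hD).trans_of_subset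
      (Finset.smul_finset_subset_smul_finset hP) h1) (by grind)
  rw [ca.smul_eq hP haP] at h2
  obtain ⟨b, hb, hi⟩ := hΓ.ext (a' • D) (Q ∪ D) R
  refine ⟨b * a' * b⁻¹, ca.trans ⟨b, hΓ.fx_mono (by grind) hb, rfl⟩, ?_⟩
  rw [mul_smul, mul_smul, hb.inv.smul_eq (by grind)]
  exact (hΓ.ind_smul_fx hb (by grind) subset_rfl h2).trans_of_subset (by grind) hi

/-- Enlarges a two-step trajectory starting at `Q` so that it ends in a larger set: `C'` is pulled
back through a maximally moving conjugate of `a₂⁻¹`, then through `a₁` by an independent extension.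
It lets two trajectories meet at the same set. -/
theorem conj_meet {a₁ a₂ : Γ} (h₂ : a₂ ≠ 1) {Q C' E : Finset V} (hE : E ⊆ Q)
    (haE : a₂⁻¹ • E ⊆ Q) (hD : DInd d (a₁ • Q) Q (a₂ • a₁ • Q ∪ C'))
    (hC' : DInd d C' E (Q ∪ a₁ • Q ∪ a₂ • a₁ • Q)) :
    ∃ a₁' a₂' Z, Cj d Q a₁ a₁' ∧ Cj d Q a₂ a₂' ∧ Q ⊆ Z ∧ a₂' • a₁' • Z = a₂ • a₁ • Q ∪ C' ∧
      DInd d (a₁' • Z) Z (a₂ • a₁ • Q ∪ C') := by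
  set D := a₁ • Q with hDdef
  set C := a₂ • D with hCdef
  set K := Q ∪ D ∪ C with hK
  obtain ⟨b₂, cb, -, h1⟩ := hΓ.mov_conj (inv_ne_one.2 h₂) K C'
  have hEK : E ⊆ K := by grind
  have h2 : DInd d (b₂ • C') (b₂ • E) (K ∪ C') :=
    hΓ.dim.ind_mono_right ((hΓ.ind_smul b₂ hC').trans_of_subset
      (Finset.smul_finset_subset_smul_finset hEK) h1) (by grind)
  rw [cb.smul_eq hEK (by grind)] at h2
  have h3 : DInd d (b₂ • C') Q (K ∪ C') := hΓ.dim.ind_base h2 haE (by grind)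
  have hCD : b₂ • C = D := by
    rw [cb.smul_eq (by grind) (by rw [hCdef, inv_smul_smul]; grind), hCdef, inv_smul_smul]
  set Z₁ := D ∪ b₂ • C' with hZ₁
  have h4 : DInd d (C ∪ C') Q Z₁ :=
    hD.symm.trans (hΓ.dim.ind_mono (hΓ.dim.ind_base h3 (B' := Q ∪ D) (by grind) (by grind)).symm
      (by grind) (by grind))
  obtain ⟨b, hb, hi⟩ := hΓ.ext (a₁⁻¹ • Z₁) (Q ∪ Z₁) (C ∪ C')
  have hQ : Q ⊆ b • a₁⁻¹ • Z₁ := by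
    have h5 : Q ⊆ a₁⁻¹ • Z₁ := by
      rw [hZ₁, Finset.smul_finset_union, hDdef, inv_smul_smul]
      exact Finset.subset_union_left
    have h6 := Finset.smul_finset_subset_smul_finset (a := b) h5
    rwa [hb.smul_eq (show Q ⊆ Q ∪ Z₁ by grind)] at h6
  have hZ : (b * a₁ * b⁻¹) • b • a₁⁻¹ • Z₁ = Z₁ := by
    rw [mul_smul, mul_smul, inv_smul_smul, smul_inv_smul, hb.smul_eq (by grind)]
  refine ⟨b * a₁ * b⁻¹, b₂⁻¹, b • a₁⁻¹ • Z₁, ⟨b, hΓ.fx_mono (by grind) hb, rfl⟩, ?_, hQ, ?_, ?_⟩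
  · simpa using (hΓ.cj_mono (by grind) cb).inv
  · rw [hZ, hZ₁, Finset.smul_finset_union, inv_smul_smul, ← hCD, inv_smul_smul]
  · rw [hZ]
    have h5 : DInd d (C ∪ C') Q (Z₁ ∪ b • a₁⁻¹ • Z₁) := h4.trans hi.symm
    exact hΓ.dim.ind_mono (hΓ.dim.ind_base h5 (B' := b • a₁⁻¹ • Z₁) hQ (by grind)).symm
      (by grind) (by grind)

/-- Four non-trivial elements can be conjugated over `P` so that some trajectory is sufficiently
independent and starts and ends outside of `P`. -/
theorem exists_trajectory {f₁ f₂ f₃ f₄ : Γ} (h₁ : f₁ ≠ 1) (h₂ : f₂ ≠ 1) (h₃ : f₃ ≠ 1)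
    (h₄ : f₄ ≠ 1) (P : Finset V) :
    ∃ f₁' f₂' f₃' f₄' Z, Cj d P f₁ f₁' ∧ Cj d P f₂ f₂' ∧ Cj d P f₃ f₃' ∧ Cj d P f₄ f₄' ∧
      P ⊆ Z ∧ P ⊆ f₄' • f₃' • f₂' • f₁' • Z ∧
      DInd d (f₁' • Z) Z (f₂' • f₁' • Z) ∧
      DInd d (f₃' • f₂' • f₁' • Z) (f₄' • f₃' • f₂' • f₁' • Z) (f₂' • f₁' • Z) := by
  obtain ⟨c₁, hc₁⟩ : ∃ c, c = f₄⁻¹ := ⟨_, rfl⟩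
  obtain ⟨c₂, hc₂⟩ : ∃ c, c = f₃⁻¹ := ⟨_, rfl⟩
  have hc₁' : c₁ ≠ 1 := by rw [hc₁]; simpa using h₄
  have hc₂' : c₂ ≠ 1 := by rw [hc₂]; simpa using h₃
  -- `Q` contains every base over which independence is stated below, and their preimages, so that
  -- conjugation over `Q` leaves them unchanged.
  set Q := P ∪ f₂ • P ∪ c₂ • P ∪ c₂⁻¹ • f₂ • P ∪ f₂⁻¹ • c₂ • P with hQ
  have hPQ : P ⊆ Q := by grind
  obtain ⟨a₁, ca₁, i₁, -⟩ := hΓ.mov_conj h₁ P Q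
  obtain ⟨b₁, cb₁, j₁, -⟩ := hΓ.mov_conj hc₁' P Q
  have iD : DInd d (a₁ • Q) P Q := hΓ.dim.ind_mono i₁.symm (by grind) (by grind)
  have jD : DInd d (b₁ • Q) P Q := hΓ.dim.ind_mono j₁.symm (by grind) (by grind)
  set D := a₁ • Q with hD
  set D' := b₁ • Q with hD'
  obtain ⟨a₂, ca₂, i₂⟩ := hΓ.conj_second h₂ hPQ (by grind) iD D'
  obtain ⟨b₂, cb₂, j₂⟩ := hΓ.conj_second hc₂' hPQ (by grind) jD (D ∪ a₂ • D)
  set C := a₂ • D with hC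
  set C' := b₂ • D' with hC'
  have e₁ : a₂⁻¹ • c₂ • P = f₂⁻¹ • c₂ • P := ca₂.inv.smul_eq (by grind) (by grind)
  have e₂ : b₂⁻¹ • f₂ • P = c₂⁻¹ • f₂ • P := cb₂.inv.smul_eq (by grind) (by grind)
  have k₁ : DInd d C' Q (D ∪ C ∪ D') :=
    hΓ.dim.ind_mono_right (hΓ.dim.ind_base j₂ (B' := Q) (by grind) (by grind)) (by grind)
  have k₂ : DInd d C Q (D ∪ D') :=
    hΓ.dim.ind_mono_right (hΓ.dim.ind_base i₂ (B' := Q) (by grind) (by grind)) (by grind)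
  have k₃ : DInd d D Q (C ∪ C') :=
    DInd.trans (hΓ.dim.ind_mono k₂.symm (by grind) (by grind))
      (hΓ.dim.ind_mono (hΓ.dim.ind_base k₁ (B' := Q ∪ C) (by grind) (by grind)).symm
        (by grind) (by grind))
  have k₄ : DInd d D' Q (C' ∪ C) := by
    rw [Finset.union_comm]
    exact DInd.trans (hΓ.dim.ind_mono k₂.symm (by grind) (by grind))
      (hΓ.dim.ind_mono (hΓ.dim.ind_base k₁ (B' := Q ∪ C) (by grind) (by grind)).symm
        (by grind) (by grind))
  have k₅ : DInd d C (f₂ • P) (Q ∪ D' ∪ C') :=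
    hΓ.dim.ind_mono_right (DInd.trans (C := Q ∪ D') (D := C')
      (hΓ.dim.ind_mono_right i₂ (by grind))
      (hΓ.dim.ind_mono (hΓ.dim.ind_base k₁ (B' := f₂ • P ∪ (Q ∪ D')) (by grind) (by grind)).symm
        (by grind) (by grind))) (by grind)
  -- `C` is reached forwards from `Q` by the first two maps, `C'` backwards by the inverses of the
  -- last two. Both halves are enlarged to meet in `C ∪ C'`.
  obtain ⟨a₁', a₂', Z, ha₁, ha₂, hQZ, hZ, iZ⟩ := hΓ.conj_meet (a₁ := a₁) (ca₂.ne_one h₂)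
    (Q := Q) (C' := C') (E := c₂ • P) (by grind) (by rw [e₁]; grind) k₃
    (hΓ.dim.ind_mono_right j₂ (by grind))
  obtain ⟨b₁', b₂', Z', hb₁, hb₂, hQZ', hZ', iZ'⟩ := hΓ.conj_meet (a₁ := b₁) (cb₂.ne_one hc₂')
    (Q := Q) (C' := C) (E := f₂ • P) (by grind) (by rw [e₂]; grind) k₄ k₅
  rw [← hD, ← hC] at hZ iZ
  rw [← hD', ← hC', Finset.union_comm] at hZ' iZ'
  have z₂ : b₂'⁻¹ • a₂' • a₁' • Z = b₁' • Z' := by rw [hZ, ← hZ', inv_smul_smul]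
  have z₁ : b₁'⁻¹ • b₂'⁻¹ • a₂' • a₁' • Z = Z' := by rw [z₂, inv_smul_smul]
  refine ⟨a₁', a₂', b₂'⁻¹, b₁'⁻¹, Z, ca₁.trans (hΓ.cj_mono hPQ ha₁),
    (hΓ.cj_mono hPQ ca₂).trans (hΓ.cj_mono hPQ ha₂), ?_, ?_, hPQ.trans hQZ, ?_, ?_, ?_⟩
  · have := ((hΓ.cj_mono hPQ cb₂).trans (hΓ.cj_mono hPQ hb₂)).inv
    rwa [hc₂, inv_inv] at this
  · have := (cb₁.trans (hΓ.cj_mono hPQ hb₁)).inv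
    rwa [hc₁, inv_inv] at this
  · rw [z₁]; exact hPQ.trans hQZ'
  · rwa [hZ]
  · rw [z₁, z₂, hZ]; exact iZ'

end DimAction

namespace DimAction

variable {Γ V : Type*} [Group Γ] [MulAction Γ V] {d : Finset V → ℤ} (hΓ : DimAction Γ d)

theorem smul_finset_congr {g h : Γ} {A : Finset V} (H : ∀ x ∈ A, g • x = h • x) :
    g • A = h • A := by
  ext y
  simp only [Finset.mem_smul_finset]
  constructor <;> rintro ⟨x, hx, rfl⟩
  · exact ⟨x, hx, (H x hx).symm⟩
  · exact ⟨x, hx, H x hx⟩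

-- The remaining hypotheses of `adjust_of_ind` are obtained by applying `conj_trajectory` to the
-- first two maps, and to the inverses of the last two from the other end; the middle set is
-- unaffected.
include hΓ in
theorem adjust_of_trajectory {f₁ f₂ f₃ f₄ : Γ} (h₁ : f₁ ≠ 1) (h₂ : f₂ ≠ 1) (h₃ : f₃ ≠ 1)
    (h₄ : f₄ ≠ 1) {P Z : Finset V} (hP₀ : P ⊆ Z) (hP₄ : P ⊆ f₄ • f₃ • f₂ • f₁ • Z)
    (hi₁ : DInd d (f₁ • Z) Z (f₂ • f₁ • Z))
    (hi₃ : DInd d (f₃ • f₂ • f₁ • Z) (f₄ • f₃ • f₂ • f₁ • Z) (f₂ • f₁ • Z))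
    {u : Γ} (hu : ∀ x ∈ dcl d Z, u • x = f₄ • f₃ • f₂ • f₁ • x) (T : Finset V) :
    ∃ f₁' f₂' f₃' f₄', Cj d P f₁ f₁' ∧ Cj d P f₂ f₂' ∧ Cj d P f₃ f₃' ∧ Cj d P f₄ f₄' ∧
      ∀ x ∈ dcl d T, u • x = f₄' • f₃' • f₂' • f₁' • x := by
  obtain ⟨g₁, g₂, c₁, c₂, e, i⟩ := hΓ.conj_trajectory hi₁ (Z ∪ T)
  set Z₄ := f₄ • f₃ • f₂ • f₁ • Z with hZ₄
  obtain ⟨g₄, g₃, c₄, c₃, e', i'⟩ := hΓ.conj_trajectory (a₁ := f₄⁻¹) (a₂ := f₃⁻¹) (Z := Z₄)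
    (by rw [hZ₄]; simpa only [inv_smul_smul] using hi₃) (u • (Z ∪ T))
  have hz₂ : g₂ • g₁ • Z = f₂ • f₁ • Z := by
    rw [← mul_smul, ← mul_smul]
    exact smul_finset_congr fun x hx => by
      rw [mul_smul, mul_smul, e x (subset_dcl d _ hx)]
  have hz₃ : g₃⁻¹ • f₂ • f₁ • Z = g₄ • Z₄ := by
    rw [inv_smul_eq_iff, ← mul_smul g₃ g₄]
    have : (g₃ * g₄) • Z₄ = (f₃⁻¹ * f₄⁻¹) • Z₄ := smul_finset_congr fun x hx => by
      rw [mul_smul, mul_smul, e' x (subset_dcl d _ hx)]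
    rw [this, hZ₄]; simp only [mul_smul, inv_smul_smul]
  obtain ⟨k₁, k₂, k₃, k₄, d₁, d₂, d₃, d₄, hk⟩ := hΓ.adjust_of_ind (c₁.ne_one h₁) (c₂.ne_one h₂)
    (f₃ := g₃⁻¹) (f₄ := g₄⁻¹)
    (inv_ne_one.2 (c₃.ne_one (inv_ne_one.2 h₃))) (inv_ne_one.2 (c₄.ne_one (inv_ne_one.2 h₄)))
    (P := P) (Z₀ := Z) (X := Z ∪ T) (u := u)
    rfl hz₂ hz₃ (inv_smul_smul _ _) hP₀ hP₄ Finset.subset_union_left i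
    (by
      simp only [hZ₄, inv_smul_smul] at i' ⊢
      exact i')
    (fun x hx => by
      rw [hu x hx, e x hx]
      have hw := e' (f₄ • f₃ • f₂ • f₁ • x)
        (hΓ.smul_mem_dcl (hΓ.smul_mem_dcl (hΓ.smul_mem_dcl (hΓ.smul_mem_dcl hx))))
      simp only [inv_smul_smul] at hw
      rw [← hw, inv_smul_smul, inv_smul_smul, hw])
  exact ⟨k₁, k₂, k₃, k₄, (hΓ.cj_mono hP₀ c₁).trans d₁, (hΓ.cj_mono hP₀ c₂).trans d₂,
    by simpa using ((hΓ.cj_mono hP₄ c₃).inv).trans d₃,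
    by simpa using ((hΓ.cj_mono hP₄ c₄).inv).trans d₄,
    fun x hx => hk x (hΓ.dim.dcl_mono Finset.subset_union_right hx)⟩

/-! ### Approximate solutions and their limits -/

/-- The product of four conjugates of `g`. -/
def prodConj (g : Γ) (h : Fin 4 → Γ) : Γ :=
  (h 3 * g * (h 3)⁻¹) * ((h 2 * g * (h 2)⁻¹) * ((h 1 * g * (h 1)⁻¹) * (h 0 * g * (h 0)⁻¹)))

theorem prodConj_smul (g : Γ) (h : Fin 4 → Γ) (x : V) :
    prodConj g h • x = (h 3 * g * (h 3)⁻¹) • (h 2 * g * (h 2)⁻¹) • (h 1 * g * (h 1)⁻¹) •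
      (h 0 * g * (h 0)⁻¹) • x := by
  simp only [prodConj, mul_smul]

/-- `h'` arises from `h` by left multiplication with elements fixing the closure of `P`. -/
def Near (d : Finset V → ℤ) (P : Finset V) (h h' : Fin 4 → Γ) : Prop :=
  ∀ i, ∃ b : Γ, Fx d P b ∧ h' i = b * h i

/-- Every element agreeing with `prodConj g h` on the closure of `Y` can be approximated by
products `prodConj g h'` with `h'` near `h`. -/
def Good (d : Finset V → ℤ) (g : Γ) (h : Fin 4 → Γ) (P Y : Finset V) : Prop :=
  ∀ u : Γ, (∀ x ∈ dcl d Y, u • x = prodConj g h • x) →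
    ∀ T : Finset V, ∃ h', Near d P h h' ∧ ∀ x ∈ dcl d T, u • x = prodConj g h' • x

theorem Near.trans {P : Finset V} {h h' h'' : Fin 4 → Γ} (a : Near d P h h')
    (b : Near d P h' h'') : Near d P h h'' := fun i => by
  obtain ⟨x, hx, e⟩ := a i
  obtain ⟨y, hy, e'⟩ := b i
  exact ⟨y * x, hy.mul hx, by rw [e', e, mul_assoc]⟩

include hΓ

theorem near_mono {P P' : Finset V} {h h' : Fin 4 → Γ} (hP : P ⊆ P') (a : Near d P' h h') :
    Near d P h h' := fun i => by
  obtain ⟨x, hx, e⟩ := a i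
  exact ⟨x, hΓ.fx_mono hP hx, e⟩

theorem good_mono {g : Γ} {h : Fin 4 → Γ} {P Y Y' : Finset V} (hY : Y ⊆ Y')
    (a : Good d g h P Y) : Good d g h P Y' :=
  fun u hu T => a u (fun x hx => hu x (hΓ.dim.dcl_mono hY hx)) T

omit hΓ in
theorem near_of_cj {g : Γ} {P : Finset V} {h : Fin 4 → Γ} {f : Fin 4 → Γ}
    (H : ∀ i, Cj d P (h i * g * (h i)⁻¹) (f i)) :
    ∃ h', Near d P h h' ∧ ∀ i, h' i * g * (h' i)⁻¹ = f i := by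
  choose b hb e using H
  refine ⟨fun i => b i * h i, fun i => ⟨b i, hb i, rfl⟩, fun i => ?_⟩
  rw [e]; group

theorem good_of_trajectory {g : Γ} (hg : g ≠ 1) (h : Fin 4 → Γ) {f : Fin 4 → Γ}
    (hf : ∀ i, h i * g * (h i)⁻¹ = f i) {P Z : Finset V} (hP₀ : P ⊆ Z)
    (hP₄ : P ⊆ f 3 • f 2 • f 1 • f 0 • Z)
    (hi₁ : DInd d (f 0 • Z) Z (f 1 • f 0 • Z))
    (hi₃ : DInd d (f 2 • f 1 • f 0 • Z) (f 3 • f 2 • f 1 • f 0 • Z) (f 1 • f 0 • Z)) :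
    Good d g h P Z := by
  intro u hu T
  have hne : ∀ i, f i ≠ 1 := fun i => by rw [← hf i]; simpa using hg
  obtain ⟨k₁, k₂, k₃, k₄, d₁, d₂, d₃, d₄, hk⟩ := hΓ.adjust_of_trajectory (hne 0) (hne 1)
    (hne 2) (hne 3) hP₀ hP₄ hi₁ hi₃ (u := u)
    (fun x hx => by rw [hu x hx, prodConj]; simp only [hf, mul_smul]) T
  obtain ⟨h', n, e⟩ := near_of_cj (d := d) (g := g) (P := P) (h := h) (f := ![k₁, k₂, k₃, k₄])
    (by
      intro i
      rw [hf]
      fin_cases i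
      exacts [d₁, d₂, d₃, d₄])
  refine ⟨h', n, fun x hx => ?_⟩
  rw [hk x hx, prodConj]
  simp [e, mul_smul]

/-- The empty trajectory is independent for trivial reasons; this starts the approximation. -/
theorem good_empty {g : Γ} (hg : g ≠ 1) (h : Fin 4 → Γ) : Good d g h ∅ ∅ :=
  hΓ.good_of_trajectory hg h (fun _ => rfl) subset_rfl (Finset.empty_subset _)
    (by simpa using DInd.base_right d ∅ ∅) (by simpa using DInd.base_right d ∅ ∅)

theorem exists_good {g : Γ} (hg : g ≠ 1) (h : Fin 4 → Γ) (P : Finset V) :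
    ∃ h' Y, Near d P h h' ∧ Good d g h' P Y := by
  have hne : ∀ i, h i * g * (h i)⁻¹ ≠ 1 := fun i => by simpa using hg
  obtain ⟨f₁, f₂, f₃, f₄, Z, c₁, c₂, c₃, c₄, hP, hP', i₁, i₂⟩ :=
    hΓ.exists_trajectory (hne 0) (hne 1) (hne 2) (hne 3) P
  obtain ⟨h', n, e⟩ := near_of_cj (d := d) (g := g) (P := P) (h := h) (f := ![f₁, f₂, f₃, f₄])
    (by
      intro i
      fin_cases i
      exacts [c₁, c₂, c₃, c₄])
  exact ⟨h', Z, n, hΓ.good_of_trajectory hg h' e hP (by simpa using hP') (by simpa using i₁)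
    (by simpa using i₂)⟩

theorem conj_eqOn {f b : Γ} {P A : Finset V} (hb : Fx d P b) (hA : A ⊆ P) (hfA : f • A ⊆ P) :
    ∀ x ∈ dcl d A, (b * f * b⁻¹) • x = f • x := by
  intro x hx
  rw [mul_smul, mul_smul, hb.inv x (hΓ.dim.dcl_mono hA hx),
    hb _ (hΓ.dim.dcl_mono hfA (hΓ.smul_mem_dcl hx))]

/-- Continuity of the product: it suffices that the corrections fix all intermediate images of `Y`.
-/
theorem prodConj_near (g : Γ) (h : Fin 4 → Γ) (Y : Finset V) :
    ∃ P, ∀ h', Near d P h h' → ∀ x ∈ dcl d Y, prodConj g h' • x = prodConj g h • x := by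
  obtain ⟨f, hf⟩ : ∃ f : Fin 4 → Γ, ∀ i, h i * g * (h i)⁻¹ = f i := ⟨_, fun _ => rfl⟩
  refine ⟨Y ∪ f 0 • Y ∪ f 1 • f 0 • Y ∪ f 2 • f 1 • f 0 • Y ∪ f 3 • f 2 • f 1 • f 0 • Y, ?_⟩
  intro h' n x hx
  choose b hb e using n
  have e' : ∀ i, h' i * g * (h' i)⁻¹ = b i * f i * (b i)⁻¹ := fun i => by
    rw [e, ← hf]; group
  simp only [prodConj_smul, e', hf]
  rw [hΓ.conj_eqOn (hb 0) (A := Y) (by grind) (by grind) x hx]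
  have h1 := hΓ.smul_mem_dcl (g := f 0) hx
  rw [hΓ.conj_eqOn (hb 1) (A := f 0 • Y) (by grind) (by grind) _ h1]
  have h2 := hΓ.smul_mem_dcl (g := f 1) h1
  rw [hΓ.conj_eqOn (hb 2) (A := f 1 • f 0 • Y) (by grind) (by grind) _ h2]
  have h3 := hΓ.smul_mem_dcl (g := f 2) h2
  rw [hΓ.conj_eqOn (hb 3) (A := f 2 • f 1 • f 0 • Y) (by grind) (by grind) _ h3]

/-- First `h'` is made good by a change too small to destroy the agreement on `Y`. Goodness of `h`
then lets `h` catch up on a larger set. The outcome is the same situation with the two sides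
exchanged and `k` inverted, so that the step can be repeated. -/
theorem half_step {g : Γ} (hg : g ≠ 1) {k : Γ} {h h' : Fin 4 → Γ} {P Y : Finset V}
    (Q F : Finset V) (hgood : Good d g h P Y)
    (heq : ∀ x ∈ dcl d Y, prodConj g h • x = prodConj g h' • k • x) :
    ∃ h₁ h₁' P' Y', Near d P h h₁ ∧ Near d Q h' h₁' ∧ Q ⊆ P' ∧ F ⊆ P' ∧
      (∀ i, h₁' i • F ⊆ P') ∧ F ⊆ Y' ∧ Good d g h₁' P' Y' ∧
      ∀ x ∈ dcl d Y', prodConj g h₁' • x = prodConj g h₁ • k⁻¹ • x := by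
  obtain ⟨P₀, hP₀⟩ := hΓ.prodConj_near g h' (k • Y)
  obtain ⟨P', hP'⟩ : ∃ P', P' = Q ∪ F ∪ P₀ ∪ Finset.univ.biUnion fun i => h' i • F := ⟨_, rfl⟩
  have hF : ∀ i, h' i • F ⊆ P' := fun i => by
    rw [hP']
    exact (Finset.subset_biUnion_of_mem (fun i => h' i • F) (Finset.mem_univ i)).trans
      Finset.subset_union_right
  obtain ⟨h₁', Y₀, n', hgood'⟩ := hΓ.exists_good hg h' P'
  obtain ⟨h₁, n, e⟩ := hgood (prodConj g h₁' * k) (fun x hx => by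
    rw [heq x hx, mul_smul]
    exact hP₀ h₁' (hΓ.near_mono (by grind) n') _ (hΓ.smul_mem_dcl hx)) (k⁻¹ • (Y₀ ∪ F))
  refine ⟨h₁, h₁', P', Y₀ ∪ F, n, hΓ.near_mono (by grind) n', by grind, by grind, ?_, by grind,
    hΓ.good_mono (by grind) hgood', ?_⟩
  · intro i
    obtain ⟨b, hb, e⟩ := n' i
    rw [e, mul_smul, hb.smul_eq (hF i)]
    exact hF i
  · intro x hx
    rw [← e _ (hΓ.smul_mem_dcl hx), mul_smul, smul_inv_smul]

/-- The data of an approximate solution of `prodConj g h = prodConj g h' * k`. -/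
structure _root_.ApproxSol (d : Finset V → ℤ) (g k : Γ) where
  h : Fin 4 → Γ
  h' : Fin 4 → Γ
  P : Finset V
  Q : Finset V
  Y : Finset V
  good : Good d g h P Y
  eq : ∀ x ∈ dcl d Y, prodConj g h • x = prodConj g h' • k • x

theorem full_step {g : Γ} (hg : g ≠ 1) {k : Γ} (s : ApproxSol d g k) (F : Finset V) :
    ∃ t : ApproxSol d g k, Near d s.P s.h t.h ∧ Near d s.Q s.h' t.h' ∧ s.P ⊆ t.P ∧ s.Q ⊆ t.Q ∧
      F ⊆ t.P ∧ F ⊆ t.Q ∧ (∀ i, t.h i • F ⊆ t.P) ∧ (∀ i, t.h' i • F ⊆ t.Q) ∧ F ⊆ t.Y := by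
  obtain ⟨h₁, h₁', P', Y', n, n', hQ, hF, hi, -, hgood, heq⟩ := hΓ.half_step hg s.Q F s.good s.eq
  obtain ⟨h₂', h₂, P₂, Y₂, m', m, hP, hF₂, hi₂, hY, hgood₂, heq₂⟩ :=
    hΓ.half_step hg s.P F hgood heq
  refine ⟨⟨h₂, h₂', P₂, P', Y₂, hgood₂, by simpa using heq₂⟩, n.trans m,
    n'.trans (hΓ.near_mono hQ m'), hP, hQ, hF₂, hF, hi₂, ?_, hY⟩
  intro i
  obtain ⟨b, hb, e⟩ := m' i
  simp only
  rw [e, mul_smul, hb.smul_eq (hi i)]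
  exact hi i

/-- Conjugators change by left factors fixing `P n`, so it is their inverses that stabilise on `P
n`; the limit is taken of these. Surjectivity of the limit is the reason for recording the images of
`F n` in `P (n + 1)`. -/
theorem near_limit {F : ℕ → Finset V} (hF : Monotone F) (hF' : ∀ x, ∃ i, x ∈ F i)
    (h : ℕ → Fin 4 → Γ) (P : ℕ → Finset V) (hP : ∀ n, P n ⊆ P (n + 1))
    (hn : ∀ n, Near d (P n) (h n) (h (n + 1))) (hFP : ∀ n, F n ⊆ P (n + 1))
    (hhP : ∀ n i, h (n + 1) i • F n ⊆ P (n + 1)) :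
    ∃ q : Fin 4 → Γ, ∀ i (x : V), ∃ N, ∀ n ≥ N, h n i • x = q i • x ∧ (h n i)⁻¹ • x = (q i)⁻¹ • x := by
  have hPm : Monotone P := monotone_nat_of_le_succ hP
  have key : ∀ i, ∃ q : Γ, ∀ n, ∀ x ∈ P n, q • x = (h n i)⁻¹ • x := by
    intro i
    refine hΓ.lim (fun n => (h n i)⁻¹) P hPm ?_ ?_ ?_
    · intro x
      obtain ⟨j, hj⟩ := hF' x
      exact ⟨j + 1, hFP j hj⟩
    · intro n x hx
      obtain ⟨b, hb, e⟩ := hn n i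
      simp only [e, mul_inv_rev, mul_smul]
      rw [hb.inv x (subset_dcl d _ hx)]
    · intro x
      obtain ⟨j, hj⟩ := hF' x
      exact ⟨j + 1, by simpa using hhP j i (Finset.smul_mem_smul_finset hj)⟩
  choose q hq using key
  refine ⟨fun i => (q i)⁻¹, fun i x => ?_⟩
  obtain ⟨j, hj⟩ := hF' x
  refine ⟨j + 1, fun n hn => ⟨?_, ?_⟩⟩
  · obtain ⟨l, rfl⟩ : ∃ l, n = l + 1 := ⟨n - 1, by omega⟩
    have h1 := hq i _ _ (hhP l i (Finset.smul_mem_smul_finset (hF (by omega) hj)))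
    rw [inv_smul_smul] at h1
    rw [eq_inv_smul_iff, h1]
  · rw [inv_inv, hq i n x (hPm hn (hFP j hj))]

omit hΓ in
theorem prodConj_limit (g : Γ) {h : ℕ → Fin 4 → Γ} {q : Fin 4 → Γ}
    (H : ∀ i (x : V), ∃ N, ∀ n ≥ N, h n i • x = q i • x ∧ (h n i)⁻¹ • x = (q i)⁻¹ • x) (x : V) :
    ∃ N, ∀ n ≥ N, prodConj g (h n) • x = prodConj g q • x := by
  have key : ∀ i (x : V), ∃ N, ∀ n ≥ N,
      (h n i * g * (h n i)⁻¹) • x = (q i * g * (q i)⁻¹) • x := by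
    intro i x
    obtain ⟨N₁, h₁⟩ := H i x
    obtain ⟨N₂, h₂⟩ := H i (g • (q i)⁻¹ • x)
    refine ⟨max N₁ N₂, fun n hn => ?_⟩
    simp only [mul_smul]
    rw [(h₁ n (le_trans (le_max_left _ _) hn)).2, (h₂ n (le_trans (le_max_right _ _) hn)).1]
  obtain ⟨N₀, h₀⟩ := key 0 x
  obtain ⟨N₁, h₁⟩ := key 1 ((q 0 * g * (q 0)⁻¹) • x)
  obtain ⟨N₂, h₂⟩ := key 2 ((q 1 * g * (q 1)⁻¹) • (q 0 * g * (q 0)⁻¹) • x)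
  obtain ⟨N₃, h₃⟩ := key 3 ((q 2 * g * (q 2)⁻¹) • (q 1 * g * (q 1)⁻¹) • (q 0 * g * (q 0)⁻¹) • x)
  refine ⟨N₀ + N₁ + N₂ + N₃, fun n hn => ?_⟩
  rw [prodConj_smul, prodConj_smul, h₀ n (by omega), h₁ n (by omega), h₂ n (by omega),
    h₃ n (by omega)]

/-- Every element is the product of four conjugates of `g⁻¹` and four conjugates of `g`. -/
theorem exists_prodConj [Countable V] {g : Γ} (hg : g ≠ 1) (k : Γ) :
    ∃ q q' : Fin 4 → Γ, k = (prodConj g q')⁻¹ * prodConj g q := by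
  obtain ⟨e, he⟩ := exists_injective_nat V
  obtain ⟨F, hF, hF'⟩ : ∃ F : ℕ → Finset V, Monotone F ∧ ∀ x, ∃ i, x ∈ F i := by
    have hfin : ∀ n, {x | e x < n}.Finite := fun n =>
      (Set.finite_Iio n).preimage he.injOn
    refine ⟨fun n => (hfin n).toFinset, fun a b hab x hx => ?_, fun x => ⟨e x + 1, ?_⟩⟩
    · simp at hx ⊢; omega
    · simp
  choose nxt hnxt using fun s F => hΓ.full_step hg (k := k) s F
  -- Initially nothing has to be checked beyond the closure of the empty set, which the whole group
  -- fixes pointwise.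
  let s₀ : ApproxSol d g k := ⟨1, 1, ∅, ∅, ∅, hΓ.good_empty hg 1, fun x hx => by
    rw [← mul_smul, hΓ.fix_empty _ x hx, hΓ.fix_empty _ x hx]⟩
  let s : ℕ → ApproxSol d g k := fun n => Nat.rec s₀ (fun n t => nxt t (F n)) n
  have hs : ∀ n, s (n + 1) = nxt (s n) (F n) := fun n => rfl
  have H : ∀ n, _ := fun n => hnxt (s n) (F n)
  simp only [← hs] at H
  obtain ⟨q, hq⟩ := hΓ.near_limit hF hF' (fun n => (s n).h) (fun n => (s n).P)
    (fun n => (H n).2.2.1) (fun n => (H n).1) (fun n => (H n).2.2.2.2.1)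
    (fun n => (H n).2.2.2.2.2.2.1)
  obtain ⟨q', hq'⟩ := hΓ.near_limit hF hF' (fun n => (s n).h') (fun n => (s n).Q)
    (fun n => (H n).2.2.2.1) (fun n => (H n).2.1) (fun n => (H n).2.2.2.2.2.1)
    (fun n => (H n).2.2.2.2.2.2.2.1)
  refine ⟨q, q', hΓ.faithful _ _ fun x => ?_⟩
  rw [mul_smul, eq_inv_smul_iff]
  obtain ⟨N₁, h₁⟩ := prodConj_limit g hq x
  obtain ⟨N₂, h₂⟩ := prodConj_limit g hq' (k • x)
  obtain ⟨j, hj⟩ := hF' x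
  have hx : x ∈ F (N₁ + N₂ + j) := hF (by omega) hj
  rw [← h₁ (N₁ + N₂ + j + 1) (by omega), ← h₂ (N₁ + N₂ + j + 1) (by omega)]
  exact ((s (N₁ + N₂ + j + 1)).eq x (subset_dcl d _ ((H (N₁ + N₂ + j)).2.2.2.2.2.2.2.2 hx))).symm

omit hΓ in
theorem exists_list_prodConj (g : Γ) (q : Fin 4 → Γ) :
    ∃ l : List Γ, l.length = 4 ∧ (∀ x ∈ l, IsConj g x) ∧ l.prod = prodConj g q := by
  have hc : ∀ a : Γ, IsConj g (a * g * a⁻¹) := fun a => isConj_iff.2 ⟨a, rfl⟩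
  refine ⟨[q 3 * g * (q 3)⁻¹, q 2 * g * (q 2)⁻¹, q 1 * g * (q 1)⁻¹, q 0 * g * (q 0)⁻¹], rfl, ?_,
    by simp [prodConj]⟩
  intro x hx
  simp only [List.mem_cons, List.not_mem_nil, or_false] at hx
  rcases hx with rfl | rfl | rfl | rfl <;> exact hc _

/-- Every element is a product of `2 * N` conjugates of `g` and `g⁻¹`, for `N ≥ 4`. -/
theorem exists_list [Countable V] {g : Γ} (hg : g ≠ 1) (k : Γ) (N : ℕ) :
    ∃ l : List Γ, l.length = 8 + 2 * N ∧ (∀ x ∈ l, IsConj g x ∨ IsConj g⁻¹ x) ∧ l.prod = k := by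
  obtain ⟨q, q', rfl⟩ := hΓ.exists_prodConj hg k
  obtain ⟨l, hl, hc, hp⟩ := exists_list_prodConj g q
  obtain ⟨l', hl', hc', hp'⟩ := exists_list_prodConj g q'
  -- Eight factors suffice; `N` cancelling pairs adjust the length.
  refine ⟨(List.replicate N [g, g⁻¹]).flatten ++ ((l'.map (·⁻¹)).reverse ++ l), ?_, ?_, ?_⟩
  · simp [hl, hl']; omega
  · intro x hx
    simp only [List.mem_append, List.mem_flatten, List.mem_replicate, List.mem_reverse,
      List.mem_map] at hx
    rcases hx with ⟨m, ⟨-, rfl⟩, hx⟩ | ⟨y, hy, rfl⟩ | hx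
    · simp only [List.mem_cons, List.not_mem_nil, or_false] at hx
      rcases hx with rfl | rfl
      · exact Or.inl (IsConj.refl _)
      · exact Or.inr (IsConj.refl _)
    · obtain ⟨c, rfl⟩ := isConj_iff.1 (hc' y hy)
      exact Or.inr (isConj_iff.2 ⟨c, by group⟩)
    · exact Or.inl (hc x hx)
  · have h1 : ((List.replicate N [g, g⁻¹]).flatten).prod = 1 := by
      rw [List.prod_flatten]; simp
    rw [List.prod_append, List.prod_append, h1, hp, one_mul, ← List.prod_inv_reverse, hp']

end DimAction

/-! ### The predimension on finite subsets of a hypergraph -/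

namespace UHypergraph

variable {r : ℕ} {V W : Type*}

/-- The edges contained in a finite set. -/
def ein (H : UHypergraph r V) (A : Finset V) : Finset (Finset V) :=
  A.powerset.filter (· ∈ H.edges)

/-- The predimension of a finite set. -/
def pd (n m : ℕ) (H : UHypergraph r V) (A : Finset V) : ℤ :=
  (n : ℤ) * A.card - (m : ℤ) * (H.ein A).card

/-- The edges inside `A ∪ B` which are neither in `A` nor in `B`. -/
def cross (H : UHypergraph r V) (A B : Finset V) : Finset (Finset V) :=
  H.ein (A ∪ B) \ (H.ein A ∪ H.ein B)

/-- The predimension is nonnegative on all finite sets. -/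
def Pos (n m : ℕ) (H : UHypergraph r V) : Prop :=
  ∀ A : Finset V, 0 ≤ H.pd n m A

/-- The dimension of a finite set: the least predimension of a finite superset. -/
def fd (n m : ℕ) (H : UHypergraph r V) (A : Finset V) : ℤ :=
  sInf {x | ∃ B, A ⊆ B ∧ x = H.pd n m B}

/-- The predimension does not drop on finite supersets of `Z`. -/
def FStrong (n m : ℕ) (H : UHypergraph r V) (Z : Finset V) : Prop :=
  ∀ B, Z ⊆ B → H.pd n m Z ≤ H.pd n m B

theorem mem_ein {H : UHypergraph r V} {A e : Finset V} : e ∈ H.ein A ↔ e ⊆ A ∧ e ∈ H.edges := by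
  simp [ein]

theorem mem_cross {H : UHypergraph r V} {A B e : Finset V} :
    e ∈ H.cross A B ↔ e ∈ H.edges ∧ e ⊆ A ∪ B ∧ ¬ e ⊆ A ∧ ¬ e ⊆ B := by
  simp only [cross, Finset.mem_sdiff, Finset.mem_union, mem_ein]
  tauto

/-- The defect of modularity is exactly `m` for each edge that is split between `A` and `B`. The
counting arguments with edges rest on this identity. -/
theorem pd_union_add_inter (n m : ℕ) (H : UHypergraph r V) (A B : Finset V) :
    H.pd n m (A ∪ B) + H.pd n m (A ∩ B) + m * (H.cross A B).card = H.pd n m A + H.pd n m B := by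
  have h1 := Finset.card_union_add_card_inter A B
  have h2 := Finset.card_union_add_card_inter (H.ein A) (H.ein B)
  have h3 : H.ein A ∩ H.ein B = H.ein (A ∩ B) := by
    ext e; simp only [Finset.mem_inter, mem_ein, Finset.subset_inter_iff]; tauto
  have h4 : (H.cross A B).card + (H.ein A ∪ H.ein B).card = (H.ein (A ∪ B)).card := by
    apply Finset.card_sdiff_add_card_eq_card
    intro e
    simp only [Finset.mem_union, mem_ein]
    rintro (⟨h, h'⟩ | ⟨h, h'⟩)
    · exact ⟨h.trans Finset.subset_union_left, h'⟩
    · exact ⟨h.trans Finset.subset_union_right, h'⟩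
  rw [h3] at h2
  unfold pd
  zify at h1 h2 h4
  linear_combination (n : ℤ) * h1 - (m : ℤ) * h2 + (m : ℤ) * h4

theorem pd_submod (n m : ℕ) (H : UHypergraph r V) (A B : Finset V) :
    H.pd n m (A ∪ B) + H.pd n m (A ∩ B) ≤ H.pd n m A + H.pd n m B := by
  have h1 := H.pd_union_add_inter n m A B
  have h2 : (0 : ℤ) ≤ m * (H.cross A B).card := by positivity
  omega

theorem pd_empty (n m : ℕ) (H : UHypergraph r V) (hr : r ≠ 0) : H.pd n m ∅ = 0 := by
  have : H.ein ∅ = ∅ := by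
    ext e
    simp only [mem_ein, Finset.subset_empty, Finset.notMem_empty, iff_false, not_and]
    rintro rfl h
    exact hr (H.card_edge _ h).symm
  simp [pd, this]

theorem pd_singleton_le (n m : ℕ) (H : UHypergraph r V) (w : V) : H.pd n m {w} ≤ n := by
  have : (0 : ℤ) ≤ m * (H.ein {w}).card := by positivity
  simp only [pd, Finset.card_singleton]
  push_cast
  omega

/-! ### The dimension derived from the predimension -/

section Dimension

variable {n m : ℕ} {H : UHypergraph r V} (hp : H.Pos n m)
include hp

theorem fd_le {A B : Finset V} (h : A ⊆ B) : H.fd n m A ≤ H.pd n m B :=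
  csInf_le ⟨0, by rintro _ ⟨C, -, rfl⟩; exact hp C⟩ ⟨B, h, rfl⟩

omit hp in
theorem le_fd {A : Finset V} {c : ℤ} (h : ∀ B, A ⊆ B → c ≤ H.pd n m B) : c ≤ H.fd n m A :=
  le_csInf ⟨_, A, subset_rfl, rfl⟩ (by rintro _ ⟨B, hB, rfl⟩; exact h B hB)

theorem exists_pd_eq_fd (A : Finset V) : ∃ Z, A ⊆ Z ∧ H.pd n m Z = H.fd n m A := by
  obtain ⟨Z, hZ, h⟩ := Int.csInf_mem (s := {x | ∃ B, A ⊆ B ∧ x = H.pd n m B})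
    ⟨_, A, subset_rfl, rfl⟩ ⟨0, by rintro _ ⟨C, -, rfl⟩; exact hp C⟩
  exact ⟨Z, hZ, h.symm⟩

theorem fd_isDim : IsDim (H.fd n m) where
  mono A B h := le_fd fun _ hC => fd_le hp (h.trans hC)
  submod A B := by
    obtain ⟨Y, hY, e⟩ := exists_pd_eq_fd hp A
    obtain ⟨Z, hZ, e'⟩ := exists_pd_eq_fd hp B
    have := H.pd_submod n m Y Z
    have := fd_le hp (Finset.union_subset_union hY hZ)
    have := fd_le hp (Finset.inter_subset_inter hY hZ)
    omega

theorem fd_nonneg (A : Finset V) : 0 ≤ H.fd n m A :=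
  le_fd fun B _ => hp B

theorem FStrong.fd_eq {Z : Finset V} (h : H.FStrong n m Z) : H.fd n m Z = H.pd n m Z :=
  le_antisymm (fd_le hp subset_rfl) (le_fd h)

theorem fStrong_of_pd_le {Z : Finset V} (h : H.pd n m Z ≤ H.fd n m Z) : H.FStrong n m Z :=
  fun _ hB => h.trans (fd_le hp hB)

/-- Every finite set has a strong superset of the same dimension. -/
theorem exists_hull (A : Finset V) :
    ∃ Z, A ⊆ Z ∧ H.pd n m Z = H.fd n m A ∧ H.FStrong n m Z ∧ H.fd n m Z = H.fd n m A := by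
  obtain ⟨Z, hZ, e⟩ := exists_pd_eq_fd hp A
  have hs : H.FStrong n m Z := fun B hB => by rw [e]; exact fd_le hp (hZ.trans hB)
  exact ⟨Z, hZ, e, hs, by rw [hs.fd_eq hp, e]⟩

omit hp in
theorem FStrong.pd_inter_le {Z : Finset V} (h : H.FStrong n m Z) (B : Finset V) :
    H.pd n m (B ∩ Z) ≤ H.pd n m B := by
  have := H.pd_submod n m B Z
  have := h (B ∪ Z) Finset.subset_union_right
  omega

omit hp in
theorem FStrong.inter {Y Z : Finset V} (hY : H.FStrong n m Y) (hZ : H.FStrong n m Z) :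
    H.FStrong n m (Y ∩ Z) := by
  intro B hB
  have h1 := hY.pd_inter_le B
  have h2 := hZ.pd_inter_le (B ∩ Y)
  have h3 := H.pd_submod n m (B ∩ Y ∩ Z) (Y ∩ Z)
  rw [Finset.inter_assoc, Finset.inter_eq_right.2 hB] at h2
  omega

/-- The dimension of a subset of a strong set may be computed inside that set. -/
theorem FStrong.exists_hull {D Y : Finset V} (hD : H.FStrong n m D) (hY : Y ⊆ D) :
    ∃ T, Y ⊆ T ∧ T ⊆ D ∧ H.pd n m T = H.fd n m Y ∧ H.FStrong n m T := by
  obtain ⟨Z, hZ, e, -, -⟩ := UHypergraph.exists_hull hp Y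
  have h1 := hD.pd_inter_le Z
  have h2 := fd_le hp (Finset.subset_inter hZ hY)
  refine ⟨Z ∩ D, Finset.subset_inter hZ hY, Finset.inter_subset_right, by omega, fun B hB => ?_⟩
  have := fd_le hp ((Finset.subset_inter hZ hY).trans hB)
  omega

/-- If the dimension of a union is as large as possible, the union is a strong free amalgam. -/
theorem free_union {X Y : Finset V}
    (h : H.pd n m X + H.pd n m Y - H.pd n m (X ∩ Y) ≤ H.fd n m (X ∪ Y)) :
    H.FStrong n m (X ∪ Y) ∧ (1 ≤ m → ∀ e ∈ H.edges, e ⊆ X ∪ Y → e ⊆ X ∨ e ⊆ Y) := by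
  -- The hypothesis leaves no room for a positive defect, hence none for an edge split between `X`
  -- and `Y`.
  have h1 := H.pd_union_add_inter n m X Y
  have h2 : (0 : ℤ) ≤ m * (H.cross X Y).card := by positivity
  have h3 := fd_le hp (subset_refl (X ∪ Y))
  refine ⟨fStrong_of_pd_le hp (by omega), fun hm e he heXY => ?_⟩
  by_contra! hc
  have h4 : e ∈ H.cross X Y := mem_cross.2 ⟨he, heXY, hc.1, hc.2⟩
  have h5 : 0 < (H.cross X Y).card := Finset.card_pos.2 ⟨e, h4⟩
  have h6 : (0 : ℤ) < m * (H.cross X Y).card := by positivity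
  omega

/-- A finite set has a least strong superset. -/
theorem exists_least_hull (X : Finset V) :
    ∃ Z, X ⊆ Z ∧ H.FStrong n m Z ∧ H.pd n m Z = H.fd n m X ∧
      ∀ Y, X ⊆ Y → H.FStrong n m Y → Z ⊆ Y := by
  obtain ⟨Z, ⟨hZ, hs⟩, hmin⟩ := (measure (Finset.card (α := V))).wf.has_min
    {Z | X ⊆ Z ∧ H.FStrong n m Z} (by
      obtain ⟨Z, h, -, h', -⟩ := exists_hull hp X
      exact ⟨Z, h, h'⟩)
  have key : ∀ Y, X ⊆ Y → H.FStrong n m Y → Z ⊆ Y := by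
    intro Y hY hYs
    have := hmin (Z ∩ Y) ⟨Finset.subset_inter hZ hY, hs.inter hYs⟩
    have h2 := Finset.eq_of_subset_of_card_le (Finset.inter_subset_left (s₁ := Z) (s₂ := Y))
      (not_lt.1 this)
    exact Finset.inter_eq_left.1 h2
  refine ⟨Z, hZ, hs, le_antisymm ?_ (fd_le hp hZ), key⟩
  obtain ⟨Y, h, h', h'', -⟩ := exists_hull hp X
  rw [← h']
  exact hs Y (key Y h h'')

end Dimension

/-! #### Comparison with the definitions for sets -/

section Compare

variable {n m : ℕ} {H : UHypergraph r V}

theorem predim_coe (A : Finset V) : H.predim n m A = H.pd n m A := by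
  have : H.edgesIn A = (H.ein A : Set (Finset V)) := by
    ext e
    simp [edgesIn, mem_ein, and_comm]
  rw [predim, pd, this, Set.ncard_coe_finset, Set.ncard_coe_finset]

theorem inC0_iff (hr : r ≠ 0) : H.InC0 n m ↔ H.Pos n m := by
  have h0 : H.predim n m ∅ = 0 := by
    have := H.predim_coe (n := n) (m := m) ∅
    rwa [Finset.coe_empty, H.pd_empty n m hr] at this
  constructor
  · intro h A
    have := (h A A.finite_toSet).2 A (Set.empty_subset _) subset_rfl
    rwa [h0, predim_coe] at this
  · intro h X hX
    refine ⟨Set.empty_subset _, fun B _ hB => ?_⟩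
    lift B to Finset V using hX.subset hB
    rw [h0, predim_coe]
    exact h B

theorem strong_coe_iff {Z : Finset V} : H.Strong n m Z ↔ H.FStrong n m Z := by
  constructor
  · intro h B hB
    have := (h B B.finite_toSet).2 B Set.inter_subset_left subset_rfl
    rwa [Set.inter_eq_right.2 (Finset.coe_subset.2 hB), predim_coe, predim_coe] at this
  · intro h X hX
    refine ⟨Set.inter_subset_left, fun B hB hB' => ?_⟩
    lift X to Finset V using hX
    lift B to Finset V using X.finite_toSet.subset hB'
    have e : B ∩ Z = X ∩ Z := by
      ext x
      have h1 := @hB x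
      have h2 := @hB' x
      simp at h1 h2 ⊢
      tauto
    rw [← Finset.coe_inter, predim_coe, predim_coe, ← e]
    exact h.pd_inter_le B

/-- The closure is an intersection over possibly infinite strong sets. Each of these meets the least
finite hull `Z` in a strong set, which must then be all of `Z`. -/
theorem cl0_coe (hp : H.Pos n m) (X : Finset V) :
    ∃ Z : Finset V, H.cl0 n m X = Z ∧ H.pd n m Z = H.fd n m X := by
  obtain ⟨Z, hZ, hs, e, hl⟩ := exists_least_hull hp X
  refine ⟨Z, Set.Subset.antisymm ?_ ?_, e⟩
  · exact Set.sInter_subset_of_mem ⟨Finset.coe_subset.2 hZ, strong_coe_iff.2 hs⟩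
  · refine Set.subset_sInter ?_
    rintro Y ⟨hXY, hY⟩
    have h1 : H.FStrong n m (Z.filter (· ∈ Y)) := by
      intro B hB
      refine le_trans ?_ (hs.pd_inter_le B)
      have h2 := (hY Z Z.finite_toSet).2 ↑(B ∩ Z) ?_ (by simp)
      · rw [predim_coe] at h2
        rwa [show (Z : Set V) ∩ Y = ↑(Z.filter (· ∈ Y)) by ext; simp, predim_coe] at h2
      · rintro x ⟨hx, hx'⟩
        simp only [Finset.coe_inter, Set.mem_inter_iff, Finset.mem_coe]
        exact ⟨hB (Finset.mem_filter.2 ⟨hx, hx'⟩), hx⟩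
    intro x hx
    have := hl _ (fun y hy => Finset.mem_filter.2 ⟨hZ hy, hXY hy⟩) h1 hx
    exact (Finset.mem_filter.1 this).2

theorem dim_coe (hp : H.Pos n m) (X : Finset V) : H.dim n m X = H.fd n m X := by
  obtain ⟨Z, h, e⟩ := cl0_coe hp X
  rw [dim, h, predim_coe, e]

theorem clD_empty (hp : H.Pos n m) : H.clD n m ∅ = dcl (H.fd n m) ∅ := by
  ext a
  have h1 := dim_coe hp (∅ : Finset V)
  have h2 := dim_coe hp ({a} : Finset V)
  rw [Finset.coe_empty] at h1
  rw [Finset.coe_singleton] at h2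
  simp only [clD, dcl, Set.mem_ofPred_eq, Set.empty_union, h1, h2]
  rw [show insert a (∅ : Finset V) = {a} by rfl]

end Compare

/-! #### Partial isomorphisms -/

/-- `f` restricts to an isomorphism of the structure induced on `D` with the one on its image. -/
def IsoOn (K : UHypergraph r W) (H : UHypergraph r V) (f : W → V) (D : Finset W) : Prop :=
  Set.InjOn f D ∧ ∀ e, e ⊆ D → (e.image f ∈ H.edges ↔ e ∈ K.edges)

section IsoOn

variable {n m : ℕ} {K : UHypergraph r W} {H : UHypergraph r V} {f : W → V} {D : Finset W}

theorem IsoOn.mono (h : IsoOn K H f D) {A : Finset W} (hA : A ⊆ D) : IsoOn K H f A :=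
  ⟨h.1.mono (Finset.coe_subset.2 hA), fun e he => h.2 e (he.trans hA)⟩

theorem IsoOn.comp {U : Type*} {L : UHypergraph r U} {g : V → U} (hg : IsoOn H L g (D.image f))
    (h : IsoOn K H f D) : IsoOn K L (g ∘ f) D := by
  refine ⟨hg.1.comp h.1 fun x hx => Finset.mem_coe.2 (Finset.mem_image_of_mem f hx),
    fun e he => ?_⟩
  rw [← Finset.image_image, hg.2 _ (Finset.image_subset_image he), h.2 e he]

theorem IsoOn.pd_image (h : IsoOn K H f D) {A : Finset W} (hA : A ⊆ D) :
    H.pd n m (A.image f) = K.pd n m A := by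
  have hi := h.1.mono (Finset.coe_subset.2 hA)
  have h1 : H.ein (A.image f) = (K.ein A).image (Finset.image f) := by
    ext e
    simp only [mem_ein, Finset.mem_image]
    constructor
    · rintro ⟨he, he'⟩
      obtain ⟨e, hs, rfl⟩ := Finset.subset_image_iff.1 he
      exact ⟨e, ⟨Finset.coe_subset.1 hs, (h.2 e ((Finset.coe_subset.1 hs).trans hA)).1 he'⟩, rfl⟩
    · rintro ⟨e, ⟨hs, he⟩, rfl⟩
      exact ⟨Finset.image_subset_image hs, (h.2 e (hs.trans hA)).2 he⟩
  rw [pd, pd, Finset.card_image_of_injOn hi, h1, Finset.card_image_of_injOn]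
  intro a ha b hb hab
  have ha := (mem_ein.1 ha).1
  have hb := (mem_ein.1 hb).1
  refine Finset.coe_injective ((hi.image_eq_image_iff (Finset.coe_subset.2 ha)
    (Finset.coe_subset.2 hb)).1 ?_)
  rw [← Finset.coe_image, ← Finset.coe_image]
  exact congrArg _ hab

theorem IsoOn.exists_inverse (h : IsoOn K H f D) [Nonempty W] :
    ∃ g : V → W, IsoOn H K g (D.image f) ∧ ∀ x ∈ D, g (f x) = x := by
  refine ⟨Function.invFunOn f D, ?_, fun x hx => h.1.leftInvOn_invFunOn hx⟩
  have hl : ∀ x ∈ D, Function.invFunOn f D (f x) = x := fun x hx => h.1.leftInvOn_invFunOn hx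
  refine ⟨?_, fun e he => ?_⟩
  · rintro _ hx _ hy hxy
    obtain ⟨a, ha, rfl⟩ := Finset.mem_image.1 hx
    obtain ⟨b, hb, rfl⟩ := Finset.mem_image.1 hy
    rw [hl a ha, hl b hb] at hxy
    rw [hxy]
  · obtain ⟨e, hs, rfl⟩ := Finset.subset_image_iff.1 he
    have hs := Finset.coe_subset.1 hs
    have : (e.image f).image (Function.invFunOn f D) = e := by
      rw [Finset.image_image]
      conv_rhs => rw [← Finset.image_id (s := e)]
      exact Finset.image_congr fun x hx => hl x (hs hx)
    rw [this, h.2 e hs]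

/-- Dimensions of subsets of a strong set are attained by sets inside it, where `f` preserves the
predimension. -/
theorem IsoOn.fd_image (hK : K.Pos n m) (hH : H.Pos n m) (h : IsoOn K H f D)
    (hD : K.FStrong n m D) (hD' : H.FStrong n m (D.image f)) {A : Finset W} (hA : A ⊆ D) :
    H.fd n m (A.image f) = K.fd n m A := by
  apply le_antisymm
  · obtain ⟨T, hT, hT', e, -⟩ := hD.exists_hull hK hA
    rw [← e, ← h.pd_image hT']
    exact fd_le hH (Finset.image_subset_image hT)
  · obtain ⟨T, hT, hT', e, -⟩ := hD'.exists_hull hH (Finset.image_subset_image hA)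
    obtain ⟨T, hs, rfl⟩ := Finset.subset_image_iff.1 hT'
    have hs := Finset.coe_subset.1 hs
    rw [← e, h.pd_image hs]
    refine fd_le hK fun x hx => ?_
    obtain ⟨y, hy, hxy⟩ := Finset.mem_image.1 (hT (Finset.mem_image_of_mem f hx))
    rwa [← h.1 (hs hy) (hA hx) hxy]

end IsoOn

/-- `p` is an automorphism of `H`. -/
def IsAut (H : UHypergraph r V) (p : Equiv.Perm V) : Prop :=
  ∀ e : Finset V, e.image p ∈ H.edges ↔ e ∈ H.edges

section IsAut

variable {n m : ℕ} {H : UHypergraph r V} {p q : Equiv.Perm V}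

theorem isAut_iff : H.IsAut p ↔ H.IsEmbedding H p.toEmbedding := by
  simp only [IsAut, IsEmbedding, Finset.map_eq_image]
  rfl

theorem isAut_one : H.IsAut 1 := fun e => by
  rw [Equiv.Perm.coe_one, Finset.image_id]

theorem image_inv_image (p : Equiv.Perm V) (A : Finset V) : (A.image p).image ⇑p⁻¹ = A := by
  rw [Finset.image_image]
  conv_rhs => rw [← Finset.image_id (s := A)]
  exact Finset.image_congr fun x _ => by simp

theorem image_image_inv (p : Equiv.Perm V) (A : Finset V) : (A.image ⇑p⁻¹).image p = A := by
  rw [Finset.image_image]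
  conv_rhs => rw [← Finset.image_id (s := A)]
  exact Finset.image_congr fun x _ => by simp

theorem IsAut.inv (hp : H.IsAut p) : H.IsAut p⁻¹ := fun e => by
  rw [← hp, image_image_inv]

theorem IsAut.isoOn (hp : H.IsAut p) (D : Finset V) : IsoOn H H p D :=
  ⟨p.injective.injOn, fun e _ => hp e⟩

theorem IsAut.pd_image (hp : H.IsAut p) (A : Finset V) : H.pd n m (A.image p) = H.pd n m A :=
  (hp.isoOn A).pd_image subset_rfl

theorem IsAut.fd_image_le (hH : H.Pos n m) (hp : H.IsAut p) (A : Finset V) :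
    H.fd n m (A.image p) ≤ H.fd n m A := by
  obtain ⟨Z, hZ, e⟩ := exists_pd_eq_fd hH A
  rw [← e, ← hp.pd_image]
  exact fd_le hH (Finset.image_subset_image hZ)

theorem IsAut.fd_image (hH : H.Pos n m) (hp : H.IsAut p) (A : Finset V) :
    H.fd n m (A.image p) = H.fd n m A := by
  refine le_antisymm (hp.fd_image_le hH A) ?_
  have := hp.inv.fd_image_le hH (A.image p)
  rwa [image_inv_image] at this

theorem IsAut.fStrong_image (hp : H.IsAut p) {A : Finset V} (hA : H.FStrong n m A) :
    H.FStrong n m (A.image p) := by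
  intro B hB
  rw [hp.pd_image, ← hp.inv.pd_image B]
  apply hA
  have := Finset.image_subset_image (f := ⇑p⁻¹) hB
  rwa [image_inv_image] at this

end IsAut

end UHypergraph

namespace UHypergraph

variable {r : ℕ} {V W : Type*} {n m : ℕ} {H : UHypergraph r V}

/-! ### Realizing finite extensions -/

theorem IsoOn.fStrong_image {K : UHypergraph r W} {f : W → V} {D A : Finset W}
    (h : IsoOn K H f D) (hD : H.FStrong n m (D.image f)) (hA : A ⊆ D) (hs : K.FStrong n m A) :
    H.FStrong n m (A.image f) := by
  intro B hB
  refine le_trans ?_ (hD.pd_inter_le B)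
  obtain ⟨T, hT, e⟩ := Finset.subset_image_iff.1 (Finset.inter_subset_right (s₁ := B)
    (s₂ := D.image f))
  have hT := Finset.coe_subset.1 hT
  rw [← e, h.pd_image hT, h.pd_image hA]
  refine hs T fun x hx => ?_
  have h1 : f x ∈ T.image f := by
    rw [e, Finset.mem_inter]
    exact ⟨hB (Finset.mem_image_of_mem f hx), Finset.mem_image_of_mem f (hA hx)⟩
  obtain ⟨y, hy, hxy⟩ := Finset.mem_image.1 h1
  rwa [← h.1 (hT hy) (hA hx) hxy]

theorem IsGeneric.pos (hH : H.IsGeneric n m) (hr : r ≠ 0) : H.Pos n m :=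
  (inC0_iff hr).1 hH.inC0

/-- The hypergraph without edges. -/
def edgeless (r : ℕ) (W : Type*) : UHypergraph r W := ⟨∅, fun _ h => h.elim⟩

theorem pd_edgeless (A : Finset W) : (edgeless r W).pd n m A = n * A.card := by
  have : (edgeless r W).ein A = ∅ := by
    ext e
    simp [mem_ein, edgeless]
  simp [pd, this]

theorem IsGeneric.nonempty (hH : H.IsGeneric n m) (hr : r ≠ 0) : Nonempty V := by
  have hp := hH.pos hr
  have hpK : (edgeless r (Fin 1)).Pos n m := fun A => by rw [pd_edgeless]; positivity
  have h0 : ∀ {V : Type _} {K : UHypergraph r V}, K.Pos n m → K.FStrong n m ∅ := fun hK B _ => by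
    rw [pd_empty n m _ hr]; exact hK B
  obtain ⟨α, -⟩ := hH.extension (∅ : Finset V) (Finset.finite_toSet _) (strong_coe_iff.2 (h0 hp))
    (Fin 1) (edgeless r (Fin 1)) ((inC0_iff hr).2 hpK)
    ⟨fun x => 0, fun x => absurd x.2 (by simp)⟩
    (by
      intro e
      have : e = ∅ := Finset.eq_empty_of_forall_notMem fun x _ => absurd x.2 (by simp)
      subst this
      simp only [Finset.map_empty]
      constructor
      · exact fun h => h.elim
      · intro h
        exact absurd ((H.induce _).card_edge _ h) (by simpa using hr.symm))
    (by
      have := strong_coe_iff.2 (fun B _ => by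
        rw [pd_empty n m _ hr]; exact hpK B : (edgeless r (Fin 1)).FStrong n m ∅)
      convert this
      ext x
      simp)
  exact ⟨α 0⟩

/-- Strong extensions of a finite strong subset are realized in the generic structure. -/
theorem IsGeneric.realize (hH : H.IsGeneric n m) (hr : r ≠ 0) {S : Finset V}
    (hS : H.FStrong n m S) {K : UHypergraph r W} (hK : K.Pos n m) {D : Finset W} {j : V → W}
    (hj : IsoOn H K j S) (hjD : S.image j ⊆ D) (hjs : K.FStrong n m (S.image j)) :
    ∃ α : W → V, IsoOn K H α D ∧ (∀ x ∈ S, α (j x) = x) ∧ H.FStrong n m (D.image α) := by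
  obtain ⟨v₀⟩ := hH.nonempty hr
  -- The extension property only concerns finite structures in `Type`, so the structure on `D` is
  -- transported to `Fin D.card`.
  let ε : D ≃ Fin D.card := D.equivFin
  let ι : Fin D.card → W := fun i => ε.symm i
  have hι : Function.Injective ι := Subtype.val_injective.comp ε.symm.injective
  let K' : UHypergraph r (Fin D.card) :=
    ⟨{e | e.image ι ∈ K.edges}, fun e he => by
      rw [← K.card_edge _ he, Finset.card_image_of_injective _ hι]⟩
  have hιK : ∀ A, IsoOn K' K ι A := fun A => ⟨hι.injOn, fun e _ => Iff.rfl⟩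
  have hK' : K'.Pos n m := fun A => by rw [← (hιK A).pd_image subset_rfl]; exact hK _
  have hjm : ∀ x ∈ S, j x ∈ D := fun x hx => hjD (Finset.mem_image_of_mem j hx)
  let j' : (S : Set V) ↪ Fin D.card := ⟨fun x => ε ⟨j x, hjm x x.2⟩, fun x y hxy => by
    have := ε.injective hxy
    simp only [Subtype.mk.injEq] at this
    exact Subtype.ext (hj.1 x.2 y.2 this)⟩
  have hιj : ∀ x, ι (j' x) = j x := fun x => by simp [ι, j']
  let S' : Finset (Fin D.card) := Finset.univ.filter fun i => ι i ∈ S.image j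
  have hS'i : S'.image ι = S.image j := by
    ext y
    simp only [S', Finset.mem_image, Finset.mem_filter, Finset.mem_univ, true_and]
    constructor
    · rintro ⟨i, h, rfl⟩; exact h
    · rintro ⟨x, hx, rfl⟩
      exact ⟨j' ⟨x, hx⟩, ⟨x, hx, (hιj ⟨x, hx⟩).symm⟩, hιj ⟨x, hx⟩⟩
  have hrange : Set.range j' = (S' : Set (Fin D.card)) := by
    ext i
    simp only [S', Set.mem_range, Finset.coe_filter, Finset.mem_univ, true_and, Set.mem_ofPred_eq,
      Finset.mem_image]
    constructor
    · rintro ⟨x, rfl⟩; exact ⟨x, x.2, (hιj x).symm⟩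
    · rintro ⟨x, hx, e⟩
      exact ⟨⟨x, hx⟩, hι ((hιj _).trans e)⟩
  obtain ⟨α, hα, hαj, hαs⟩ := hH.extension S S.finite_toSet (strong_coe_iff.2 hS) (Fin D.card) K'
    ((inC0_iff hr).2 hK') j'
    (by
      intro e
      change (e.map j').image ι ∈ K.edges ↔ e.map (Function.Embedding.subtype _) ∈ H.edges
      rw [← hj.2 (e.map (Function.Embedding.subtype _)) (by
        intro x hx
        obtain ⟨y, -, rfl⟩ := Finset.mem_map.1 hx
        exact y.2), Finset.map_eq_image, Finset.map_eq_image, Finset.image_image,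
        Finset.image_image]
      rw [Finset.image_congr (g := j ∘ (Function.Embedding.subtype (· ∈ (S : Set V))))]
      intro x _
      exact hιj x)
    (by
      rw [hrange, strong_coe_iff]
      intro B hB
      rw [← (hιK S').pd_image subset_rfl, ← (hιK B).pd_image subset_rfl, hS'i]
      apply hjs
      rw [← hS'i]
      exact Finset.image_subset_image hB)
  have hιD : ∀ w ∈ D, ∃ i, ι i = w := fun w hw => ⟨ε ⟨w, hw⟩, by simp [ι]⟩
  -- The value outside `D` is arbitrary.
  let β : W → V := fun w => if h : w ∈ D then α (ε ⟨w, h⟩) else v₀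
  have hβ : ∀ i, β (ι i) = α i := fun i => by
    have : ι i ∈ D := (ε.symm i).2
    simp [β, this, ι]
  have hDι : D = Finset.univ.image ι := by
    ext w
    simp only [Finset.mem_image, Finset.mem_univ, true_and]
    exact ⟨hιD w, by rintro ⟨i, rfl⟩; exact (ε.symm i).2⟩
  refine ⟨β, ⟨?_, ?_⟩, ?_, ?_⟩
  · intro x hx y hy hxy
    obtain ⟨i, rfl⟩ := hιD x hx
    obtain ⟨k, rfl⟩ := hιD y hy
    rw [hβ, hβ] at hxy
    rw [α.injective hxy]
  · intro e he
    rw [hDι] at he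
    obtain ⟨e, -, rfl⟩ := Finset.subset_image_iff.1 he
    have h1 : (e.image ι).image β = e.map α := by
      rw [Finset.image_image, Finset.map_eq_image]
      exact Finset.image_congr fun i _ => hβ i
    rw [h1, hα e]
    rfl
  · intro x hx
    have h1 := hαj ⟨x, hx⟩
    rwa [← hβ, hιj] at h1
  · rw [← strong_coe_iff]
    convert hαs
    have h1 : D.image β = Finset.univ.image α := by
      conv_lhs => rw [hDι]
      rw [Finset.image_image]
      exact Finset.image_congr fun i _ => hβ i
    rw [h1]
    simp

/-! ### Limits of partial maps -/

theorem perm_inv_apply_self (p : Equiv.Perm V) (x : V) : p⁻¹ (p x) = x :=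
  p.symm_apply_apply x

theorem exists_perm_of_chain {f : ℕ → V → V} {F : ℕ → Finset V} (hF : Monotone F)
    (hcov : ∀ x, ∃ i, x ∈ F i) (hf : ∀ i, ∀ x ∈ F i, f (i + 1) x = f i x)
    (hinj : ∀ i, Set.InjOn (f i) (F i)) (hsurj : ∀ y, ∃ i, ∃ x ∈ F i, f i x = y) :
    ∃ p : Equiv.Perm V, ∀ i, ∀ x ∈ F i, p x = f i x := by
  have hst : ∀ i k, ∀ x ∈ F i, f (i + k) x = f i x := by
    intro i k
    induction k with
    | zero => intro x _; rfl
    | succ k ih =>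
      intro x hx
      rw [← ih x hx, ← add_assoc, hf _ x (hF (by omega) hx)]
  choose N hN using hcov
  have key : ∀ i, ∀ x ∈ F i, f (N x) x = f i x := by
    intro i x hx
    rw [← hst i (N x) x hx, ← hst (N x) i x (hN x), add_comm]
  refine ⟨Equiv.ofBijective (fun x => f (N x) x) ⟨?_, ?_⟩, fun i x hx => key i x hx⟩
  · intro x y hxy
    have hx := hF (le_max_left (N x) (N y)) (hN x)
    have hy := hF (le_max_right (N x) (N y)) (hN y)
    simp only [key _ x hx, key _ y hy] at hxy
    exact hinj _ hx hy hxy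
  · intro y
    obtain ⟨i, x, hx, rfl⟩ := hsurj y
    exact ⟨x, key i x hx⟩

theorem exists_subset_of_chain {F : ℕ → Finset V} (hF : Monotone F) (hcov : ∀ x, ∃ i, x ∈ F i)
    (e : Finset V) : ∃ i, e ⊆ F i := by
  induction e using Finset.induction_on with
  | empty => exact ⟨0, by simp⟩
  | insert a e _ ih =>
    obtain ⟨i, hi⟩ := ih
    obtain ⟨k, hk⟩ := hcov a
    exact ⟨max i k, Finset.insert_subset (hF (le_max_right _ _) hk)
      (hi.trans (hF (le_max_left _ _)))⟩

theorem exists_isAut_of_chain {f : ℕ → V → V} {F : ℕ → Finset V} (hF : Monotone F)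
    (hcov : ∀ x, ∃ i, x ∈ F i) (hf : ∀ i, ∀ x ∈ F i, f (i + 1) x = f i x)
    (hiso : ∀ i, IsoOn H H (f i) (F i)) (hsurj : ∀ y, ∃ i, ∃ x ∈ F i, f i x = y) :
    ∃ p : Equiv.Perm V, H.IsAut p ∧ ∀ i, ∀ x ∈ F i, p x = f i x := by
  obtain ⟨p, hp⟩ := exists_perm_of_chain hF hcov hf (fun i => (hiso i).1) hsurj
  refine ⟨p, fun e => ?_, hp⟩
  obtain ⟨i, hi⟩ := exists_subset_of_chain hF hcov e
  rw [Finset.image_congr (g := f i) (fun x hx => hp i x (hi hx)), (hiso i).2 e hi]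

/-! ### Homogeneity -/

/-- `f` is an isomorphism between the finite strong sets `F` and `f F`. -/
structure PIso (n m : ℕ) (H : UHypergraph r V) (F : Finset V) (f : V → V) : Prop where
  dom : H.FStrong n m F
  iso : IsoOn H H f F
  ran : H.FStrong n m (F.image f)

theorem PIso.exists_inverse {F : Finset V} {f : V → V} (h : PIso n m H F f) [Nonempty V] :
    ∃ g, PIso n m H (F.image f) g ∧ (∀ x ∈ F, g (f x) = x) ∧ (F.image f).image g = F := by
  obtain ⟨g, hg, hl⟩ := h.iso.exists_inverse
  have e : (F.image f).image g = F := by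
    rw [Finset.image_image]
    conv_rhs => rw [← Finset.image_id (s := F)]
    exact Finset.image_congr fun x hx => hl x hx
  exact ⟨g, ⟨h.ran, hg, by rw [e]; exact h.dom⟩, hl, e⟩

section Homogeneity

variable (hH : H.IsGeneric n m) (hr : r ≠ 0)
include hH hr

/-- A strong hull of `F ∪ {v}` is a strong extension of `f F` through the inverse of `f`, hence is
realized over `f F`. -/
theorem PIso.forth {F : Finset V} {f : V → V} (h : PIso n m H F f) (v : V) :
    ∃ F' f', F ⊆ F' ∧ v ∈ F' ∧ (∀ x ∈ F, f' x = f x) ∧ PIso n m H F' f' := by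
  have := hH.nonempty hr
  have hp := hH.pos hr
  obtain ⟨T, hT, -, hTs, -⟩ := exists_hull hp (insert v F)
  obtain ⟨g, hg, hl, e⟩ := h.exists_inverse
  have hFT : F ⊆ T := (Finset.subset_insert _ _).trans hT
  obtain ⟨α, hα, hαg, hαs⟩ := hH.realize hr hg.dom hp (D := T) hg.iso (by rwa [e])
    (by rw [e]; exact h.dom)
  refine ⟨T, α, hFT, hT (Finset.mem_insert_self _ _), fun x hx => ?_, hTs, hα, hαs⟩
  have := hαg (f x) (Finset.mem_image_of_mem f hx)
  rwa [hl x hx] at this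

theorem PIso.back {F : Finset V} {f : V → V} (h : PIso n m H F f) (v : V) :
    ∃ F' f', F ⊆ F' ∧ (∃ x ∈ F', f' x = v) ∧ (∀ x ∈ F, f' x = f x) ∧ PIso n m H F' f' := by
  have := hH.nonempty hr
  obtain ⟨g, hg, hl, e⟩ := h.exists_inverse
  obtain ⟨T, g', hT, hv, hg', hP⟩ := hg.forth hH hr v
  obtain ⟨f', hf', hl', -⟩ := hP.exists_inverse
  refine ⟨T.image g', f', fun x hx => ?_, ⟨g' v, Finset.mem_image_of_mem _ hv, hl' v hv⟩,
    fun x hx => ?_, hf'⟩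
  · have h1 := Finset.mem_image_of_mem f hx
    have := Finset.mem_image_of_mem g' (hT h1)
    rwa [hg' _ h1, hl x hx] at this
  · have h1 := Finset.mem_image_of_mem f hx
    have := hl' _ (hT h1)
    rwa [hg' _ h1, hl x hx] at this

/-- An isomorphism of finite strong subsets extends to an automorphism. -/
theorem PIso.exists_isAut {F : Finset V} {f : V → V} (h : PIso n m H F f) :
    ∃ p : Equiv.Perm V, H.IsAut p ∧ ∀ x ∈ F, p x = f x := by
  have := hH.nonempty hr
  have := hH.countable
  obtain ⟨v, hv⟩ := exists_surjective_nat V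
  have step : ∀ (s : {s : Finset V × (V → V) // PIso n m H s.1 s.2}) (v : V),
      ∃ t : {s : Finset V × (V → V) // PIso n m H s.1 s.2}, s.1.1 ⊆ t.1.1 ∧ v ∈ t.1.1 ∧
        (∃ x ∈ t.1.1, t.1.2 x = v) ∧ ∀ x ∈ s.1.1, t.1.2 x = s.1.2 x := by
    rintro ⟨⟨F, f⟩, h⟩ v
    obtain ⟨F₁, f₁, hF₁, hv, hf₁, h₁⟩ := h.forth hH hr v
    obtain ⟨F₂, f₂, hF₂, hv₂, hf₂, h₂⟩ := h₁.back hH hr v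
    exact ⟨⟨⟨F₂, f₂⟩, h₂⟩, hF₁.trans hF₂, hF₂ hv, hv₂, fun x hx =>
      (hf₂ x (hF₁ hx)).trans (hf₁ x hx)⟩
  choose nxt h1 h2 h3 h4 using step
  let s : ℕ → {s : Finset V × (V → V) // PIso n m H s.1 s.2} :=
    fun i => Nat.rec ⟨⟨F, f⟩, h⟩ (fun i t => nxt t (v i)) i
  obtain ⟨p, hp, hpe⟩ := exists_isAut_of_chain (H := H) (f := fun i => (s i).1.2)
    (F := fun i => (s i).1.1) (monotone_nat_of_le_succ fun i => h1 (s i) (v i))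
    (fun x => by obtain ⟨i, rfl⟩ := hv x; exact ⟨i + 1, h2 (s i) (v i)⟩)
    (fun i x hx => h4 (s i) (v i) x hx) (fun i => (s i).2.iso)
    (fun y => by obtain ⟨i, rfl⟩ := hv y; exact ⟨i + 1, h3 (s i) (v i)⟩)
  exact ⟨p, hp, hpe 0⟩

/-- Two automorphisms which agree on the intersection of two strong sets can be glued, provided
both the sets and their images are in free position. -/
theorem exists_isAut_glue (hm : 1 ≤ m) {F T : Finset V} {p q : Equiv.Perm V} (hp : H.IsAut p)
    (hq : H.IsAut q) (hpq : ∀ x ∈ F, x ∈ T → p x = q x)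
    (hinj : ∀ x ∈ F, ∀ t ∈ T, p x = q t → x = t)
    (h₁ : H.pd n m F + H.pd n m T - H.pd n m (F ∩ T) ≤ H.fd n m (F ∪ T))
    (h₂ : H.pd n m F + H.pd n m T - H.pd n m (F ∩ T) ≤ H.fd n m (F.image p ∪ T.image q)) :
    ∃ s : Equiv.Perm V, H.IsAut s ∧ (∀ x ∈ F, s x = p x) ∧ ∀ x ∈ T, s x = q x := by
  have hpos := hH.pos hr
  let u : V → V := fun x => if x ∈ F then p x else q x
  have huF : ∀ x ∈ F, u x = p x := fun x hx => if_pos hx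
  have huT : ∀ x ∈ T, u x = q x := fun x hx => by
    by_cases h : x ∈ F
    · rw [huF x h, hpq x h hx]
    · exact if_neg h
  -- Free position on both sides means that the unions are strong and carry no edges besides those
  -- of the two parts, so the union of the two maps is again an isomorphism of strong sets.
  obtain ⟨s₁, c₁⟩ := free_union hpos h₁
  have hint : F.image p ∩ T.image q = (F ∩ T).image p := by
    ext y
    simp only [Finset.mem_inter, Finset.mem_image]
    constructor
    · rintro ⟨⟨x, hx, rfl⟩, t, ht, e⟩
      obtain rfl := hinj x hx t ht e.symm
      exact ⟨x, ⟨hx, ht⟩, rfl⟩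
    · rintro ⟨x, ⟨hx, ht⟩, rfl⟩
      exact ⟨⟨x, hx, rfl⟩, x, ht, (hpq x hx ht).symm⟩
  have h₂' : H.pd n m (F.image p) + H.pd n m (T.image q) - H.pd n m (F.image p ∩ T.image q) ≤
      H.fd n m (F.image p ∪ T.image q) := by
    rw [hint, hp.pd_image, hq.pd_image, hp.pd_image]; exact h₂
  obtain ⟨s₂, c₂⟩ := free_union hpos h₂'
  have hui : (F ∪ T).image u = F.image p ∪ T.image q := by
    rw [Finset.image_union, Finset.image_congr (g := p) (fun x hx => huF x hx),
      Finset.image_congr (s := T) (g := q) (fun x hx => huT x hx)]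
  have hinj' : Set.InjOn u (F ∪ T : Finset V) := by
    intro x hx y hy hxy
    rcases Finset.mem_union.1 hx with hx | hx <;> rcases Finset.mem_union.1 hy with hy | hy
    · rw [huF x hx, huF y hy] at hxy; exact p.injective hxy
    · rw [huF x hx, huT y hy] at hxy; exact hinj x hx y hy hxy
    · rw [huT x hx, huF y hy] at hxy; exact (hinj y hy x hx hxy.symm).symm
    · rw [huT x hx, huT y hy] at hxy; exact q.injective hxy
  have hP : PIso n m H (F ∪ T) u := by
    refine ⟨s₁, ⟨hinj', fun e he => ?_⟩, by rw [hui]; exact s₂⟩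
    have eF : e ⊆ F → e.image u = e.image p := fun h =>
      Finset.image_congr fun x hx => huF x (h hx)
    have eT : e ⊆ T → e.image u = e.image q := fun h =>
      Finset.image_congr fun x hx => huT x (h hx)
    constructor
    · intro h
      rcases c₂ hm _ h (by rw [← hui]; exact Finset.image_subset_image he) with hc | hc
      · have : e ⊆ F := by
          intro x hx
          obtain ⟨y, hy, hxy⟩ := Finset.mem_image.1 (hc (Finset.mem_image_of_mem u hx))
          rw [← huF y hy] at hxy
          rwa [← hinj' (Finset.mem_union_left _ hy) (he hx) hxy]
        rw [eF this] at h
        exact (hp e).1 h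
      · have : e ⊆ T := by
          intro x hx
          obtain ⟨y, hy, hxy⟩ := Finset.mem_image.1 (hc (Finset.mem_image_of_mem u hx))
          rw [← huT y hy] at hxy
          rwa [← hinj' (Finset.mem_union_right _ hy) (he hx) hxy]
        rw [eT this] at h
        exact (hq e).1 h
    · intro h
      rcases c₁ hm e h he with hc | hc
      · rw [eF hc]; exact (hp e).2 h
      · rw [eT hc]; exact (hq e).2 h
  obtain ⟨s, hs, hse⟩ := hP.exists_isAut hH hr
  exact ⟨s, hs, fun x hx => by rw [hse x (Finset.mem_union_left _ hx), huF x hx],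
    fun x hx => by rw [hse x (Finset.mem_union_right _ hx), huT x hx]⟩

end Homogeneity

/-! ### Extending partial isomorphisms with infinite domain -/

/-- `σ` is a partial isomorphism of the (possibly infinite) set `Z`, locally given by
automorphisms, and `Z` has the dimension of its finite subset `B`. -/
structure Coherent (n m : ℕ) (H : UHypergraph r V) (Z : Set V) (σ : V → V) (B : Finset V) :
    Prop where
  hull : ∀ T₀ : Finset V, (T₀ : Set V) ⊆ Z → ∃ T, T₀ ∪ B ⊆ T ∧ (T : Set V) ⊆ Z ∧
    H.FStrong n m T ∧ H.pd n m T = H.fd n m B ∧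
    ∃ q : Equiv.Perm V, H.IsAut q ∧ ∀ x ∈ T, q x = σ x
  mem_iff : ∀ p : Equiv.Perm V, H.IsAut p → (∀ x ∈ B, p x = σ x) → ∀ x, p x ∈ σ '' Z ↔ x ∈ Z

namespace Coherent

variable {Z : Set V} {σ : V → V} {B : Finset V}

theorem base_subset (h : Coherent n m H Z σ B) : (B : Set V) ⊆ Z := by
  obtain ⟨T, hT, hTZ, -⟩ := h.hull ∅ (by simp)
  exact fun x hx => hTZ (hT (Finset.mem_union_right _ hx))

theorem injOn (h : Coherent n m H Z σ B) : Set.InjOn σ Z := by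
  intro x hx y hy hxy
  obtain ⟨T, hT, -, -, -, q, -, hq⟩ := h.hull {x, y} (by
    intro z hz
    simp at hz
    rcases hz with rfl | rfl <;> assumption)
  rw [← hq x (hT (by simp)), ← hq y (hT (by simp))] at hxy
  exact q.injective hxy

theorem inverse (hp : H.Pos n m) (h : Coherent n m H Z σ B) {τ : V → V} (hτ : ∀ z ∈ Z, τ (σ z) = z) :
    Coherent n m H (σ '' Z) τ (B.image σ) := by
  refine ⟨fun T₀ hT₀ => ?_, fun p hpa hpB x => ?_⟩
  · obtain ⟨T₁, hT₁, rfl⟩ := Finset.subset_set_image_iff.1 hT₀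
    obtain ⟨T, hT, hTZ, hTs, hTd, q, hq, hqσ⟩ := h.hull T₁ hT₁
    have e : T.image σ = T.image q := Finset.image_congr fun x hx => (hqσ x hx).symm
    have e' : B.image σ = B.image q := Finset.image_congr fun x hx =>
      (hqσ x (hT (Finset.mem_union_right _ hx))).symm
    refine ⟨T.image σ, ?_, ?_, ?_, ?_, q⁻¹, hq.inv, ?_⟩
    · rw [← Finset.image_union]; exact Finset.image_subset_image hT
    · rw [Finset.coe_image]; exact Set.image_mono hTZ
    · rw [e]; exact hq.fStrong_image hTs
    · rw [e, e', hq.pd_image, hq.fd_image hp, hTd]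
    · intro y hy
      obtain ⟨x, hx, rfl⟩ := Finset.mem_image.1 hy
      rw [hτ x (hTZ hx), ← hqσ x hx, perm_inv_apply_self]
  · have h1 := h.mem_iff p⁻¹ hpa.inv (fun b hb => by
      rw [Equiv.Perm.inv_eq_iff_eq, hpB _ (Finset.mem_image_of_mem σ hb),
        hτ b (h.base_subset hb)]) (p x)
    rw [perm_inv_apply_self] at h1
    rw [h1, Set.image_image, Set.image_congr (g := id) (fun z hz => hτ z hz), Set.image_id]

/-- A hull `T` of the new points of `Z` is automatically in free position to `F`: its predimension
is the dimension of `B`, and `B` lies in `F ∩ T`, so `T` adds nothing to `F`. Hence `p` on `F` and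
`σ` on `T` can be glued. -/
theorem forth (hH : H.IsGeneric n m) (hr : r ≠ 0) (hm : 1 ≤ m) (h : Coherent n m H Z σ B)
    {p : Equiv.Perm V} (hpa : H.IsAut p) {F : Finset V} (hF : H.FStrong n m F) (hB : B ⊆ F)
    (hσ : ∀ x ∈ F, x ∈ Z → p x = σ x) (v : V) :
    ∃ F' p', H.IsAut p' ∧ H.FStrong n m F' ∧ F ⊆ F' ∧ v ∈ F' ∧ (∀ x ∈ F, p' x = p x) ∧
      ∀ x ∈ F', x ∈ Z → p' x = σ x := by
  have hp := hH.pos hr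
  have hd := fd_isDim hp
  obtain ⟨F', hF', -, hFs', -⟩ := exists_hull hp (insert v F)
  have hFF' : F ⊆ F' := (Finset.subset_insert _ _).trans hF'
  obtain ⟨T, hT, hTZ, hTs, hTd, q, hq, hqσ⟩ := h.hull (F'.filter (· ∈ Z)) (fun x hx => by
    simp at hx; exact hx.2)
  have hBT : B ⊆ T := Finset.subset_union_right.trans hT
  have h1 := fd_le hp (Finset.subset_inter hB hBT)
  have h2 := hF.fd_eq hp
  have hinj : ∀ x ∈ F, ∀ t ∈ T, p x = q t → x = t := by
    intro x hx t ht e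
    rw [hqσ t ht] at e
    have hxZ := (h.mem_iff p hpa (fun b hb => hσ b (hB hb) (h.base_subset hb)) x).1
      ⟨t, hTZ ht, e.symm⟩
    rw [hσ x hx hxZ] at e
    exact h.injOn hxZ (hTZ ht) e
  obtain ⟨s, hs, hsF, hsT⟩ := exists_isAut_glue hH hr hm hpa hq
    (fun x hx hxT => by rw [hσ x hx (hTZ hxT), hqσ x hxT]) hinj
    (by have := hd.mono F (F ∪ T) Finset.subset_union_left; omega)
    (by
      have := hd.mono (F.image p) (F.image p ∪ T.image q) Finset.subset_union_left
      rw [hpa.fd_image hp] at this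
      omega)
  refine ⟨F', s, hs, hFs', hFF', hF' (Finset.mem_insert_self _ _), hsF, fun x hx hxZ => ?_⟩
  have : x ∈ T := hT (Finset.mem_union_left _ (Finset.mem_filter.2 ⟨hx, hxZ⟩))
  rw [hsT x this, hqσ x this]

theorem back (hH : H.IsGeneric n m) (hr : r ≠ 0) (hm : 1 ≤ m) (h : Coherent n m H Z σ B)
    {p : Equiv.Perm V} (hpa : H.IsAut p) {F : Finset V} (hF : H.FStrong n m F) (hB : B ⊆ F)
    (hσ : ∀ x ∈ F, x ∈ Z → p x = σ x) (v : V) :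
    ∃ F' p', H.IsAut p' ∧ H.FStrong n m F' ∧ F ⊆ F' ∧ (∃ x ∈ F', p' x = v) ∧
      (∀ x ∈ F, p' x = p x) ∧ ∀ x ∈ F', x ∈ Z → p' x = σ x := by
  have := hH.nonempty hr
  have hτ : ∀ z ∈ Z, Function.invFunOn σ Z (σ z) = z := fun z hz => h.injOn.leftInvOn_invFunOn hz
  have hpB : ∀ b ∈ B, p b = σ b := fun b hb => hσ b (hB hb) (h.base_subset hb)
  obtain ⟨T, s, hs, hTs, hT, hv, hsp, hsτ⟩ := (h.inverse (hH.pos hr) hτ).forth hH hr hm hpa.inv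
    (F := F.image p) (hpa.fStrong_image hF) (by
      rw [Finset.image_congr (g := p) fun x hx => (hpB x hx).symm]
      exact Finset.image_subset_image hB)
    (by
      intro y hy hyZ
      obtain ⟨x, hx, rfl⟩ := Finset.mem_image.1 hy
      have hxZ := (h.mem_iff p hpa hpB x).1 hyZ
      rw [perm_inv_apply_self, hσ x hx hxZ, hτ x hxZ]) v
  have hsx : ∀ x ∈ F, s (p x) = x := fun x hx => by
    rw [hsp _ (Finset.mem_image_of_mem p hx), perm_inv_apply_self]
  have hsF : ∀ x ∈ F, s⁻¹ x = p x := fun x hx => by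
    rw [Equiv.Perm.inv_eq_iff_eq, hsx x hx]
  refine ⟨T.image s, s⁻¹, hs.inv, hs.fStrong_image hTs, fun x hx => ?_,
    ⟨s v, Finset.mem_image_of_mem s hv, perm_inv_apply_self _ _⟩, hsF, fun x hx hxZ => ?_⟩
  · rw [← hsx x hx]
    exact Finset.mem_image_of_mem s (hT (Finset.mem_image_of_mem p hx))
  · obtain ⟨y, hy, rfl⟩ := Finset.mem_image.1 hx
    have h1 := (h.mem_iff s⁻¹ hs.inv (fun b hb => by rw [hsF b (hB hb), hpB b hb]) (s y)).2 hxZ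
    rw [perm_inv_apply_self] at h1 ⊢
    have h2 := hsτ y hy h1
    obtain ⟨z, hz, rfl⟩ := h1
    rw [h2, hτ z hz]

/-- A coherent partial isomorphism extends to an automorphism. -/
theorem exists_isAut (hH : H.IsGeneric n m) (hr : r ≠ 0) (hm : 1 ≤ m) (h : Coherent n m H Z σ B)
    {p : Equiv.Perm V} (hpa : H.IsAut p) {F : Finset V} (hF : H.FStrong n m F) (hB : B ⊆ F)
    (hσ : ∀ x ∈ F, x ∈ Z → p x = σ x) :
    ∃ s : Equiv.Perm V, H.IsAut s ∧ (∀ x ∈ F, s x = p x) ∧ ∀ x ∈ Z, s x = σ x := by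
  have := hH.nonempty hr
  have := hH.countable
  obtain ⟨v, hv⟩ := exists_surjective_nat V
  let P : Finset V × Equiv.Perm V → Prop := fun s => H.IsAut s.2 ∧ H.FStrong n m s.1 ∧ B ⊆ s.1 ∧
    ∀ x ∈ s.1, x ∈ Z → s.2 x = σ x
  have step : ∀ (s : {s // P s}) (v : V), ∃ t : {s // P s}, s.1.1 ⊆ t.1.1 ∧ v ∈ t.1.1 ∧
        (∃ x ∈ t.1.1, t.1.2 x = v) ∧ ∀ x ∈ s.1.1, t.1.2 x = s.1.2 x := by
    rintro ⟨⟨F, p⟩, h1, h2, h3, h4⟩ v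
    obtain ⟨F₁, p₁, ha₁, hs₁, hF₁, hv₁, hp₁, hσ₁⟩ := h.forth hH hr hm h1 h2 h3 h4 v
    obtain ⟨F₂, p₂, ha₂, hs₂, hF₂, hv₂, hp₂, hσ₂⟩ := h.back hH hr hm ha₁ hs₁ (h3.trans hF₁) hσ₁ v
    exact ⟨⟨⟨F₂, p₂⟩, ha₂, hs₂, h3.trans (hF₁.trans hF₂), hσ₂⟩, hF₁.trans hF₂, hF₂ hv₁, hv₂,
      fun x hx => (hp₂ x (hF₁ hx)).trans (hp₁ x hx)⟩
  choose nxt h1 h2 h3 h4 using step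
  let s : ℕ → {s // P s} := fun i => Nat.rec ⟨⟨F, p⟩, hpa, hF, hB, hσ⟩ (fun i t => nxt t (v i)) i
  obtain ⟨q, hq, hqe⟩ := exists_isAut_of_chain (H := H) (f := fun i => ⇑(s i).1.2)
    (F := fun i => (s i).1.1) (monotone_nat_of_le_succ fun i => h1 (s i) (v i))
    (fun x => by obtain ⟨i, rfl⟩ := hv x; exact ⟨i + 1, h2 (s i) (v i)⟩)
    (fun i x hx => h4 (s i) (v i) x hx) (fun i => (s i).2.1.isoOn _)
    (fun y => by obtain ⟨i, rfl⟩ := hv y; exact ⟨i + 1, h3 (s i) (v i)⟩)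
  refine ⟨q, hq, hqe 0, fun x hx => ?_⟩
  obtain ⟨i, rfl⟩ := hv x
  rw [hqe (i + 1) _ (h2 (s i) (v i))]
  exact (s (i + 1)).2.2.2.2 _ (h2 (s i) (v i)) hx

end Coherent

end UHypergraph

namespace UHypergraph

variable {r : ℕ} {V W : Type*} {n m : ℕ} {H : UHypergraph r V}

/-! ### Stationarity and extension of independence -/

theorem IsAut.mem_dcl_image (hp : H.Pos n m) {p : Equiv.Perm V} (h : H.IsAut p) {A : Finset V}
    {x : V} : p x ∈ dcl (H.fd n m) (A.image p) ↔ x ∈ dcl (H.fd n m) A := by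
  simp only [dcl, Set.mem_ofPred_eq]
  rw [← Finset.image_insert, h.fd_image hp, h.fd_image hp]

theorem image_eq_self {p : V → V} {A : Finset V} (h : ∀ x ∈ A, p x = x) : A.image p = A := by
  conv_rhs => rw [← Finset.image_id (s := A)]
  exact Finset.image_congr fun x hx => h x hx

theorem exists_hull_dcl (hp : H.Pos n m) {B T₀ : Finset V} (h : (T₀ : Set V) ⊆ dcl (H.fd n m) B) :
    ∃ T, T₀ ∪ B ⊆ T ∧ (T : Set V) ⊆ dcl (H.fd n m) B ∧ H.FStrong n m T ∧
      H.pd n m T = H.fd n m B := by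
  have hd := fd_isDim hp
  obtain ⟨T, hT, e, hs, e'⟩ := exists_hull hp (T₀ ∪ B)
  have h1 := hd.union_of_subset_dcl h
  rw [Finset.union_comm] at h1
  refine ⟨T, hT, hd.subset_dcl_of_le ?_, hs, by omega⟩
  rw [Finset.union_eq_right.2 (Finset.subset_union_right.trans hT)]
  omega

/-- An automorphism fixing `F ∩ cl B` can be changed outside `F` to fix `cl B`. -/
theorem IsAut.exists_fix (hH : H.IsGeneric n m) (hr : r ≠ 0) (hm : 1 ≤ m) {p : Equiv.Perm V}
    (hpa : H.IsAut p) {F B : Finset V} (hF : H.FStrong n m F) (hB : B ⊆ F)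
    (hfix : ∀ x ∈ F, x ∈ dcl (H.fd n m) B → p x = x) :
    ∃ s : Equiv.Perm V, H.IsAut s ∧ (∀ x ∈ F, s x = p x) ∧ ∀ x ∈ dcl (H.fd n m) B, s x = x := by
  have hp := hH.pos hr
  -- Here the coherent map is the identity on the closure of `B`.
  refine Coherent.exists_isAut (σ := id) (B := B) hH hr hm ⟨fun T₀ h => ?_, fun q hq hqB x => ?_⟩
    hpa hF hB hfix
  · obtain ⟨T, h1, h2, h3, h4⟩ := exists_hull_dcl hp h
    exact ⟨T, h1, h2, h3, h4, 1, isAut_one, fun x _ => rfl⟩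
  · have := hq.mem_dcl_image hp (A := B) (x := x)
    rw [image_eq_self (p := q) hqB] at this
    rwa [Set.image_id]

/-- Stationarity of independence. -/
theorem IsAut.exists_of_ind (hH : H.IsGeneric n m) (hr : r ≠ 0) (hm : 1 ≤ m) {h : Equiv.Perm V}
    (ha : H.IsAut h) {A B C : Finset V} (hBA : B ⊆ A) (hBC : B ⊆ C)
    (hB : ∀ x ∈ dcl (H.fd n m) B, h x = x) (h₁ : DInd (H.fd n m) A B C)
    (h₂ : DInd (H.fd n m) (A.image h) B C) :
    ∃ k : Equiv.Perm V, H.IsAut k ∧ (∀ x ∈ dcl (H.fd n m) A, k x = h x) ∧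
      ∀ x ∈ dcl (H.fd n m) C, k x = x := by
  have hp := hH.pos hr
  have hd := fd_isDim hp
  set cl := dcl (H.fd n m) with hcl
  have hBh : B ⊆ A.image h := fun x hx => by
    rw [← hB x (subset_dcl _ _ hx)]
    exact Finset.mem_image_of_mem h (hBA hx)
  -- The closures of `A` and `C` meet inside that of `B`, where `h` is the identity; so `σ`, given
  -- by `h` on one and the identity on the other, is consistent. `i₂` gives the same for the images.
  have i₁ := hd.dcl_inter_subset hBA hBC h₁
  have i₂ := hd.dcl_inter_subset hBh hBC h₂
  let σ : V → V := fun x => if x ∈ cl A then h x else x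
  have σA : ∀ x ∈ cl A, σ x = h x := fun x hx => if_pos hx
  have σC : ∀ x ∈ cl C, σ x = x := fun x hx => by
    by_cases hxA : x ∈ cl A
    · rw [σA x hxA, hB x (i₁ ⟨hxA, hx⟩)]
    · exact if_neg hxA
  have hcoh : Coherent n m H (cl A ∪ cl C) σ (A ∪ C) := by
    refine ⟨fun T₀ hT₀ => ?_, fun q hq hqB x => ?_⟩
    · obtain ⟨TA, a1, a2, a3, a4⟩ := exists_hull_dcl (B := A) (T₀ := T₀.filter (· ∈ cl A)) hp
        (fun x hx => by simp at hx; exact hx.2)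
      obtain ⟨TC, c1, c2, c3, c4⟩ := exists_hull_dcl (B := C) (T₀ := T₀.filter (· ∈ cl C)) hp
        (fun x hx => by simp at hx; exact hx.2)
      have hATA : A ⊆ TA := Finset.subset_union_right.trans a1
      have hCTC : C ⊆ TC := Finset.subset_union_right.trans c1
      have hBT : B ⊆ TA ∩ TC := Finset.subset_inter (hBA.trans hATA) (hBC.trans hCTC)
      have hTB : ∀ x ∈ TA, x ∈ TC → x ∈ cl B := fun x hx hx' => i₁ ⟨a2 hx, c2 hx'⟩
      have e1 := fd_le hp hBT
      have e2 : H.fd n m A + H.fd n m C - H.fd n m B ≤ H.fd n m (A ∪ C) := by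
        unfold DInd at h₁
        rw [Finset.union_eq_left.2 hBA, Finset.union_eq_right.2 hBC] at h₁
        omega
      have e3 : H.fd n m A + H.fd n m C - H.fd n m B ≤ H.fd n m (A.image h ∪ C) := by
        unfold DInd at h₂
        rw [Finset.union_eq_left.2 hBh, Finset.union_eq_right.2 hBC, ha.fd_image hp] at h₂
        omega
      have e4 := hd.mono _ _ (Finset.union_subset_union hATA hCTC)
      have e5 := hd.mono _ _ (Finset.union_subset_union (Finset.image_subset_image (f := h) hATA)
        hCTC)
      -- The hulls have the dimensions of `A` and `C`, and their intersection contains `B`, so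
      -- independence becomes free position.
      have e6 : H.pd n m TA + H.pd n m TC - H.pd n m (TA ∩ TC) ≤ H.fd n m (TA ∪ TC) := by omega
      obtain ⟨q, hq, hqA, hqC⟩ := exists_isAut_glue hH hr hm ha (isAut_one (H := H)) (F := TA)
        (T := TC) (fun x hx hx' => hB x (hTB x hx hx'))
        (fun x hx t ht e => by
          change h x = t at e
          have h3 : h x ∈ cl B := i₂ ⟨(ha.mem_dcl_image hp).2 (a2 hx), by rw [e]; exact c2 ht⟩
          have h4 := hB _ h3
          rw [← e]
          exact (h.injective h4).symm) e6 (by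
          rw [Equiv.Perm.coe_one, Finset.image_id]; omega)
      refine ⟨TA ∪ TC, ?_, ?_, (free_union hp e6).1, ?_, q, hq, ?_⟩
      · intro x hx
        rcases Finset.mem_union.1 hx with hx | hx
        · rcases hT₀ hx with hx' | hx'
          · exact Finset.mem_union_left _ (a1 (Finset.mem_union_left _
              (Finset.mem_filter.2 ⟨hx, hx'⟩)))
          · exact Finset.mem_union_right _ (c1 (Finset.mem_union_left _
              (Finset.mem_filter.2 ⟨hx, hx'⟩)))
        · exact Finset.union_subset_union hATA hCTC hx
      · rw [Finset.coe_union]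
        exact Set.union_subset_union a2 c2
      · have f1 := (free_union hp e6).1.fd_eq hp
        have f2 := hd.union_eq_of_subset_dcl (A := A) (B := A ∪ C) Finset.subset_union_left a2
        have f3 := hd.union_eq_of_subset_dcl (A := C) (B := A ∪ C ∪ TA)
          (Finset.subset_union_right.trans Finset.subset_union_left) c2
        rw [show A ∪ C ∪ TA ∪ TC = TA ∪ TC by
          ext x; have := @hATA x; have := @hCTC x; simp; tauto] at f3
        omega
      · intro x hx
        rcases Finset.mem_union.1 hx with hx | hx
        · rw [hqA x hx, σA x (a2 hx)]
        · rw [hqC x hx, σC x (c2 hx)]; rfl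
    · have qA : A.image q = A.image h := Finset.image_congr fun x hx => by
        rw [hqB x (Finset.mem_union_left _ hx), σA x (subset_dcl _ _ hx)]
      have qC : C.image q = C := image_eq_self fun x hx => by
        rw [hqB x (Finset.mem_union_right _ hx), σC x (subset_dcl _ _ hx)]
      have sA : ∀ y, y ∈ σ '' cl A ↔ y ∈ cl (A.image h) := by
        intro y
        rw [Set.image_congr (g := h) fun x hx => σA x hx]
        constructor
        · rintro ⟨x, hx, rfl⟩
          exact (ha.mem_dcl_image hp).2 hx
        · intro hy
          refine ⟨h⁻¹ y, ?_, by simp⟩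
          rw [← ha.mem_dcl_image hp]
          simpa using hy
      rw [Set.image_union, Set.mem_union, sA, Set.image_congr (g := id) fun x hx => σC x hx,
        Set.image_id, Set.mem_union, ← qA, hcl, hq.mem_dcl_image hp]
      nth_rewrite 1 [← qC]
      rw [hq.mem_dcl_image hp]
  obtain ⟨T, h1, h2, h3, -, q, hq, hqσ⟩ := hcoh.hull ∅ (by simp)
  obtain ⟨k, hk, -, hkσ⟩ := hcoh.exists_isAut hH hr hm hq h3 (Finset.subset_union_right.trans h1)
    (fun x hx _ => hqσ x hx)
  exact ⟨k, hk, fun x hx => by rw [hkσ x (Or.inl hx), σA x hx],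
    fun x hx => by rw [hkσ x (Or.inr hx), σC x hx]⟩

/-! ### Free amalgams and independent copies -/

/-- Two copies of `V`. -/
inductive Dbl (V : Type*) : Type _
  | fst : V → Dbl V
  | snd : V → Dbl V

theorem Dbl.fst_injective : Function.Injective (Dbl.fst : V → Dbl V) :=
  fun _ _ h => by simpa using h

/-- The map placing a copy of `V` next to `V`, glued along `B`. -/
def glueMap (B : Finset V) (x : V) : Dbl V := if x ∈ B then Dbl.fst x else Dbl.snd x

theorem glueMap_injective (B : Finset V) : Function.Injective (glueMap B) := by
  intro x y hxy
  unfold glueMap at hxy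
  split_ifs at hxy <;> simpa using hxy

theorem glueMap_eq_inl {B : Finset V} {x y : V} (h : glueMap B x = Dbl.fst y) :
    x = y ∧ x ∈ B := by
  unfold glueMap at h
  split_ifs at h with h'
  exact ⟨by simpa using h, h'⟩

/-- The free amalgam of `E` and `F` over `B`. -/
def freeAmalgam (H : UHypergraph r V) (E F B : Finset V) : UHypergraph r (Dbl V) where
  edges := {e | ∃ e₀ ∈ H.edges, (e₀ ⊆ E ∧ e = e₀.image Dbl.fst) ∨
    (e₀ ⊆ F ∧ e = e₀.image (glueMap B))}
  card_edge := by
    rintro e ⟨e₀, he₀, ⟨-, rfl⟩ | ⟨-, rfl⟩⟩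
    · rw [Finset.card_image_of_injective _ Dbl.fst_injective, H.card_edge _ he₀]
    · rw [Finset.card_image_of_injective _ (glueMap_injective B), H.card_edge _ he₀]

theorem isoOn_inl {E F B : Finset V} : IsoOn H (H.freeAmalgam E F B) Dbl.fst E := by
  refine ⟨Dbl.fst_injective.injOn, fun e he => ⟨?_, fun h => ⟨e, h, Or.inl ⟨he, rfl⟩⟩⟩⟩
  rintro ⟨e₀, he₀, ⟨-, h⟩ | ⟨-, h⟩⟩
  · rwa [Finset.image_injective Dbl.fst_injective h]
  · have : e = e₀ := by
      ext x
      have h1 : Dbl.fst x ∈ e.image (Dbl.fst : V → Dbl V) ↔ Dbl.fst x ∈ e₀.image (glueMap B) := by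
        rw [h]
      simp only [Finset.mem_image, Dbl.fst.injEq, exists_eq_right] at h1
      rw [h1]
      constructor
      · rintro ⟨y, hy, hyx⟩
        rwa [← (glueMap_eq_inl hyx).1]
      · intro hx
        have h2 : glueMap B x ∈ e.image (Dbl.fst : V → Dbl V) := by
          rw [h]; exact Finset.mem_image_of_mem _ hx
        obtain ⟨y, -, hy⟩ := Finset.mem_image.1 h2
        exact ⟨x, hx, by rw [← hy, (glueMap_eq_inl hy.symm).1]⟩
    rwa [this]

theorem isoOn_glueMap {E F B : Finset V} : IsoOn H (H.freeAmalgam E F B) (glueMap B) F := by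
  refine ⟨(glueMap_injective B).injOn, fun e he => ⟨?_, fun h => ⟨e, h, Or.inr ⟨he, rfl⟩⟩⟩⟩
  rintro ⟨e₀, he₀, ⟨-, h⟩ | ⟨-, h⟩⟩
  · have : e = e₀ := by
      ext x
      have h1 : Dbl.fst x ∈ e₀.image (Dbl.fst : V → Dbl V) ↔ Dbl.fst x ∈ e.image (glueMap B) := by
        rw [← h]
      simp only [Finset.mem_image, Dbl.fst.injEq, exists_eq_right] at h1
      rw [h1]
      constructor
      · intro hx
        have h2 : glueMap B x ∈ e₀.image (Dbl.fst : V → Dbl V) := by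
          rw [← h]; exact Finset.mem_image_of_mem _ hx
        obtain ⟨y, -, hy⟩ := Finset.mem_image.1 h2
        exact ⟨x, hx, by rw [← hy, (glueMap_eq_inl hy.symm).1]⟩
      · rintro ⟨y, hy, hyx⟩
        rwa [← (glueMap_eq_inl hyx).1]
    rwa [this]
  · rwa [Finset.image_injective (glueMap_injective B) h]

/-- Inside the free amalgam every finite set contains a free amalgam of smaller predimension. -/
theorem pd_freeAmalgam {E F B : Finset V} (hBE : B ⊆ E) (hBF : B ⊆ F) (A : Finset (Dbl V)) :
    ∃ A₁ A₂ A₃, A₁ ⊆ E ∧ A₂ ⊆ F ∧ A₃ ⊆ A₁ ∧ A₃ ⊆ A₂ ∧ A₃ ⊆ B ∧ A₁ ∩ B = A₃ ∧ A₂ ∩ B = A₃ ∧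
      (∀ x ∈ E, Dbl.fst x ∈ A → x ∈ A₁) ∧ (∀ x ∈ F, glueMap B x ∈ A → x ∈ A₂) ∧
      H.pd n m A₁ + H.pd n m A₂ - H.pd n m A₃ ≤ (H.freeAmalgam E F B).pd n m A ∧
      (A = E.image Dbl.fst ∪ F.image (glueMap B) →
        (H.freeAmalgam E F B).pd n m A = H.pd n m A₁ + H.pd n m A₂ - H.pd n m A₃) := by
  set K := H.freeAmalgam E F B with hK
  set A₁ := E.filter fun x => Dbl.fst x ∈ A with hA₁
  set A₂ := F.filter fun x => glueMap B x ∈ A with hA₂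
  have hglue : ∀ x ∈ B, glueMap B x = Dbl.fst x := fun x hx => if_pos hx
  have e12 : ∀ x ∈ B, x ∈ A₁ ↔ x ∈ A₂ := by
    intro x hx
    simp only [hA₁, hA₂, Finset.mem_filter, hglue x hx, hBE hx, hBF hx]
  set I := A₁.image (Dbl.fst : V → Dbl V) with hI
  set J := A₂.image (glueMap B) with hJ
  have hIJ : I ∩ J = (A₁ ∩ B).image Dbl.fst := by
    ext z
    simp only [hI, hJ, Finset.mem_inter, Finset.mem_image]
    constructor
    · rintro ⟨⟨x, hx, rfl⟩, y, hy, hyx⟩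
      obtain ⟨rfl, hyB⟩ := glueMap_eq_inl hyx
      exact ⟨y, ⟨hx, hyB⟩, rfl⟩
    · rintro ⟨x, ⟨hx, hxB⟩, rfl⟩
      exact ⟨⟨x, hx, rfl⟩, x, (e12 x hxB).1 hx, hglue x hxB⟩
  have hsub : I ∪ J ⊆ A := by
    intro z hz
    rcases Finset.mem_union.1 hz with hz | hz
    · obtain ⟨x, hx, rfl⟩ := Finset.mem_image.1 hz
      exact (Finset.mem_filter.1 hx).2
    · obtain ⟨x, hx, rfl⟩ := Finset.mem_image.1 hz
      exact (Finset.mem_filter.1 hx).2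
  have hein : ∀ e ∈ K.edges, e ⊆ A → e ⊆ I ∨ e ⊆ J := by
    rintro e ⟨e₀, he₀, ⟨hs, rfl⟩ | ⟨hs, rfl⟩⟩ heA
    · left
      exact Finset.image_subset_image fun x hx =>
        Finset.mem_filter.2 ⟨hs hx, heA (Finset.mem_image_of_mem _ hx)⟩
    · right
      exact Finset.image_subset_image fun x hx =>
        Finset.mem_filter.2 ⟨hs hx, heA (Finset.mem_image_of_mem _ hx)⟩
  have hpdI : K.pd n m I = H.pd n m A₁ := isoOn_inl.pd_image (Finset.filter_subset _ _)
  have hpdJ : K.pd n m J = H.pd n m A₂ := isoOn_glueMap.pd_image (Finset.filter_subset _ _)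
  have hpdIJ : K.pd n m (I ∩ J) = H.pd n m (A₁ ∩ B) := by
    rw [hIJ]
    exact isoOn_inl.pd_image (Finset.inter_subset_left.trans (Finset.filter_subset _ _))
  have hcross : K.cross I J = ∅ := by
    refine Finset.eq_empty_of_forall_notMem fun e he => ?_
    obtain ⟨h1, h2, h3, h4⟩ := mem_cross.1 he
    exact (hein e h1 (h2.trans hsub)).elim h3 h4
  have hmod := K.pd_union_add_inter n m I J
  rw [hcross, Finset.card_empty, hpdI, hpdJ, hpdIJ] at hmod
  -- Points of `A` outside both parts lie on no edge inside `A`, so dropping them cannot raise the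
  -- predimension.
  have hle : K.pd n m (I ∪ J) ≤ K.pd n m A := by
    have h1 : K.ein A = K.ein (I ∪ J) := by
      ext e
      simp only [mem_ein]
      constructor
      · rintro ⟨h, h'⟩
        refine ⟨?_, h'⟩
        rcases hein e h' h with h | h
        · exact h.trans Finset.subset_union_left
        · exact h.trans Finset.subset_union_right
      · rintro ⟨h, h'⟩
        exact ⟨h.trans hsub, h'⟩
    have h2 : ((I ∪ J).card : ℤ) ≤ A.card := by exact_mod_cast Finset.card_le_card hsub
    have h3 : (n : ℤ) * (I ∪ J).card ≤ n * A.card := by gcongr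
    simp only [pd, h1]
    omega
  refine ⟨A₁, A₂, A₁ ∩ B, Finset.filter_subset _ _, Finset.filter_subset _ _,
    Finset.inter_subset_left, ?_, Finset.inter_subset_right, rfl, ?_, ?_, ?_, ?_, ?_⟩
  · intro x hx
    rw [Finset.mem_inter] at hx
    exact (e12 x hx.2).1 hx.1
  · ext x
    simp only [Finset.mem_inter]
    exact ⟨fun h => ⟨(e12 x h.2).2 h.1, h.2⟩, fun h => ⟨(e12 x h.2).1 h.1, h.2⟩⟩
  · exact fun x hx hx' => Finset.mem_filter.2 ⟨hx, hx'⟩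
  · exact fun x hx hx' => Finset.mem_filter.2 ⟨hx, hx'⟩
  · push_cast at hmod
    omega
  · intro hA
    have h1 : A₁ = E := Finset.filter_true_of_mem fun x hx => by
      rw [hA]; exact Finset.mem_union_left _ (Finset.mem_image_of_mem _ hx)
    have h2 : A₂ = F := Finset.filter_true_of_mem fun x hx => by
      rw [hA]; exact Finset.mem_union_right _ (Finset.mem_image_of_mem _ hx)
    have h3 : I ∪ J = A := by rw [hA, hI, hJ, h1, h2]
    rw [← h3]
    push_cast at hmod
    omega

/-- Existence of independent conjugates. -/
theorem IsGeneric.exists_ind (hH : H.IsGeneric n m) (hr : r ≠ 0) (hm : 1 ≤ m) (A B C : Finset V) :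
    ∃ h : Equiv.Perm V, H.IsAut h ∧ (∀ x ∈ dcl (H.fd n m) B, h x = x) ∧
      DInd (H.fd n m) (A.image h) B C := by
  have hp := hH.pos hr
  have hd := fd_isDim hp
  obtain ⟨F, hF, -, hFs, -⟩ := exists_hull hp (A ∪ B)
  have hBF : B ⊆ F := Finset.subset_union_right.trans hF
  -- Unlike `B`, the set `B₁` is strong, as the intersection of `F` with a strong set in the closure
  -- of `B`; and it still has the dimension of `B`. Amalgamating over `B₁` also makes the new map
  -- fix all of `F` that lies in that closure.
  set B₁ := F.filter (· ∈ dcl (H.fd n m) B) with hB₁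
  have hB₁F : B₁ ⊆ F := Finset.filter_subset _ _
  have hBB₁ : B ⊆ B₁ := fun x hx => Finset.mem_filter.2 ⟨hBF hx, subset_dcl _ _ hx⟩
  have hB₁cl : (B₁ : Set V) ⊆ dcl (H.fd n m) B := fun x hx => by
    simp [hB₁] at hx; exact hx.2
  obtain ⟨T, t1, t2, t3, t4⟩ := exists_hull_dcl hp hB₁cl
  have hB₁s : H.FStrong n m B₁ := by
    have : B₁ = F ∩ T := by
      ext x
      rw [Finset.mem_inter]
      constructor
      · exact fun hx => ⟨hB₁F hx, t1 (Finset.mem_union_left _ hx)⟩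
      · exact fun hx => Finset.mem_filter.2 ⟨hx.1, t2 hx.2⟩
    rw [this]
    exact hFs.inter t3
  have hB₁d : H.pd n m B₁ = H.fd n m B := by
    rw [← hB₁s.fd_eq hp, ← hd.union_of_subset_dcl hB₁cl, Finset.union_eq_right.2 hBB₁]
  obtain ⟨E, hE, -, hEs, -⟩ := exists_hull hp (C ∪ B₁)
  have hB₁E : B₁ ⊆ E := Finset.subset_union_right.trans hE
  set K := H.freeAmalgam E F B₁ with hK
  have hKp : K.Pos n m := by
    intro Q
    obtain ⟨A₁, A₂, A₃, -, -, -, h32, -, -, h3, -, -, hle, -⟩ :=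
      pd_freeAmalgam (H := H) (n := n) (m := m) hB₁E hB₁F Q
    rw [← hK] at hle
    have h4 := hB₁s.pd_inter_le A₂
    have h5 := hp A₁
    rw [h3] at h4
    omega
  have hKE : K.FStrong n m (E.image Dbl.fst) := by
    intro Q hQ
    obtain ⟨A₁, A₂, A₃, hE', -, -, -, -, -, h3, h1, -, hle, -⟩ :=
      pd_freeAmalgam (H := H) (n := n) (m := m) hB₁E hB₁F Q
    rw [← hK] at hle
    have h4 := hB₁s.pd_inter_le A₂
    have h5 : A₁ = E := Finset.Subset.antisymm hE' fun x hx =>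
      h1 x hx (hQ (Finset.mem_image_of_mem _ hx))
    rw [h3] at h4
    rw [isoOn_inl.pd_image subset_rfl, ← h5]
    omega
  have hKF : K.FStrong n m (F.image (glueMap B₁)) := by
    intro Q hQ
    obtain ⟨A₁, A₂, A₃, -, hF', -, -, -, h3, -, -, h1, hle, -⟩ :=
      pd_freeAmalgam (H := H) (n := n) (m := m) hB₁E hB₁F Q
    rw [← hK] at hle
    have h4 := hB₁s.pd_inter_le A₁
    have h5 : A₂ = F := Finset.Subset.antisymm hF' fun x hx =>
      h1 x hx (hQ (Finset.mem_image_of_mem _ hx))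
    rw [h3] at h4
    rw [isoOn_glueMap.pd_image subset_rfl, ← h5]
    omega
  obtain ⟨α, hα, hαE, hαs⟩ := hH.realize hr hEs hKp (D := E.image Dbl.fst ∪ F.image (glueMap B₁))
    isoOn_inl Finset.subset_union_left hKE
  have hPI : PIso n m H F (α ∘ glueMap B₁) := by
    refine ⟨hFs, (hα.mono Finset.subset_union_right).comp isoOn_glueMap, ?_⟩
    rw [← Finset.image_image]
    exact hα.fStrong_image hαs Finset.subset_union_right hKF
  obtain ⟨p, hpa, hpF⟩ := hPI.exists_isAut hH hr
  obtain ⟨h, ha, hhF, hhB⟩ := hpa.exists_fix hH hr hm hFs hBF (fun x hx hxB => by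
    have hx₁ : x ∈ B₁ := Finset.mem_filter.2 ⟨hx, hxB⟩
    rw [hpF x hx, Function.comp_apply, show glueMap B₁ x = Dbl.fst x from if_pos hx₁,
      hαE x (hB₁E hx₁)])
  refine ⟨h, ha, hhB, hd.ind_mono (A := F.image h) (C := E) ?_ ?_ ?_⟩
  · have e1 : B ∪ E = E := Finset.union_eq_right.2 (hBB₁.trans hB₁E)
    have e2 : B ⊆ F.image h := fun x hx => by
      rw [← hhB x (subset_dcl _ _ hx)]
      exact Finset.mem_image_of_mem h (hBF hx)
    have e3 : F.image h = (F.image (glueMap B₁)).image α := by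
      rw [Finset.image_image]
      exact Finset.image_congr fun x hx => by rw [hhF x hx, hpF x hx]
    have e4 : E = (E.image Dbl.fst).image α := by
      rw [Finset.image_image]
      exact (image_eq_self fun x hx => hαE x hx).symm
    unfold DInd
    rw [e1, Finset.union_eq_left.2 e2]
    have e5 : F.image h ∪ E = (E.image Dbl.fst ∪ F.image (glueMap B₁)).image α := by
      rw [Finset.image_union, ← e4, ← e3, Finset.union_comm]
    rw [e5, hαs.fd_eq hp, hα.pd_image subset_rfl, ha.fd_image hp, hFs.fd_eq hp, hEs.fd_eq hp]
    obtain ⟨A₁, A₂, A₃, hE', hF', -, -, -, h3, -, h1, h2, -, heq⟩ :=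
      pd_freeAmalgam (H := H) (n := n) (m := m) hB₁E hB₁F
        (E.image Dbl.fst ∪ F.image (glueMap B₁))
    have h5 : A₁ = E := Finset.Subset.antisymm hE' fun x hx =>
      h1 x hx (Finset.mem_union_left _ (Finset.mem_image_of_mem _ hx))
    have h6 : A₂ = F := Finset.Subset.antisymm hF' fun x hx =>
      h2 x hx (Finset.mem_union_right _ (Finset.mem_image_of_mem _ hx))
    have h7 := heq rfl
    rw [h5, Finset.inter_eq_right.2 hB₁E] at h3
    rw [← h3, h5, h6] at h7
    rw [hK, h7]
    omega
  · exact (Finset.image_subset_image (Finset.subset_union_left.trans hF)).trans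
      Finset.subset_union_left
  · exact (Finset.subset_union_left.trans hE).trans Finset.subset_union_right

end UHypergraph

namespace UHypergraph

variable {r : ℕ} {V W : Type*} {n m : ℕ} {H : UHypergraph r V}

/-! ### Free points and additional edges -/

/-- There are points which are free over any given finite set. -/
def HasFree (n m : ℕ) (H : UHypergraph r V) : Prop :=
  ∀ D : Finset V, ∃ w ∉ D, ∀ Y ⊆ D, H.fd n m (insert w Y) = H.fd n m Y + n

theorem fd_empty (hp : H.Pos n m) (hr : r ≠ 0) : H.fd n m ∅ = 0 :=
  le_antisymm (by rw [← H.pd_empty n m hr]; exact fd_le hp subset_rfl) (fd_nonneg hp _)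

theorem fd_insert_le (hp : H.Pos n m) (Y : Finset V) (w : V) :
    H.fd n m (insert w Y) ≤ H.fd n m Y + n := by
  by_cases hw : w ∈ Y
  · rw [Finset.insert_eq_of_mem hw]; omega
  obtain ⟨Z, hZ, e⟩ := exists_pd_eq_fd hp Y
  have h1 := H.pd_submod n m Z {w}
  have h2 := fd_le hp (Finset.union_subset_union hZ (subset_refl {w}))
  have h3 : H.pd n m {w} ≤ n := H.pd_singleton_le n m w
  have h4 := hp (Z ∩ {w})
  rw [Finset.union_comm Y, ← Finset.insert_eq] at h2
  omega

/-- A single point without edges embeds strongly and has dimension `n`; a copy of it independent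
from `D` over the empty set is free over `D`. -/
theorem IsGeneric.hasFree (hH : H.IsGeneric n m) (hr : r ≠ 0) (hn : 1 ≤ n) (hm : 1 ≤ m) :
    H.HasFree n m := by
  have hp := hH.pos hr
  have hd := fd_isDim hp
  intro D
  obtain ⟨v₀⟩ := hH.nonempty hr
  have hK : (edgeless r (Dbl V)).Pos n m := fun A => by rw [pd_edgeless]; positivity
  obtain ⟨α, hα, -, hs⟩ := hH.realize hr (S := ∅) (fun B _ => by rw [pd_empty n m _ hr]; exact hp B)
    hK (D := {Dbl.fst v₀}) (j := Dbl.fst)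
    ⟨by simp, fun e he => by
      rw [Finset.subset_empty] at he
      subst he
      simp only [Finset.image_empty]
      exact ⟨fun h => h.elim, fun h => absurd (H.card_edge _ h) (by simpa using hr.symm)⟩⟩
    (by simp) (fun B _ => by rw [Finset.image_empty, pd_empty n m _ hr]; exact hK B)
  have h1 : H.fd n m {α (Dbl.fst v₀)} = n := by
    have e1 := hs.fd_eq hp
    rw [hα.pd_image subset_rfl, pd_edgeless] at e1
    simpa using e1
  obtain ⟨h, ha, -, hi⟩ := hH.exists_ind hr hm {α (Dbl.fst v₀)} ∅ D
  have h2 : ∀ Y ⊆ D, H.fd n m (insert (h (α (Dbl.fst v₀))) Y) = H.fd n m Y + n := by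
    intro Y hY
    have h3 := hd.ind_eq (hd.ind_mono_right hi (C' := Y) (by simpa using hY))
    have h4 : H.fd n m {h (α (Dbl.fst v₀))} = n := by
      rw [← Finset.image_singleton, ha.fd_image hp, h1]
    rw [fd_empty hp hr, Finset.union_empty, Finset.empty_union, Finset.image_singleton, h4,
      ← Finset.insert_eq] at h3
    omega
  refine ⟨h (α (Dbl.fst v₀)), fun hw => ?_, h2⟩
  have := h2 D subset_rfl
  rw [Finset.insert_eq_of_mem hw] at this
  omega

/-! ### The effect of one additional edge -/

/-- The hypergraph with one more edge. -/
def addEdge (H : UHypergraph r V) (e : Finset V) (he : e.card = r) : UHypergraph r V where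
  edges := insert e H.edges
  card_edge := by
    rintro f (rfl | hf)
    · exact he
    · exact H.card_edge f hf

section AddEdge

variable {e : Finset V} {he : e.card = r}

theorem mem_edges_addEdge {f : Finset V} : f ∈ (H.addEdge e he).edges ↔ f = e ∨ f ∈ H.edges :=
  Iff.rfl

theorem ein_addEdge_of_subset {A : Finset V} (h : e ⊆ A) :
    (H.addEdge e he).ein A = insert e (H.ein A) := by
  ext f
  simp only [mem_ein, mem_edges_addEdge, Finset.mem_insert]
  constructor
  · rintro ⟨h1, h2 | h2⟩
    · exact Or.inl h2
    · exact Or.inr ⟨h1, h2⟩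
  · rintro (rfl | ⟨h1, h2⟩)
    · exact ⟨h, Or.inl rfl⟩
    · exact ⟨h1, Or.inr h2⟩

theorem ein_addEdge_of_not_subset {A : Finset V} (h : ¬ e ⊆ A) :
    (H.addEdge e he).ein A = H.ein A := by
  ext f
  simp only [mem_ein, mem_edges_addEdge]
  constructor
  · rintro ⟨h1, rfl | h2⟩
    · exact absurd h1 h
    · exact ⟨h1, h2⟩
  · exact fun h => ⟨h.1, Or.inr h.2⟩

theorem pd_addEdge_of_subset (hne : e ∉ H.edges) {A : Finset V} (h : e ⊆ A) :
    (H.addEdge e he).pd n m A = H.pd n m A - m := by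
  rw [pd, ein_addEdge_of_subset h, Finset.card_insert_of_notMem fun h => hne (mem_ein.1 h).2, pd]
  push_cast
  ring

theorem pd_addEdge_of_not_subset {A : Finset V} (h : ¬ e ⊆ A) :
    (H.addEdge e he).pd n m A = H.pd n m A := by
  rw [pd, ein_addEdge_of_not_subset h, pd]

theorem pos_addEdge (hp : H.Pos n m) (hne : e ∉ H.edges) (h : (m : ℤ) ≤ H.fd n m e) :
    (H.addEdge e he).Pos n m := by
  intro A
  by_cases hA : e ⊆ A
  · rw [pd_addEdge_of_subset hne hA]
    have := fd_le hp hA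
    omega
  · rw [pd_addEdge_of_not_subset hA]
    exact hp A

/-- A superset of `Y` either contains the new edge and gains `m`, or keeps its old predimension. -/
theorem fd_addEdge (hp : H.Pos n m) (hne : e ∉ H.edges) (h : (m : ℤ) ≤ H.fd n m e)
    (Y : Finset V) :
    (H.addEdge e he).fd n m Y = min (H.fd n m Y) (H.fd n m (Y ∪ e) - m) := by
  have hp' := pos_addEdge (he := he) hp hne h
  apply le_antisymm
  · apply le_min
    · obtain ⟨Z, hZ, e1⟩ := exists_pd_eq_fd hp Y
      refine (fd_le hp' hZ).trans ?_
      by_cases hA : e ⊆ Z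
      · rw [pd_addEdge_of_subset hne hA]; omega
      · rw [pd_addEdge_of_not_subset hA]; omega
    · obtain ⟨Z, hZ, e1⟩ := exists_pd_eq_fd hp (Y ∪ e)
      refine (fd_le hp' (Finset.subset_union_left.trans hZ)).trans ?_
      rw [pd_addEdge_of_subset hne (Finset.subset_union_right.trans hZ)]; omega
  · refine le_fd fun B hB => ?_
    by_cases hA : e ⊆ B
    · rw [pd_addEdge_of_subset hne hA]
      have := fd_le hp (Finset.union_subset hB hA)
      omega
    · rw [pd_addEdge_of_not_subset hA]
      have := fd_le hp hB
      omega

theorem hasFree_addEdge (hp : H.Pos n m) (hne : e ∉ H.edges) (h : (m : ℤ) ≤ H.fd n m e)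
    (hf : H.HasFree n m) : (H.addEdge e he).HasFree n m := by
  intro D
  obtain ⟨w, hw, hY⟩ := hf (D ∪ e)
  refine ⟨w, fun h => hw (Finset.mem_union_left _ h), fun Y hYD => ?_⟩
  rw [fd_addEdge hp hne h, fd_addEdge hp hne h, hY Y (hYD.trans Finset.subset_union_left),
    Finset.insert_union, hY _ (Finset.union_subset_union hYD subset_rfl)]
  omega

end AddEdge

/-- An edge joining a new point to a set lowers the predimension. -/
theorem pd_insert_le_of_edge (hr : 2 ≤ r) {S : Finset V} {w : V} {e : Finset V} (hw : w ∉ S)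
    (he : e ∈ H.edges) (hwe : w ∈ e) (heS : e ⊆ insert w S) :
    H.pd n m (insert w S) + m ≤ H.pd n m S + n := by
  have h1 := H.pd_union_add_inter n m S {w}
  have h2 : S ∩ {w} = ∅ := by
    rw [Finset.inter_singleton_of_notMem hw]
  have h3 : e ∈ H.cross S {w} := by
    refine mem_cross.2 ⟨he, ?_, fun h => hw (h hwe), fun h => ?_⟩
    · rwa [Finset.union_comm, ← Finset.insert_eq]
    · have := Finset.card_le_card h
      rw [H.card_edge e he, Finset.card_singleton] at this
      omega
  have h4 : 1 ≤ (H.cross S {w}).card := Finset.card_pos.2 ⟨e, h3⟩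
  have h5 : (m : ℤ) * 1 ≤ m * (H.cross S {w}).card := by
    gcongr
    exact_mod_cast h4
  have h6 : H.pd n m {w} ≤ n := H.pd_singleton_le n m w
  rw [h2, H.pd_empty n m (by omega), Finset.union_comm, ← Finset.insert_eq] at h1
  omega

/-- A free point lies in no edge with points below it. -/
theorem notMem_edges_of_free (hp : H.Pos n m) (hr : 2 ≤ r) (hm : 1 ≤ m) {S D : Finset V} {w : V}
    (hS : H.FStrong n m S) (hSD : S ⊆ D) (hw : w ∉ D)
    (hf : ∀ Y ⊆ D, H.fd n m (insert w Y) = H.fd n m Y + n) {e : Finset V} (hwe : w ∈ e)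
    (heS : e ⊆ insert w S) : e ∉ H.edges := by
  intro he
  have h1 := pd_insert_le_of_edge (n := n) (m := m) hr (fun h => hw (hSD h)) he hwe heS
  have h2 := hf S hSD
  have h3 := fd_le hp (subset_refl (insert w S))
  have h4 := hS.fd_eq hp
  omega

/-- There is a point attached to a finite strong set `S` by the single edge `T ∪ {a}`. -/
theorem IsGeneric.exists_attached (hH : H.IsGeneric n m) (hr : 2 ≤ r) (hm : 1 ≤ m) (hmn : m ≤ n)
    {S T : Finset V} (hS : H.FStrong n m S) (hT : T ⊆ S) (hTc : T.card + 1 = r) :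
    ∃ a ∉ S, insert a T ∈ H.edges ∧
      ∀ Y ⊆ S, H.fd n m (insert a Y) = min (H.fd n m Y + n) (H.fd n m (Y ∪ T) + n - m) := by
  have hp := hH.pos (by omega)
  have hd := fd_isDim hp
  obtain ⟨w, hw, hfw⟩ := hH.hasFree (by omega) (by omega) hm S
  have hwT : w ∉ T := fun h => hw (hT h)
  have hc : (insert w T).card = r := by rw [Finset.card_insert_of_notMem hwT, hTc]
  have hne : insert w T ∉ H.edges := notMem_edges_of_free hp hr hm hS subset_rfl hw hfw
    (Finset.mem_insert_self _ _) (Finset.insert_subset_insert _ hT)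
  have hfe : (m : ℤ) ≤ H.fd n m (insert w T) := by
    have h1 := hfw T hT
    have h2 := fd_nonneg hp T
    have h3 : (m : ℤ) ≤ n := by exact_mod_cast hmn
    omega
  -- The point is built from a free point `w` by adding the edge in an auxiliary hypergraph. Since
  -- `m ≤ n`, the set `S` stays strong there, and the extension of `S` by `w` is realized.
  set K := H.addEdge (insert w T) hc with hK
  have hKp : K.Pos n m := pos_addEdge hp hne hfe
  have hfd : ∀ Y, K.fd n m Y = min (H.fd n m Y) (H.fd n m (Y ∪ insert w T) - m) :=
    fd_addEdge hp hne hfe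
  have hmn' : (m : ℤ) ≤ n := by exact_mod_cast hmn
  have hnS : ¬ insert w T ⊆ S := fun h => hw (h (Finset.mem_insert_self _ _))
  have hSK : K.FStrong n m S := by
    refine fStrong_of_pd_le hKp ?_
    rw [hK, pd_addEdge_of_not_subset hnS, ← hK, hfd, Finset.union_insert,
      Finset.union_eq_left.2 hT, hfw S subset_rfl, hS.fd_eq hp]
    omega
  have hwSK : K.FStrong n m (insert w S) := by
    refine fStrong_of_pd_le hKp ?_
    rw [hK, pd_addEdge_of_subset hne (Finset.insert_subset_insert _ hT), ← hK, hfd,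
      Finset.union_eq_left.2 (Finset.insert_subset_insert _ hT), hfw S subset_rfl, hS.fd_eq hp]
    have h1 := H.pd_submod n m S {w}
    have h2 : H.pd n m {w} ≤ n := H.pd_singleton_le n m w
    have h3 := hp (S ∩ {w})
    rw [Finset.union_comm, ← Finset.insert_eq] at h1
    omega
  have hid : IsoOn H K id S := by
    refine ⟨Function.injective_id.injOn, fun f hf => ?_⟩
    rw [Finset.image_id, hK, mem_edges_addEdge]
    exact ⟨fun h => h.resolve_left fun h' => hnS (h' ▸ hf), Or.inr⟩
  obtain ⟨α, hα, hαS, hαs⟩ := hH.realize (by omega) hS hKp (D := insert w S) hid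
    (by rw [Finset.image_id]; exact Finset.subset_insert _ _) (by rwa [Finset.image_id])
  have himg : ∀ Y ⊆ S, Y.image α = Y := fun Y hY => image_eq_self fun x hx => hαS x (hY hx)
  refine ⟨α w, fun h => hw ?_, ?_, fun Y hY => ?_⟩
  · have h1 : α (α w) = α w := hαS _ h
    have := hα.1 (Finset.mem_coe.2 (Finset.mem_insert_of_mem h))
      (Finset.mem_coe.2 (Finset.mem_insert_self _ _)) h1
    rwa [this] at h
  · have := (hα.2 (insert w T) (Finset.insert_subset_insert _ hT)).2 (Or.inl rfl)
    rwa [Finset.image_insert, himg T hT] at this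
  · have h1 := hα.fd_image hKp hp hwSK hαs (Finset.insert_subset_insert w hY)
    rw [Finset.image_insert, himg Y hY] at h1
    have h2 : insert w Y ∪ insert w T = insert w (Y ∪ T) := by
      ext x; simp
    rw [h1, hfd, h2, hfw Y hY, hfw _ (Finset.union_subset hY hT)]

end UHypergraph

namespace UHypergraph

variable {r : ℕ} {V W : Type*} {n m : ℕ} {H : UHypergraph r V}

/-! ### Non-trivial automorphisms move generic points far -/

theorem HasFree.exists_finset (hf : H.HasFree n m) (D : Finset V) (k : ℕ) :
    ∃ B : Finset V, B.card = k ∧ Disjoint B D ∧ (∀ Y ⊆ D, H.fd n m (Y ∪ B) = H.fd n m Y + k * n) ∧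
      ∀ b ∈ B, ∀ Y ⊆ D, H.fd n m (insert b Y) = H.fd n m Y + n := by
  induction k with
  | zero => exact ⟨∅, by simp, by simp, by simp, by simp⟩
  | succ k ih =>
    obtain ⟨B, h1, h2, h3, h4⟩ := ih
    obtain ⟨w, hw, hY⟩ := hf (D ∪ B)
    have hwB : w ∉ B := fun h => hw (Finset.mem_union_right _ h)
    have hwD : w ∉ D := fun h => hw (Finset.mem_union_left _ h)
    refine ⟨insert w B, by rw [Finset.card_insert_of_notMem hwB, h1],
      Finset.disjoint_insert_left.2 ⟨hwD, h2⟩, fun Y hYD => ?_, fun b hb Y hYD => ?_⟩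
    · rw [Finset.union_insert, hY _ (Finset.union_subset_union hYD subset_rfl), h3 Y hYD]
      push_cast
      ring
    · rcases Finset.mem_insert.1 hb with rfl | hb
      · exact hY Y (hYD.trans Finset.subset_union_left)
      · exact h4 b hb Y hYD

theorem free_of_subset (hp : H.Pos n m) {X Y : Finset V} {a : V} (hX : X ⊆ Y)
    (h : H.fd n m (insert a Y) = H.fd n m Y + n) : H.fd n m (insert a X) = H.fd n m X + n := by
  have h1 := fd_insert_le hp X a
  have h2 := (fd_isDim hp).submod_of_subset (A := Y) (B := insert a X) (C := X) (D := insert a Y)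
    hX (Finset.subset_insert _ _) (by intro x; simp; tauto)
  omega

/-- Two edges joining a new point to `S` lower the predimension twice. -/
theorem pd_insert_le_of_two_edges (hr : 2 ≤ r) {S : Finset V} {w : V} {e f : Finset V} (hw : w ∉ S)
    (he : e ∈ H.edges) (hwe : w ∈ e) (heS : e ⊆ insert w S) (hf : f ∈ H.edges) (hwf : w ∈ f)
    (hfS : f ⊆ insert w S) (hef : e ≠ f) : H.pd n m (insert w S) + 2 * m ≤ H.pd n m S + n := by
  have h1 := H.pd_union_add_inter n m S {w}
  have h2 : S ∩ {w} = ∅ := by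
    rw [Finset.inter_singleton_of_notMem hw]
  have h3 : ∀ e ∈ H.edges, w ∈ e → e ⊆ insert w S → e ∈ H.cross S {w} := by
    intro e he hwe heS
    refine mem_cross.2 ⟨he, ?_, fun h => hw (h hwe), fun h => ?_⟩
    · rwa [Finset.union_comm, ← Finset.insert_eq]
    · have := Finset.card_le_card h
      rw [H.card_edge e he, Finset.card_singleton] at this
      omega
  have h4 : 2 ≤ (H.cross S {w}).card :=
    Finset.one_lt_card.2 ⟨e, h3 e he hwe heS, f, h3 f hf hwf hfS, hef⟩
  have h5 : (m : ℤ) * 2 ≤ m * (H.cross S {w}).card := by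
    gcongr
    exact_mod_cast h4
  have h6 : H.pd n m {w} ≤ n := H.pd_singleton_le n m w
  rw [h2, H.pd_empty n m (by omega), Finset.union_comm, ← Finset.insert_eq] at h1
  omega

/-- An automorphism which fixes all points free over some finite set is trivial. -/
theorem IsAut.eq_one_of_fix_free (hH : H.IsGeneric n m) (hm : 1 ≤ m)
    (hr : (r = 2 ∧ m < n) ∨ (3 ≤ r ∧ m ≤ n)) {g : Equiv.Perm V} (hg : H.IsAut g) {X : Finset V}
    (h : ∀ a, H.fd n m (insert a X) = H.fd n m X + n → g a = a) : g = 1 := by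
  have hr2 : 2 ≤ r := by omega
  have hp := hH.pos (by omega)
  have hd := fd_isDim hp
  have hmn : m ≤ n := by omega
  -- This is where `r = 2` needs `m < n`, whereas for `r ≥ 3` the auxiliary points give enough.
  have hgain : (1 : ℤ) ≤ ((r - 2 : ℕ) : ℤ) * n + n - m := by
    rcases hr with ⟨rfl, h⟩ | ⟨h3, h⟩
    · simp; omega
    · have h1 : (1 : ℤ) ≤ ((r - 2 : ℕ) : ℤ) := by omega
      have h2 : (1 : ℤ) * n ≤ ((r - 2 : ℕ) : ℤ) * n := by gcongr
      omega
  -- Induction on the codimension `k` over `X`. If `c` were moved, a point `a` attached by an edge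
  -- to `c` and `r - 2` free points has larger dimension over `X` than `c`, or is free, so is fixed
  -- by induction. Then `a` lies on a second edge, with `g c` in place of `c`, although it was
  -- attached to `S` with the cost of only one.
  have key : ∀ k : ℕ, ∀ c, H.fd n m X + n - k ≤ H.fd n m (insert c X) → g c = c := by
    intro k
    induction k with
    | zero =>
      intro c hc
      refine h c ?_
      have := fd_insert_le hp X c
      push_cast at hc
      omega
    | succ k ih =>
      intro c hc
      by_contra hne
      obtain ⟨S₀, hS₀, -, hS₀s, -⟩ := exists_hull hp (insert c (insert (g c) X))
      obtain ⟨B, hBc, hBd, hBf, hBg⟩ := (hH.hasFree (by omega) (by omega) hm).exists_finset S₀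
        (r - 2)
      have hcS₀ : c ∈ S₀ := hS₀ (by simp)
      have hgcS₀ : g c ∈ S₀ := hS₀ (by simp)
      have hXS₀ : X ⊆ S₀ := fun x hx => hS₀ (by simp [hx])
      obtain ⟨S, hS, -, hSs, -⟩ := exists_hull hp (S₀ ∪ B)
      have hcB : c ∉ B := fun h => Finset.disjoint_left.1 hBd h hcS₀
      have hgcB : g c ∉ B := fun h => Finset.disjoint_left.1 hBd h hgcS₀
      have hBS : B ⊆ S := Finset.subset_union_right.trans hS
      have hS₀S : S₀ ⊆ S := Finset.subset_union_left.trans hS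
      obtain ⟨a, haS, hae, haf⟩ := hH.exists_attached hr2 hm hmn hSs (T := insert c B)
        (Finset.insert_subset (hS₀S hcS₀) hBS)
        (by rw [Finset.card_insert_of_notMem hcB, hBc]; omega)
      have hga : g a = a := by
        apply ih
        have h1 := haf X (hXS₀.trans hS₀S)
        have h2 := hBf (insert c X) (Finset.insert_subset hcS₀ hXS₀)
        rw [show insert c X ∪ B = X ∪ insert c B by ext; simp] at h2
        push_cast at hc
        have h3 : (0 : ℤ) ≤ k := by positivity
        rw [h1]
        apply le_min <;> omega
      have hgB : B.image g = B := image_eq_self fun b hb => h b (hBg b hb X hXS₀)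
      have hge : insert a (insert (g c) B) ∈ H.edges := by
        have := (hg _).2 hae
        rwa [Finset.image_insert, Finset.image_insert, hgB, hga] at this
      have h1 := pd_insert_le_of_two_edges (n := n) (m := m) hr2 haS hae (by simp)
        (Finset.insert_subset_insert _ (Finset.insert_subset (hS₀S hcS₀) hBS)) hge (by simp)
        (Finset.insert_subset_insert _ (Finset.insert_subset (hS₀S hgcS₀) hBS)) (by
          intro he
          have : c ∈ insert a (insert (g c) B) := by rw [← he]; simp
          simp only [Finset.mem_insert] at this
          rcases this with rfl | h | h
          · exact haS (hS₀S hcS₀)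
          · exact hne h.symm
          · exact hcB h)
      have h2 := haf S subset_rfl
      rw [Finset.union_eq_left.2 (Finset.insert_subset (hS₀S hcS₀) hBS), hSs.fd_eq hp] at h2
      have h3 := fd_le hp (subset_refl (insert a S))
      omega
  ext c
  refine key n c ?_
  have := hd.mono X (insert c X) (Finset.subset_insert _ _)
  simpa using this

/-! ### How far free points are displaced -/

section Movers

variable (hH : H.IsGeneric n m) (hm : 1 ≤ m) (hr : (r = 2 ∧ m < n) ∨ (3 ≤ r ∧ m ≤ n))
  {g : Equiv.Perm V} (hg : H.IsAut g)

/-- `a` and `g a` are both free over `X`. -/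
def MovFree (n m : ℕ) (H : UHypergraph r V) (g : Equiv.Perm V) (X : Finset V) (a : V) : Prop :=
  H.fd n m (insert a X) = H.fd n m X + n ∧ H.fd n m (insert (g a) X) = H.fd n m X + n

-- Collects further points of displacement at least `β`, each over all earlier points and images, so
-- that dimensions add up. New points avoid `g a`, so `g a` can only lie in the tuple if it equals
-- `a`.
include hH hm hr in
theorem exists_tuple {X : Finset V} {β : ℕ}
    (hβ : ∀ X', ∃ a, MovFree n m H g X' a ∧
      H.fd n m X' + n + β ≤ H.fd n m (insert a (insert (g a) X')))
    {a : V} (ha : MovFree n m H g X a)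
    (ha' : H.fd n m X + n + β ≤ H.fd n m (insert a (insert (g a) X))) (k : ℕ) :
    ∃ A : Finset V, a ∈ A ∧ A.card = k + 1 ∧ H.fd n m (X ∪ A) = H.fd n m X + (k + 1) * n ∧
      H.fd n m (X ∪ A.image g) = H.fd n m X + (k + 1) * n ∧
      H.fd n m X + (k + 1) * (n + β) ≤ H.fd n m (X ∪ A ∪ A.image g) ∧ (g a ∈ A → g a = a) := by
  have hp := hH.pos (by omega)
  induction k with
  | zero =>
    refine ⟨{a}, by simp, by simp, ?_, ?_, ?_, by simp⟩
    · rw [Finset.union_comm, ← Finset.insert_eq, ha.1]; push_cast; ring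
    · rw [Finset.image_singleton, Finset.union_comm, ← Finset.insert_eq, ha.2]; push_cast; ring
    · rw [Finset.image_singleton, show X ∪ {a} ∪ {g a} = insert a (insert (g a) X) by
        ext; simp]
      push_cast
      linarith
  | succ k ih =>
    obtain ⟨A, hA, hc, h1, h2, h3, h4⟩ := ih
    obtain ⟨b, ⟨hb, hgb⟩, hb'⟩ := hβ (X ∪ A ∪ A.image g)
    have hbY : b ∉ X ∪ A ∪ A.image g := fun h => by
      rw [Finset.insert_eq_of_mem h] at hb; omega
    have hbA : b ∉ A := fun h => hbY (by simp [h])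
    refine ⟨insert b A, by simp [hA], by rw [Finset.card_insert_of_notMem hbA, hc], ?_, ?_, ?_, ?_⟩
    · rw [Finset.union_insert, free_of_subset hp (by grind) hb, h1]; push_cast; ring
    · rw [Finset.image_insert, Finset.union_insert, free_of_subset hp (by grind) hgb, h2]
      push_cast; ring
    · rw [show X ∪ insert b A ∪ (insert b A).image g =
        insert b (insert (g b) (X ∪ A ∪ A.image g)) by
          ext; simp [Finset.image_insert]; tauto]
      push_cast
      linarith
    · intro h
      rcases Finset.mem_insert.1 h with h | h
      · exfalso
        apply hbY
        rw [← h]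
        exact Finset.mem_union_right _ (Finset.mem_image_of_mem g hA)
      · exact h4 h

-- Attach `b` by one edge to a set `A` of `r - 1` points around `a`; then `g b` is attached to the
-- image of `A`. As `b` is displaced by at most `β`, a hull `T` of `b`, `g b` and `X` is too small
-- to contain `A` or its image, and too small to allow two different edges between `T` and the hull
-- `S` of `A` and its image. So both edges coincide, which forces `g a = a`.
include hH hm hr hg in
theorem fix_of_bound {X : Finset V} {β : ℕ} (hβm : β < m)
    (hbd : ∀ a, MovFree n m H g X a →
      H.fd n m (insert a (insert (g a) X)) ≤ H.fd n m X + n + β)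
    (hβ : ∀ X', ∃ a, MovFree n m H g X' a ∧
      H.fd n m X' + n + β ≤ H.fd n m (insert a (insert (g a) X')))
    {a : V} (ha : MovFree n m H g X a)
    (ha' : H.fd n m X + n + β ≤ H.fd n m (insert a (insert (g a) X))) : g a = a := by
  have hr2 : 2 ≤ r := by omega
  have hp := hH.pos (by omega)
  have hd := fd_isDim hp
  have hmn : m ≤ n := by omega
  obtain ⟨A, haA, hAc, hXA, hXgA, hXAgA, hfix⟩ := exists_tuple hH hm hr hβ ha ha' (r - 2)
  have hk : ((r - 2 : ℕ) : ℤ) + 1 = (r : ℤ) - 1 := by omega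
  rw [hk] at hXA hXgA hXAgA
  have hn1 : (n : ℤ) ≤ ((r : ℤ) - 1) * n := by nlinarith
  obtain ⟨S, hS, -, hSs, -⟩ := exists_hull hp (X ∪ A ∪ A.image g)
  have hXS : X ⊆ S := by grind
  have hAS : A ⊆ S := by grind
  have hgAS : A.image g ⊆ S := by grind
  -- Choosing `b` outside the preimage of `S` as well keeps `g b` outside `S`.
  obtain ⟨S', hS', -, hS's, -⟩ := exists_hull hp (S ∪ S.image ⇑g⁻¹)
  have hSS' : S ⊆ S' := by grind
  have hgSS' : S.image ⇑g⁻¹ ⊆ S' := by grind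
  obtain ⟨b, hbS', hbe, hbf⟩ := hH.exists_attached hr2 hm hmn hS's (hAS.trans hSS')
    (by rw [hAc]; omega)
  have hbS : b ∉ S := fun h => hbS' (hSS' h)
  have hgbS : g b ∉ S := fun h => hbS' (hgSS' (by
    have := Finset.mem_image_of_mem (⇑g⁻¹) h
    rwa [perm_inv_apply_self] at this))
  have hbX : H.fd n m (insert b X) = H.fd n m X + n := by
    rw [hbf X (hXS.trans hSS'), hXA]
    omega
  have hgbX : H.fd n m (insert (g b) X) = H.fd n m X + n := by
    have e1 : H.fd n m (insert (g b) X) = H.fd n m (insert b (X.image ⇑g⁻¹)) := by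
      rw [← hg.fd_image hp (insert b (X.image ⇑g⁻¹)), Finset.image_insert, image_image_inv]
    have e2 : H.fd n m (X.image ⇑g⁻¹ ∪ A) = H.fd n m (X ∪ A.image g) := by
      rw [← hg.fd_image hp (X.image ⇑g⁻¹ ∪ A), Finset.image_union, image_image_inv]
    rw [e1, hbf _ ((Finset.image_subset_image hXS).trans hgSS'), e2, hg.inv.fd_image hp, hXgA]
    omega
  have hb2 := hbd b ⟨hbX, hgbX⟩
  obtain ⟨T, hT, hTe, hTs, -⟩ := exists_hull hp (insert b (insert (g b) X))
  have hbT : b ∈ T := hT (by simp)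
  have hgbT : g b ∈ T := hT (by simp)
  have hXT : X ⊆ T := fun x hx => hT (by simp [hx])
  have e1 : H.fd n m S + n - m ≤ H.pd n m (S ∪ T) := by
    have h1 := fd_le hp (Finset.insert_subset (Finset.mem_union_right S hbT)
      (Finset.subset_union_left (s₁ := S) (s₂ := T)))
    rw [hbf S hSS', Finset.union_eq_left.2 hAS] at h1
    omega
  rw [hSs.fd_eq hp] at e1
  have e2 := H.pd_union_add_inter n m S T
  have hXST : X ⊆ S ∩ T := Finset.subset_inter hXS hXT
  have e3 := fd_le hp hXST
  have hge : insert (g b) (A.image g) ∈ H.edges := by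
    have := (hg _).2 hbe
    rwa [Finset.image_insert] at this
  have c1 : ¬ A ⊆ T → insert b A ∈ H.cross S T := fun h =>
    mem_cross.2 ⟨hbe, Finset.insert_subset (Finset.mem_union_right _ hbT)
      (hAS.trans Finset.subset_union_left), fun h' => hbS (h' (by simp)),
      fun h' => h ((Finset.subset_insert _ _).trans h')⟩
  have c2 : ¬ A.image g ⊆ T → insert (g b) (A.image g) ∈ H.cross S T := fun h =>
    mem_cross.2 ⟨hge, Finset.insert_subset (Finset.mem_union_right _ hgbT)
      (hgAS.trans Finset.subset_union_left), fun h' => hgbS (h' (by simp)),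
      fun h' => h ((Finset.subset_insert _ _).trans h')⟩
  have c3 : ∀ e ∈ H.cross S T, (m : ℤ) ≤ m * (H.cross S T).card := by
    intro e he
    have h1 : 1 ≤ (H.cross S T).card := Finset.card_pos.2 ⟨e, he⟩
    have h2 : (m : ℤ) * 1 ≤ m * (H.cross S T).card := by
      gcongr
      exact_mod_cast h1
    omega
  -- The identity `e2` yields that the predimension of `S ∩ T` plus `m` per split edge is at most
  -- `H.fd n m X + m + β`; each case compares this with the dimension of what lies in `S ∩ T`.
  by_cases hAT : A ⊆ T <;> by_cases hgAT : A.image g ⊆ T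
  · exfalso
    have h1 := fd_le hp (Finset.union_subset (Finset.union_subset hXST
      (Finset.subset_inter hAS hAT)) (Finset.subset_inter hgAS hgAT))
    have h2 : (0 : ℤ) ≤ m * (H.cross S T).card := by positivity
    have h3 : ((r : ℤ) - 1) * (n + β) ≤ m + β := by omega
    rcases hr with ⟨rfl, h⟩ | ⟨h, h'⟩
    · push_cast at h3
      omega
    · have h4 : (2 : ℤ) * (n + β) ≤ ((r : ℤ) - 1) * (n + β) := by
        gcongr
        omega
      omega
  · exfalso
    have h1 := fd_le hp (Finset.union_subset hXST (Finset.subset_inter hAS hAT))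
    have h2 := c3 _ (c2 hgAT)
    omega
  · exfalso
    have h1 := fd_le hp (Finset.union_subset hXST (Finset.subset_inter hgAS hgAT))
    have h2 := c3 _ (c1 hAT)
    omega
  · by_cases he : insert b A = insert (g b) (A.image g)
    · apply hfix
      have h1 : g a ∈ insert b A := by
        rw [he]
        exact Finset.mem_insert_of_mem (Finset.mem_image_of_mem g haA)
      rcases Finset.mem_insert.1 h1 with h1 | h1
      · exact absurd (hgAS (Finset.mem_image_of_mem g haA)) (by rw [h1]; exact hbS)
      · exact h1
    · exfalso
      have h1 : 2 ≤ (H.cross S T).card :=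
        Finset.one_lt_card.2 ⟨_, c1 hAT, _, c2 hgAT, he⟩
      have h2 : (m : ℤ) * 2 ≤ m * (H.cross S T).card := by
        gcongr
        exact_mod_cast h1
      omega

include hH hm hr hg in
theorem exists_movFree (X : Finset V) : ∃ a, MovFree n m H g X a := by
  have hp := hH.pos (by omega)
  obtain ⟨w, -, hw⟩ := hH.hasFree (by omega) (by omega) hm (X ∪ X.image ⇑g⁻¹)
  refine ⟨w, hw X (by grind), ?_⟩
  have := hw (X.image ⇑g⁻¹) (by grind)
  rwa [← hg.fd_image hp, Finset.image_insert, image_image_inv, hg.inv.fd_image hp] at this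

include hH hm hr hg in
/-- A non-trivial automorphism moves some free point far away from itself. -/
theorem exists_mover (hg1 : g ≠ 1) (X : Finset V) :
    ∃ a, MovFree n m H g X a ∧ H.fd n m X + n + m ≤ H.fd n m (insert a (insert (g a) X)) := by
  have hp := hH.pos (by omega)
  have hd := fd_isDim hp
  by_contra! hcon
  -- The least such bound, over all finite sets, is below `m` by assumption and by minimality is
  -- attained over every finite set.
  let P : ℕ → Prop := fun β => ∃ X, ∀ a, MovFree n m H g X a →
      H.fd n m (insert a (insert (g a) X)) ≤ H.fd n m X + n + β
  have hP : ∃ β, P β := ⟨m - 1, X, fun a ha => by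
    have := hcon a ha
    omega⟩
  obtain ⟨X₀, hX₀⟩ := Nat.find_spec hP
  have hlt : Nat.find hP < m := by
    refine lt_of_le_of_lt (Nat.find_min' hP (m := m - 1) ⟨X, fun a ha => ?_⟩) (by omega)
    have := hcon a ha
    omega
  have hβ : ∀ X', ∃ a, MovFree n m H g X' a ∧
      H.fd n m X' + n + (Nat.find hP : ℕ) ≤ H.fd n m (insert a (insert (g a) X')) := by
    intro X'
    rcases Nat.eq_zero_or_pos (Nat.find hP) with h0 | h0
    · obtain ⟨a, ha⟩ := exists_movFree hH hm hr hg X'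
      refine ⟨a, ha, ?_⟩
      have h1 := hd.mono (insert a X') (insert a (insert (g a) X')) (by grind)
      rw [ha.1] at h1
      rw [h0]
      push_cast
      omega
    · have h1 := Nat.find_min hP (m := Nat.find hP - 1) (by omega)
      simp only [P, not_exists, not_forall] at h1
      obtain ⟨a, ha, h2⟩ := h1 X'
      exact ⟨a, ha, by omega⟩
  have hfix := fun {a} => fix_of_bound hH hm hr hg hlt hX₀ hβ (a := a)
  have h0 : Nat.find hP = 0 := by
    obtain ⟨a, ha, ha'⟩ := hβ X₀
    have h1 := hfix ha ha'
    rw [h1, Finset.insert_idem, ha.1] at ha'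
    omega
  refine hg1 (hg.eq_one_of_fix_free hH hm hr (X := X₀ ∪ X₀.image ⇑g⁻¹) fun a ha => ?_)
  have ha1 : MovFree n m H g X₀ a := by
    refine ⟨free_of_subset hp (by grind) ha, ?_⟩
    have := free_of_subset hp (X := X₀.image ⇑g⁻¹) (by grind) ha
    rwa [← hg.fd_image hp, Finset.image_insert, image_image_inv, hg.inv.fd_image hp] at this
  refine hfix ha1 ?_
  have h1 := hd.mono (insert a X₀) (insert a (insert (g a) X₀)) (by grind)
  rw [ha1.1] at h1
  rw [h0]
  push_cast
  omega

end Movers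

end UHypergraph

namespace UHypergraph

variable {r : ℕ} {V W : Type*} {n m : ℕ} {H : UHypergraph r V}

/-! ### Adding edges to make a set algebraic -/

/-- Equalities of dimensions of nested sets persist from `K` to `K'`. -/
def Persist (n m : ℕ) (K K' : UHypergraph r V) : Prop :=
  ∀ Y Z, Y ⊆ Z → K.fd n m Y = K.fd n m Z → K'.fd n m Y = K'.fd n m Z

/-- The standing assumptions on the sets used to make `F` algebraic over `E₂`, leaving it as free
as possible over `E₁`. The sets `C s` provide the auxiliary points on the edges to be added. -/
structure KillSetup (n m : ℕ) (H : UHypergraph r V) (E E₁ E₂ F : Finset V) (C : ℕ → Finset V)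
    (N : ℕ) : Prop where
  sub₁ : E₁ ⊆ E
  sub₂ : E₂ ⊆ E
  mono : Monotone C
  sub_C : ∀ s ≤ N, C s ⊆ E₂
  card : ∀ s < N, r ≤ (C (s + 1) \ C s).card
  gain : ∀ s < N, ∀ c ∈ C (s + 1) \ C s,
    H.fd n m (E₁ ∪ C s) + m ≤ H.fd n m (insert c (E₁ ∪ C s))
  notMem : ∀ c ∈ C N, c ∉ F

/-- The properties of the hypergraphs arising from `H` in the course of making `F` algebraic over
`E₂`. The set `T` contains the points under consideration, and `s` measures the auxiliary points
not yet used. -/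
structure KillState (n m : ℕ) (H : UHypergraph r V) (E E₁ E₂ F : Finset V) (C : ℕ → Finset V)
    (N : ℕ) (k : ℤ) (K : UHypergraph r V) (T : Finset V) (s : ℕ) : Prop where
  pos : K.Pos n m
  free : K.HasFree n m
  fd_eq : ∀ Y ⊆ E, K.fd n m Y = H.fd n m Y
  edge_E : ∀ e ⊆ E, e ∈ K.edges ↔ e ∈ H.edges
  edge_F : ∀ e ⊆ F, e ∈ K.edges ↔ e ∈ H.edges
  indep : H.fd n m (E₁ ∪ C s) + k ≤ K.fd n m (F ∪ (E₁ ∪ C s))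
  shift : ∀ Y ⊆ T, K.fd n m (E ∪ Y) - H.fd n m E = K.fd n m (E₂ ∪ Y) - H.fd n m E₂
  edge_T : ∀ e ∈ K.edges, e ⊆ E ∪ T → ∀ c ∈ C s, c ∈ e → e ⊆ E
  disj : Disjoint T E
  cover : F ⊆ E ∪ T
  le : s ≤ N

theorem Persist.trans {K K' K'' : UHypergraph r V} (h : Persist n m K K') (h' : Persist n m K' K'') :
    Persist n m K K'' :=
  fun Y Z hYZ e => h' Y Z hYZ (h Y Z hYZ e)

/-- If `Z` is algebraic over `Y`, adjoining `e` to both does not separate them, so both minima in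
`fd_addEdge` agree. -/
theorem persist_addEdge {K : UHypergraph r V} (hp : K.Pos n m) {e : Finset V} {he : e.card = r}
    (hne : e ∉ K.edges) (h : (m : ℤ) ≤ K.fd n m e) : Persist n m K (K.addEdge e he) := by
  intro Y Z hYZ hd
  have h1 := (fd_isDim hp).submod_of_subset (A := Z) (B := Y ∪ e) (C := Y) (D := Z ∪ e) hYZ
    Finset.subset_union_left (by grind)
  have h2 := (fd_isDim hp).mono (Y ∪ e) (Z ∪ e) (by grind)
  rw [fd_addEdge hp hne h, fd_addEdge hp hne h, hd, show K.fd n m (Y ∪ e) = K.fd n m (Z ∪ e) by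
    omega]

section Kill

variable {E E₁ E₂ F : Finset V} {C : ℕ → Finset V} {N : ℕ} {k : ℤ}

theorem KillState.indep_of_subset {K : UHypergraph r V} {T : Finset V} {s : ℕ}
    (hS : KillSetup n m H E E₁ E₂ F C N) (h : KillState n m H E E₁ E₂ F C N k K T s)
    {Q : Finset V} (hQ : Q ⊆ E₁ ∪ C s) : H.fd n m Q + k ≤ K.fd n m (F ∪ Q) := by
  have h1 := (fd_isDim h.pos).submod_of_subset (A := F ∪ Q) (B := E₁ ∪ C s) (C := Q)
    (D := F ∪ (E₁ ∪ C s)) (by grind) hQ (by grind)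
  have h2 : E₁ ∪ C s ⊆ E := Finset.union_subset hS.sub₁ ((hS.sub_C s h.le).trans hS.sub₂)
  rw [h.fd_eq _ h2, h.fd_eq _ (hQ.trans h2)] at h1
  have h3 := h.indep
  omega

theorem KillState.mono {K : UHypergraph r V} {T : Finset V} {s t : ℕ}
    (hS : KillSetup n m H E E₁ E₂ F C N) (h : KillState n m H E E₁ E₂ F C N k K T s)
    (hts : t ≤ s) : KillState n m H E E₁ E₂ F C N k K T t :=
  { h with
    indep := h.indep_of_subset hS (Finset.union_subset_union subset_rfl (hS.mono hts))
    edge_T := fun e he heT c hc => h.edge_T e he heT c (hS.mono hts hc)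
    le := hts.trans h.le }

/-- The bounds `hY` and `hJ` say that the edge can be afforded: inside `E` nothing changes, and the
independence of `F` from `E₁ ∪ C s` survives the loss of `m`. The relative dimension over `E`
remains that over `E₂` because the edge lies in `E₂ ∪ T`. -/
theorem KillState.addEdge {K : UHypergraph r V} {T : Finset V} {s : ℕ} (hp : H.Pos n m)
    (hS : KillSetup n m H E E₁ E₂ F C N) (h : KillState n m H E E₁ E₂ F C N k K T s)
    {e : Finset V} (he : e.card = r) (hne : e ∉ K.edges)
    (hY : ∀ Y ⊆ E, H.fd n m Y + m ≤ K.fd n m (Y ∪ e)) (heE : ¬ e ⊆ E) (heF : ¬ e ⊆ F)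
    (hJ : H.fd n m (E₁ ∪ C s) + k + m ≤ K.fd n m (F ∪ (E₁ ∪ C s) ∪ e)) (heT : e ⊆ E₂ ∪ T)
    (hec : ∀ c ∈ C s, c ∉ e) :
    KillState n m H E E₁ E₂ F C N k (K.addEdge e he) T s ∧ Persist n m K (K.addEdge e he) ∧
      ∀ Y, (K.addEdge e he).fd n m Y = min (K.fd n m Y) (K.fd n m (Y ∪ e) - m) := by
  have hme : (m : ℤ) ≤ K.fd n m e := by
    have h1 := hY ∅ (by simp)
    have h2 := fd_nonneg hp (∅ : Finset V)
    rw [Finset.empty_union] at h1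
    omega
  have hfd : ∀ Y, (K.addEdge e he).fd n m Y = min (K.fd n m Y) (K.fd n m (Y ∪ e) - m) :=
    fd_addEdge h.pos hne hme
  refine ⟨⟨pos_addEdge h.pos hne hme, hasFree_addEdge h.pos hne hme h.free, fun Y hYE => ?_,
    fun f hf => ?_, fun f hf => ?_, ?_, fun Y hYT => ?_, fun f hf hfT c hc hcf => ?_, h.disj,
    h.cover, h.le⟩, persist_addEdge h.pos hne hme, hfd⟩
  · have h1 := hY Y hYE
    rw [hfd, h.fd_eq Y hYE]
    omega
  · rw [mem_edges_addEdge, h.edge_E f hf]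
    exact ⟨fun h' => h'.resolve_left fun h' => heE (h' ▸ hf), Or.inr⟩
  · rw [mem_edges_addEdge, h.edge_F f hf]
    exact ⟨fun h' => h'.resolve_left fun h' => heF (h' ▸ hf), Or.inr⟩
  · have h1 := h.indep
    rw [hfd]
    apply le_min <;> omega
  · have e1 : E ∪ Y ∪ e = E ∪ (Y ∪ e ∩ T) := by
      ext x
      have h1 := @heT x
      have h2 := @hS.sub₂ x
      simp only [Finset.mem_union, Finset.mem_inter] at *
      tauto
    have e2 : E₂ ∪ Y ∪ e = E₂ ∪ (Y ∪ e ∩ T) := by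
      ext x
      have h1 := @heT x
      simp only [Finset.mem_union, Finset.mem_inter] at *
      tauto
    have h1 := h.shift Y hYT
    have h2 := h.shift (Y ∪ e ∩ T) (Finset.union_subset hYT Finset.inter_subset_right)
    rw [hfd, hfd, e1, e2]
    omega
  · rcases hf with rfl | hf
    · exact absurd hcf (hec c hc)
    · exact h.edge_T f hf hfT c hc hcf

theorem KillState.addFree (hr : 2 ≤ r) (hm : 1 ≤ m) {K : UHypergraph r V} {T : Finset V} {s : ℕ}
    (hS : KillSetup n m H E E₁ E₂ F C N) (h : KillState n m H E E₁ E₂ F C N k K T s) :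
    ∃ w, w ∉ E ∪ T ∧ (∀ Y ⊆ E ∪ T, K.fd n m (insert w Y) = K.fd n m Y + n) ∧
      (∀ e, w ∈ e → e ⊆ E ∪ insert w T → e ∉ K.edges) ∧
      KillState n m H E E₁ E₂ F C N k K (insert w T) s := by
  obtain ⟨Z, hZ, -, hZs, -⟩ := exists_hull h.pos (E ∪ T)
  obtain ⟨w, hw, hf⟩ := h.free Z
  have hwE : w ∉ E ∪ T := fun h' => hw (hZ h')
  have hf' : ∀ Y ⊆ E ∪ T, K.fd n m (insert w Y) = K.fd n m Y + n := fun Y hY => hf Y (hY.trans hZ)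
  have hno : ∀ e, w ∈ e → e ⊆ E ∪ insert w T → e ∉ K.edges := fun e hwe he =>
    notMem_edges_of_free h.pos hr hm hZs subset_rfl hw hf hwe (he.trans (by
      rw [Finset.union_insert]; exact Finset.insert_subset_insert _ hZ))
  refine ⟨w, hwE, hf', hno, { h with
    shift := fun Y hY => ?_
    edge_T := fun e he heT c hc hce => ?_
    disj := Finset.disjoint_insert_left.2 ⟨fun h' => hwE (Finset.mem_union_left _ h'), h.disj⟩
    cover := h.cover.trans (Finset.union_subset_union subset_rfl (Finset.subset_insert _ _)) }⟩
  · by_cases hwY : w ∈ Y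
    · have hY' : Y.erase w ⊆ T := fun x hx =>
        (Finset.mem_insert.1 (hY (Finset.mem_of_mem_erase hx))).resolve_left
          (Finset.ne_of_mem_erase hx)
      have h1 := h.shift _ hY'
      have h2 := hf' (E ∪ Y.erase w) (Finset.union_subset_union subset_rfl hY')
      have h3 := hf' (E₂ ∪ Y.erase w) (Finset.union_subset_union hS.sub₂ hY')
      rw [← Finset.union_insert, Finset.insert_erase hwY] at h2 h3
      omega
    · exact h.shift Y fun x hx => (Finset.mem_insert.1 (hY hx)).resolve_left fun h' =>
        hwY (h' ▸ hx)
  · have hwe : w ∉ e := fun hwe => hno e hwe heT he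
    refine h.edge_T e he (fun x hx => ?_) c hc hce
    have h1 := heT hx
    have h2 : x ≠ w := fun h' => hwe (h' ▸ hx)
    simp only [Finset.mem_union, Finset.mem_insert] at h1 ⊢
    tauto

set_option maxHeartbeats 1000000 in
/-- Adding edges makes a point algebraic. -/
theorem KillState.kill (hr : 2 ≤ r) (hm : 1 ≤ m) (hmn : m ≤ n) (hp : H.Pos n m)
    (hS : KillSetup n m H E E₁ E₂ F C N) (t : ℕ) : ∀ {K : UHypergraph r V} {T : Finset V} {s : ℕ}
    (_ : KillState n m H E E₁ E₂ F C N k K T (s + t)) {z : V} (_ : z ∈ T) {κ : ℤ} {j : ℕ}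
    (_ : K.fd n m (insert z E₂) = H.fd n m E₂ + κ) (_ : κ + n * j = m * t),
    ∃ K' T', T ⊆ T' ∧ KillState n m H E E₁ E₂ F C N k K' T' s ∧ Persist n m K K' ∧
      K'.fd n m (insert z E₂) = H.fd n m E₂ := by
  induction t with
  | zero =>
    intro K T s h z hz κ j hκ hj
    have h1 := (fd_isDim h.pos).mono E₂ (insert z E₂) (Finset.subset_insert _ _)
    rw [h.fd_eq _ hS.sub₂] at h1
    have h2 : (0 : ℤ) ≤ n * j := by positivity
    refine ⟨K, T, subset_rfl, h, fun _ _ _ e => e, ?_⟩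
    push_cast at hj
    omega
  | succ t ih =>
    intro K T s h z hz κ j hκ hj
    have hd := fd_isDim h.pos
    have hle : s + t < N := by have := h.le; omega
    have hmono := hd.mono E₂ (insert z E₂) (Finset.subset_insert _ _)
    rw [h.fd_eq _ hS.sub₂] at hmono
    have hzE : z ∉ E := fun h' => Finset.disjoint_left.1 h.disj hz h'
    have hCsub : C (s + t + 1) ⊆ E₂ := hS.sub_C _ hle
    have hst : KillState n m H E E₁ E₂ F C N k K T (s + t) := h.mono hS (by omega)
    rcases eq_or_ne κ 0 with rfl | hκ0
    · exact ⟨K, T, subset_rfl, h.mono hS (by omega), fun _ _ _ e => e, by omega⟩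
    by_cases hκm : (m : ℤ) ≤ κ
    -- With at least `m` left, an edge through `z` and `r - 1` fresh supply points lowers the
    -- dimension of `z` over `E₂` by `m`. The gain of `c` pays for it as regards `F`, at the price
    -- of one block of the supply.
    · obtain ⟨Q, hQ, hQc⟩ := Finset.exists_subset_card_eq (s := C (s + t + 1) \ C (s + t))
        (n := r - 1) (by have := hS.card _ hle; omega)
      have hQC : Q ⊆ C (s + t + 1) := hQ.trans Finset.sdiff_subset
      have hQ2 : Q ⊆ E₂ := hQC.trans hCsub
      have hzQ : z ∉ Q := fun h' => hzE (hS.sub₂ (hQ2 h'))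
      obtain ⟨c, hc⟩ : Q.Nonempty := Finset.card_pos.1 (by omega)
      have he : (insert z Q).card = r := by
        rw [Finset.card_insert_of_notMem hzQ, hQc]; omega
      have heT : insert z Q ⊆ E₂ ∪ T :=
        Finset.insert_subset (Finset.mem_union_right _ hz) (hQ2.trans Finset.subset_union_left)
      have hsh := h.shift {z} (by simpa using hz)
      rw [Finset.union_comm E, ← Finset.insert_eq, Finset.union_comm E₂, ← Finset.insert_eq] at hsh
      obtain ⟨h1, h2, h3⟩ := hst.addEdge hp hS he
        (fun h' => hzE (h.edge_T _ h' (heT.trans (Finset.union_subset_union hS.sub₂ subset_rfl)) c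
          (hQC hc) (Finset.mem_insert_of_mem hc) (Finset.mem_insert_self _ _)))
        (fun Y hY => by
          have f1 := hd.submod_of_subset (A := E) (B := Y ∪ insert z Q) (C := Y) (D := insert z E)
            hY Finset.subset_union_left
            (Finset.insert_subset (by simp) Finset.subset_union_left)
          rw [h.fd_eq _ subset_rfl, h.fd_eq _ hY] at f1
          omega)
        (fun h' => hzE (h' (Finset.mem_insert_self _ _)))
        (fun h' => hS.notMem c (hS.mono hle (hQC hc)) (h' (Finset.mem_insert_of_mem hc)))
        (by
          have f1 := hS.gain _ hle c (hQ hc)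
          have f2 := h.indep_of_subset hS (Q := insert c (E₁ ∪ C (s + t)))
            (Finset.insert_subset (Finset.mem_union_right _ (hQC hc))
              (Finset.union_subset_union subset_rfl (hS.mono (by omega))))
          have f3 := hd.mono (F ∪ insert c (E₁ ∪ C (s + t)))
            (F ∪ (E₁ ∪ C (s + t)) ∪ insert z Q)
            (Finset.union_subset (Finset.subset_union_left.trans Finset.subset_union_left)
              (Finset.insert_subset
                (Finset.mem_union_right _ (Finset.mem_insert_of_mem hc))
                (Finset.subset_union_right.trans Finset.subset_union_left)))
          omega)
        heT
        (fun x hx h' => by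
          rcases Finset.mem_insert.1 h' with rfl | h'
          · exact hzE (hS.sub₂ (hS.sub_C _ hle.le hx))
          · exact (Finset.mem_sdiff.1 (hQ h')).2 hx)
      obtain ⟨K', T', g1, g2, g3, g4⟩ := ih h1 hz (κ := κ - m) (j := j)
        (by
          rw [h3, Finset.union_eq_left.2 (Finset.insert_subset_insert z hQ2), hκ]
          omega)
        (by push_cast at hj ⊢; linarith)
      exact ⟨K', T', g1, g2, h2.trans g3, g4⟩
    -- With less than `m` left, a free point `w` is joined to `z`; being free, `w` pays for the
    -- edge. Now `z` is algebraic over `E₂` and `w`, and `w` has dimension `κ + n - m` over `E₂`, so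
    -- it suffices to continue with `w`, with `j` and `t` lowered by one.
    · obtain ⟨j, rfl⟩ : ∃ i, j = i + 1 := by
        rcases Nat.eq_zero_or_pos j with rfl | hj0
        · exfalso
          push_cast at hj
          have : (0 : ℤ) ≤ m * t := by positivity
          have : κ = m * t + m := by linarith
          omega
        · exact ⟨j - 1, by omega⟩
      obtain ⟨w, hw, hwf, hno, hstw⟩ := hst.addFree hr hm hS
      obtain ⟨Q, hQ, hQc⟩ := Finset.exists_subset_card_eq (s := C (s + t + 1) \ C (s + t))
        (n := r - 2) (by have := hS.card _ hle; omega)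
      have hQC : Q ⊆ C (s + t + 1) := hQ.trans Finset.sdiff_subset
      have hQ2 : Q ⊆ E₂ := hQC.trans hCsub
      have hQE : Q ⊆ E := hQ2.trans hS.sub₂
      have hzQ : z ∉ Q := fun h' => hzE (hQE h')
      have hwE : w ∉ E := fun h' => hw (Finset.mem_union_left _ h')
      have hwz : w ≠ z := fun h' => hw (Finset.mem_union_right _ (h' ▸ hz))
      have hwQ : w ∉ insert z Q := by
        rw [Finset.mem_insert, not_or]
        exact ⟨hwz, fun h' => hwE (hQE h')⟩
      have he : (insert w (insert z Q)).card = r := by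
        rw [Finset.card_insert_of_notMem hwQ, Finset.card_insert_of_notMem hzQ, hQc]; omega
      have heT : insert w (insert z Q) ⊆ E₂ ∪ insert w T := by
        intro x hx
        have := @hQ2 x
        simp only [Finset.mem_insert, Finset.mem_union] at *
        rcases hx with rfl | rfl | hx <;> tauto
      have hmn' : (m : ℤ) ≤ n := by exact_mod_cast hmn
      have hzQT : insert z Q ⊆ E ∪ T := Finset.insert_subset (Finset.mem_union_right _ hz)
        (hQE.trans Finset.subset_union_left)
      have hEC : E₁ ∪ C (s + t) ⊆ E :=
        Finset.union_subset hS.sub₁ ((hS.sub_C _ hle.le).trans hS.sub₂)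
      obtain ⟨h1, h2, h3⟩ := hstw.addEdge hp hS he
        (hno _ (Finset.mem_insert_self _ _)
          (heT.trans (Finset.union_subset_union hS.sub₂ subset_rfl)))
        (fun Y hY => by
          rw [Finset.union_insert, hwf _ (Finset.union_subset
            (hY.trans Finset.subset_union_left) hzQT)]
          have f1 := hd.mono Y (Y ∪ insert z Q) Finset.subset_union_left
          rw [h.fd_eq _ hY] at f1
          omega)
        (fun h' => hwE (h' (Finset.mem_insert_self _ _)))
        (fun h' => hw (h.cover (h' (Finset.mem_insert_self _ _))))
        (by
          rw [Finset.union_insert, hwf _ (Finset.union_subset (Finset.union_subset h.cover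
            (hEC.trans Finset.subset_union_left)) hzQT)]
          have f1 := hd.mono (F ∪ (E₁ ∪ C (s + t))) (F ∪ (E₁ ∪ C (s + t)) ∪ insert z Q)
            Finset.subset_union_left
          have f2 := hst.indep
          omega)
        heT
        (fun x hx h' => by
          have hxE : x ∈ E := hS.sub₂ (hS.sub_C _ hle.le hx)
          simp only [Finset.mem_insert] at h'
          rcases h' with rfl | rfl | h'
          · exact hwE hxE
          · exact hzE hxE
          · exact (Finset.mem_sdiff.1 (hQ h')).2 hx)
      have hE2T : insert z E₂ ⊆ E ∪ T := Finset.insert_subset (Finset.mem_union_right _ hz)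
        (hS.sub₂.trans Finset.subset_union_left)
      have f1 := hwf _ hE2T
      have f2 := hwf E₂ (hS.sub₂.trans Finset.subset_union_left)
      have u1 : insert w E₂ ∪ insert w (insert z Q) = insert w (insert z E₂) := by
        ext x
        have := @hQ2 x
        simp only [Finset.mem_insert, Finset.mem_union] at *
        tauto
      have u2 : insert w (insert z E₂) ∪ insert w (insert z Q) = insert w (insert z E₂) := by
        ext x
        have := @hQ2 x
        simp only [Finset.mem_insert, Finset.mem_union] at *
        tauto
      have v1 := h3 (insert w E₂)
      have v2 := h3 (insert w (insert z E₂))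
      rw [u1, f1, f2, hκ, h.fd_eq _ hS.sub₂] at v1
      rw [u2, f1, hκ] at v2
      obtain ⟨K', T', g1, g2, g3, g4⟩ := ih h1 (Finset.mem_insert_self w T) (κ := κ + n - m)
        (j := j) (by rw [v1]; omega) (by push_cast at hj ⊢; linarith)
      refine ⟨K', T', (Finset.subset_insert _ _).trans g1, g2, h2.trans g3, ?_⟩
      have w1 := g3 (insert w E₂) (insert w (insert z E₂))
        (Finset.insert_subset_insert _ (Finset.subset_insert _ _)) (by omega)
      have w2 := (fd_isDim g2.pos).mono (insert z E₂) (insert w (insert z E₂))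
        (Finset.subset_insert _ _)
      have w3 := (fd_isDim g2.pos).mono E₂ (insert z E₂) (Finset.subset_insert _ _)
      rw [g2.fd_eq _ hS.sub₂] at w3
      omega

/-- As `n` is invertible modulo `m`, some `j < m` works. Here `t` is the number of edges needed to
make a point of dimension `a` algebraic and `j` the number of free points; the bound on `t` is
uniform, so that the supply can be fixed in advance. -/
theorem exists_multiple (hnm : Nat.Coprime n m) (hm : 1 ≤ m) {a : ℕ} (ha : a ≤ n) :
    ∃ j t : ℕ, (a : ℤ) + n * j = m * t ∧ t ≤ n + n * m := by
  have : NeZero m := ⟨by omega⟩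
  let u := ZMod.unitOfCoprime n hnm
  let j : ℕ := (-(a : ZMod m) * (↑u⁻¹ : ZMod m)).val
  have hj : j < m := ZMod.val_lt _
  have h1 : ((a + n * j : ℕ) : ZMod m) = 0 := by
    have hu : (n : ZMod m) = u := (ZMod.coe_unitOfCoprime n hnm).symm
    push_cast
    rw [ZMod.natCast_val, ZMod.cast_id, hu]
    have : (u : ZMod m) * (-(a : ZMod m) * (↑u⁻¹ : ZMod m)) = -a := by
      rw [mul_left_comm, Units.mul_inv, mul_one]
    rw [this]
    ring
  obtain ⟨t, ht⟩ := (ZMod.natCast_eq_zero_iff _ _).1 h1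
  refine ⟨j, t, by exact_mod_cast ht, ?_⟩
  have h2 : n * j ≤ n * m := Nat.mul_le_mul_left _ hj.le
  have h3 : 1 * t ≤ m * t := Nat.mul_le_mul_right _ hm
  omega

/-- Points already made algebraic remain so by `Persist`; each point uses at most `n + n * m` blocks
of the supply. -/
theorem KillState.kill_all (hr : 2 ≤ r) (hnm : Nat.Coprime n m) (hm : 1 ≤ m) (hmn : m ≤ n)
    (hp : H.Pos n m) (hS : KillSetup n m H E E₁ E₂ F C N) {K : UHypergraph r V} {T : Finset V}
    (B : Finset V) : ∀ {s : ℕ},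
    KillState n m H E E₁ E₂ F C N k K T (s + (n + n * m) * B.card) → B ⊆ T →
    ∃ K' T', T ⊆ T' ∧ KillState n m H E E₁ E₂ F C N k K' T' s ∧ Persist n m K K' ∧
      ∀ z ∈ B, K'.fd n m (insert z E₂) = H.fd n m E₂ := by
  induction B using Finset.induction_on with
  | empty =>
    intro s h _
    exact ⟨K, T, subset_rfl, by simpa using h, fun _ _ _ e => e, by simp⟩
  | insert b B hb ih =>
    intro s h hBT
    rw [Finset.card_insert_of_notMem hb] at h
    obtain ⟨K₁, T₁, h1, h2, h3, h4⟩ := ih (s := s + (n + n * m))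
      (by convert h using 1; ring) ((Finset.subset_insert _ _).trans hBT)
    have hd := fd_isDim h2.pos
    have hle := fd_insert_le h2.pos E₂ b
    have hge := hd.mono E₂ (insert b E₂) (Finset.subset_insert _ _)
    rw [h2.fd_eq _ hS.sub₂] at hle hge
    obtain ⟨a, ha⟩ : ∃ a : ℕ, K₁.fd n m (insert b E₂) = H.fd n m E₂ + a :=
      ⟨(K₁.fd n m (insert b E₂) - H.fd n m E₂).toNat, by omega⟩
    obtain ⟨j, t, hjt, ht⟩ := exists_multiple hnm hm (a := a) (by omega)
    obtain ⟨K₂, T₂, g1, g2, g3, g4⟩ := (h2.mono hS (t := s + t) (by omega)).kill hr hm hmn hp hS t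
      (h1 (hBT (Finset.mem_insert_self _ _))) ha hjt
    refine ⟨K₂, T₂, h1.trans g1, g2, h3.trans g3, fun z hz => ?_⟩
    rcases Finset.mem_insert.1 hz with rfl | hz
    · exact g4
    · have := g3 E₂ (insert z E₂) (Finset.subset_insert _ _)
        (by rw [h4 z hz, h2.fd_eq _ hS.sub₂])
      rw [← this, g2.fd_eq _ hS.sub₂]

end Kill

end UHypergraph

namespace UHypergraph

variable {r : ℕ} {V W : Type*} {n m : ℕ} {H : UHypergraph r V}

/-! ### Moving types maximally -/

section Moving

variable (hH : H.IsGeneric n m) (hm : 1 ≤ m) (hr : (r = 2 ∧ m < n) ∨ (3 ≤ r ∧ m ≤ n))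
  {g : Equiv.Perm V} (hg : H.IsAut g) (hg1 : g ≠ 1)
include hH hm hr hg hg1

/-- A supply of points, moved far by `g`. -/
theorem exists_supply {X X' : Finset V} (hX : X ⊆ X') :
    ∃ C : ℕ → Finset V, Monotone C ∧ (∀ s, r ≤ (C (s + 1) \ C s).card) ∧
      (∀ s, ∀ c ∈ C s, c ∉ dcl (H.fd n m) X) ∧
      ∀ N, ∀ s < N, ∀ c ∈ C (s + 1) \ C s, H.fd n m (X' ∪ (C N).image g ∪ C s) + m ≤
        H.fd n m (insert c (X' ∪ (C N).image g ∪ C s)) := by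
  have hp := hH.pos (by omega)
  have hd := fd_isDim hp
  have hn : (1 : ℤ) ≤ n := by omega
  choose mv hmv hmv' using exists_mover hH hm hr hg hg1
  obtain ⟨Y, c, hY0, hYs, hc, hc'⟩ : ∃ (Y : ℕ → Finset V) (c : ℕ → V), Y 0 = X' ∧
      (∀ i, Y (i + 1) = insert (c i) (insert (g (c i)) (Y i))) ∧
      (∀ i, MovFree n m H g (Y i) (c i)) ∧
      ∀ i, H.fd n m (Y i) + n + m ≤ H.fd n m (insert (c i) (insert (g (c i)) (Y i))) :=
    ⟨fun i => Nat.rec X' (fun _ Z => insert (mv Z) (insert (g (mv Z)) Z)) i, _, rfl,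
      fun _ => rfl, fun _ => hmv _, fun _ => hmv' _⟩
  have hY : ∀ i, Y i = X' ∪ (Finset.range i).image c ∪ (Finset.range i).image (g ∘ c) := by
    intro i
    induction i with
    | zero => simp [hY0]
    | succ i ih =>
      rw [hYs, ih, Finset.range_add_one, Finset.image_insert, Finset.image_insert]
      ext x
      simp only [Finset.mem_insert, Finset.mem_union, Function.comp_apply]
      tauto
  have hcY : ∀ i, c i ∉ Y i := fun i h => by
    have := (hc i).1
    rw [Finset.insert_eq_of_mem h] at this
    omega
  have hcY' : ∀ i j, j < i → c j ∈ Y i := fun i j hij => by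
    rw [hY]
    exact Finset.mem_union_left _ (Finset.mem_union_right _
      (Finset.mem_image_of_mem c (Finset.mem_range.2 hij)))
  have hci : Function.Injective c := by
    intro i j hij
    rcases lt_trichotomy i j with h | h | h
    · exact absurd (hcY' j i h) (hij ▸ hcY j)
    · exact h
    · exact absurd (hcY' i j h) (hij ▸ hcY i)
  -- Each later image `g (c j)` is free over everything before it and so contributes exactly `n`.
  have htail : ∀ i k, H.fd n m (Y i ∪ (Finset.Ico i (i + k)).image (g ∘ c)) =
      H.fd n m (Y i) + k * n := by
    intro i k
    induction k with
    | zero => simp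
    | succ k ih =>
      have h1 : Y i ∪ (Finset.Ico i (i + k)).image (g ∘ c) ⊆ Y (i + k) := by
        rw [hY, hY]
        refine Finset.union_subset (Finset.union_subset_union (Finset.union_subset_union
          subset_rfl (Finset.image_subset_image ?_)) (Finset.image_subset_image ?_))
          ((Finset.image_subset_image ?_).trans Finset.subset_union_right)
        all_goals
          intro x hx
          simp only [Finset.mem_range, Finset.mem_Ico] at hx ⊢
          omega
      have h2 := free_of_subset hp h1 (hc (i + k)).2
      have h3 : Y i ∪ (Finset.Ico i (i + (k + 1))).image (g ∘ c) =
          insert (g (c (i + k))) (Y i ∪ (Finset.Ico i (i + k)).image (g ∘ c)) := by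
        rw [show Finset.Ico i (i + (k + 1)) = insert (i + k) (Finset.Ico i (i + k)) by
          ext x; simp; omega, Finset.image_insert, Finset.union_insert]
        rfl
      rw [h3, h2, ih]
      push_cast
      ring
  -- Of the `n + m` contributed jointly by `c i` and `g (c i)`, the image alone accounts for `n`, so
  -- `c i` gains at least `m` even over all the images.
  have hgain : ∀ L i, i < L →
      H.fd n m (X' ∪ (Finset.range L).image (g ∘ c) ∪ (Finset.range i).image c) + m ≤
      H.fd n m (insert (c i)
        (X' ∪ (Finset.range L).image (g ∘ c) ∪ (Finset.range i).image c)) := by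
    intro L i hi
    obtain ⟨k, rfl⟩ : ∃ k, L = i + (k + 1) := ⟨L - i - 1, by omega⟩
    have h1 := htail i (k + 1)
    have h2 := htail (i + 1) k
    have h3 := hc' i
    have hr1 : Finset.range (i + (k + 1)) = Finset.range i ∪ Finset.Ico i (i + (k + 1)) := by
      ext x; simp; omega
    have hr2 : Finset.Ico i (i + (k + 1)) = insert i (Finset.Ico (i + 1) (i + 1 + k)) := by
      ext x; simp; omega
    have e1 : X' ∪ (Finset.range (i + (k + 1))).image (g ∘ c) ∪ (Finset.range i).image c =
        Y i ∪ (Finset.Ico i (i + (k + 1))).image (g ∘ c) := by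
      rw [hY, hr1, Finset.image_union]
      ext x
      simp only [Finset.mem_union]
      tauto
    have e2 : insert (c i) (Y i ∪ (Finset.Ico i (i + (k + 1))).image (g ∘ c)) =
        Y (i + 1) ∪ (Finset.Ico (i + 1) (i + 1 + k)).image (g ∘ c) := by
      rw [hYs, hr2, Finset.image_insert]
      ext x
      simp only [Finset.mem_union, Finset.mem_insert, Function.comp_apply]
      tauto
    rw [e1, e2, h1, h2, hYs]
    push_cast
    linarith
  -- Blocks of `r` points, more than the `r - 1` that one edge can use.
  refine ⟨fun s => (Finset.range (r * s)).image c, fun s t hst => ?_, fun s => ?_,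
    fun s x hx => ?_, fun N s hs x hx => ?_⟩
  · exact Finset.image_subset_image (Finset.range_subset_range.2 (Nat.mul_le_mul_left _ hst))
  · refine le_trans ?_ (Finset.le_card_sdiff _ _)
    rw [Finset.card_image_of_injective _ hci, Finset.card_image_of_injective _ hci,
      Finset.card_range, Finset.card_range, Nat.mul_succ]
    omega
  · obtain ⟨i, -, rfl⟩ := Finset.mem_image.1 hx
    have h1 := free_of_subset hp (X := X) (Y := Y i) (hX.trans (by
      rw [hY, Finset.union_assoc]; exact Finset.subset_union_left)) (hc i).1
    rw [hd.mem_dcl_iff]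
    omega
  · rw [Finset.mem_sdiff] at hx
    obtain ⟨i, hi, rfl⟩ := Finset.mem_image.1 hx.1
    have hi1 : i < r * (s + 1) := Finset.mem_range.1 hi
    have hi2 : r * s ≤ i := by
      by_contra! h
      exact hx.2 (Finset.mem_image_of_mem c (Finset.mem_range.2 h))
    have h1 := hgain (r * N) i (lt_of_lt_of_le hi1 (Nat.mul_le_mul_left _ hs))
    beta_reduce
    rw [Finset.image_image]
    have hsub : (Finset.range (r * s)).image c ⊆ (Finset.range i).image c :=
      Finset.image_subset_image (Finset.range_subset_range.2 hi2)
    have h2 := hd.submod_of_subset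
      (A := insert (c i) (X' ∪ (Finset.range (r * N)).image (g ∘ c) ∪ (Finset.range (r * s)).image c))
      (B := X' ∪ (Finset.range (r * N)).image (g ∘ c) ∪ (Finset.range i).image c)
      (C := X' ∪ (Finset.range (r * N)).image (g ∘ c) ∪ (Finset.range (r * s)).image c)
      (D := insert (c i) (X' ∪ (Finset.range (r * N)).image (g ∘ c) ∪ (Finset.range i).image c))
      (Finset.subset_insert _ _) (Finset.union_subset_union subset_rfl hsub)
      (Finset.insert_subset (by simp) Finset.subset_union_right)
    omega

/-- Every set has a conjugate over `X` which is algebraic over a set that `g` moves to one over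
which it is independent. -/
theorem exists_algebraic_conj (hnm : Nat.Coprime n m) (X A : Finset V) :
    ∃ (h : Equiv.Perm V) (F E₁ E₂ : Finset V), H.IsAut h ∧
      (∀ x ∈ dcl (H.fd n m) X, h x = x) ∧ A ⊆ F ∧ X ⊆ F ∧ X ⊆ E₁ ∧ X.image g ⊆ E₁ ∧
      X.image ⇑g⁻¹ ⊆ E₁ ∧ E₂.image g ⊆ E₁ ∧ H.fd n m (E₂ ∪ F.image h) = H.fd n m E₂ ∧
      H.fd n m F + H.fd n m E₁ ≤ H.fd n m (F.image h ∪ E₁) + H.fd n m X := by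
  have hr2 : 2 ≤ r := by omega
  have hmn : m ≤ n := by omega
  have hp := hH.pos (by omega)
  have hd := fd_isDim hp
  obtain ⟨F, hF, -, hFs, -⟩ := exists_hull hp (A ∪ X)
  have hAF : A ⊆ F := Finset.subset_union_left.trans hF
  have hXF : X ⊆ F := Finset.subset_union_right.trans hF
  set F₀ := F.filter (· ∈ dcl (H.fd n m) X) with hF₀
  set X' := X ∪ X.image g ∪ X.image ⇑g⁻¹ with hX'
  obtain ⟨C, hCm, hCc, hCX, hCg⟩ := exists_supply hH hm hr hg hg1 (X := X) (X' := X') (by grind)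
  set N := (n + n * m) * F.card with hN
  set E₁ := X' ∪ (C N).image g with hE₁
  set E₂ := X ∪ C N with hE₂
  -- Including `F₀` ensures that `E` meets the independent copy `F'` exactly in `F₀`, so that the
  -- two are in free position.
  obtain ⟨E, hE, -, hEs, -⟩ := exists_hull hp (E₁ ∪ E₂ ∪ F₀)
  have hE1 : E₁ ⊆ E := by grind
  have hE2 : E₂ ⊆ E := by grind
  have hF₀E : F₀ ⊆ E := by grind
  have hXE2 : X ⊆ E₂ := by grind
  have hXE1 : X ⊆ E₁ := by grind
  have hXE : X ⊆ E := hXE2.trans hE2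
  obtain ⟨h, ha, hhX, hi⟩ := hH.exists_ind (by omega) hm F X E
  set F' := F.image h with hF'
  have hXF' : X ⊆ F' := fun x hx => by
    rw [← hhX x (subset_dcl _ _ hx)]
    exact Finset.mem_image_of_mem h (hXF hx)
  have hF'd : H.fd n m F' = H.fd n m F := ha.fd_image hp F
  have hFE : ∀ x ∈ F', x ∈ E → x ∈ F₀ := by
    intro x hx hxE
    have h1 : x ∈ dcl (H.fd n m) X :=
      hd.dcl_inter_subset hXF' hXE hi ⟨subset_dcl _ _ hx, subset_dcl _ _ hxE⟩
    obtain ⟨y, hy, rfl⟩ := Finset.mem_image.1 hx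
    have h2 := hhX _ h1
    have h3 := h.injective h2
    exact Finset.mem_filter.2 ⟨by rw [h3]; exact hy, h1⟩
  have hF₀F' : F₀ ⊆ F' := fun x hx => by
    rw [← hhX x (Finset.mem_filter.1 hx).2]
    exact Finset.mem_image_of_mem h (Finset.mem_filter.1 hx).1
  have hF₀X : (F₀ : Set V) ⊆ dcl (H.fd n m) X := fun x hx => by
    simp [hF₀] at hx; exact hx.2
  have hF's : H.FStrong n m F' := ha.fStrong_image hFs
  have hCF' : ∀ c ∈ C N, c ∉ F' := fun c hc hcF =>
    hCX N c hc (hF₀X (hFE c hcF (hE2 (Finset.mem_union_right _ hc))))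
  have hind : ∀ Q ⊆ E, X ⊆ Q → ∀ Y ⊆ F', H.fd n m (Q ∪ Y) - H.fd n m Q =
      H.fd n m (X ∪ Y) - H.fd n m X := by
    intro Q hQ hXQ Y hY
    have h1 := hd.ind_eq (hd.ind_mono hi (A' := Y) (C' := Q) (by grind) (by grind))
    rw [Finset.union_eq_right.2 hXQ, show Y ∪ X ∪ Q = Q ∪ Y by grind, Finset.union_comm Y X] at h1
    omega
  have hfree : ∀ e ∈ H.edges, e ⊆ E ∪ F' → e ⊆ E ∨ e ⊆ F' := by
    refine (free_union hp ?_).2 hm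
    have h1 : E ∩ F' = F₀ := by
      ext x
      rw [Finset.mem_inter]
      exact ⟨fun hx => hFE x hx.2 hx.1, fun hx => ⟨hF₀E hx, hF₀F' hx⟩⟩
    have h2 := hind E subset_rfl hXE F' subset_rfl
    rw [Finset.union_eq_right.2 hXF'] at h2
    have h3 : X ⊆ F₀ := fun x hx => Finset.mem_filter.2 ⟨hXF hx, subset_dcl _ _ hx⟩
    have h4 := fd_le hp h3
    rw [h1, ← hEs.fd_eq hp, ← hF's.fd_eq hp]
    omega
  have hS : KillSetup n m H E E₁ E₂ F' C N :=
    { sub₁ := hE1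
      sub₂ := hE2
      mono := hCm
      sub_C := fun s hs => (hCm hs).trans Finset.subset_union_right
      card := fun s _ => hCc s
      gain := fun s hs c hc => hCg N s hs c hc
      notMem := hCF' }
  have hE1C : E₁ ∪ C N ⊆ E := Finset.union_subset hE1 (Finset.subset_union_right.trans hE2)
  have hinit : KillState n m H E E₁ E₂ F' C N (H.fd n m F - H.fd n m X) H (F' \ E) N :=
    { pos := hp
      free := hH.hasFree (by omega) (by omega) hm
      fd_eq := fun _ _ => rfl
      edge_E := fun _ _ => Iff.rfl
      edge_F := fun _ _ => Iff.rfl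
      indep := by
        have h1 := hind (E₁ ∪ C N) hE1C (hXE1.trans Finset.subset_union_left) F' subset_rfl
        rw [Finset.union_eq_right.2 hXF', Finset.union_comm _ F'] at h1
        omega
      shift := fun Y hY => by
        have hY' := hY.trans Finset.sdiff_subset
        rw [hind E subset_rfl hXE Y hY', hind E₂ hE2 hXE2 Y hY']
      edge_T := fun e he heT c hc hce => by
        refine (hfree e he (heT.trans (Finset.union_subset_union subset_rfl
          Finset.sdiff_subset))).resolve_right fun h' => hCF' c hc (h' hce)
      disj := Finset.sdiff_disjoint
      cover := by intro x hx; by_cases hxE : x ∈ E <;> simp [hx, hxE]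
      le := le_rfl }
  have hcard : (F' \ E).card ≤ F.card :=
    (Finset.card_le_card Finset.sdiff_subset).trans Finset.card_image_le
  obtain ⟨K, T, hT, hK, -, hkill⟩ := (hinit.mono hS (t := 0 + (n + n * m) * (F' \ E).card) (by
    rw [zero_add, hN]; exact Nat.mul_le_mul_left _ hcard)).kill_all hr2 hnm hm hmn hp hS _
    subset_rfl
  have hKd := fd_isDim hK.pos
  have hKE2 : K.fd n m E₂ = H.fd n m E₂ := hK.fd_eq _ hE2
  have hF'E2 : K.fd n m (E₂ ∪ F') = H.fd n m E₂ := by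
    rw [← hKE2]
    refine hKd.union_of_subset_dcl fun x hx => ?_
    rw [hKd.mem_dcl_iff, hKE2]
    by_cases hxE : x ∈ E
    · rw [hK.fd_eq _ (Finset.insert_subset hxE hE2)]
      have h1 := hd.dcl_mono hXE2 (hF₀X (hFE x hx hxE))
      exact (hd.mem_dcl_iff).1 h1
    · exact (hkill x (Finset.mem_sdiff.2 ⟨hx, hxE⟩)).le
  have hF'E1 : H.fd n m E₁ + (H.fd n m F - H.fd n m X) ≤ K.fd n m (F' ∪ E₁) :=
    hK.indep_of_subset hS Finset.subset_union_left
  have hpdE : K.pd n m E = H.pd n m E := by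
    have : K.ein E = H.ein E := by
      ext e; simp only [mem_ein]
      exact and_congr_right fun h' => hK.edge_E e h'
    simp only [pd, this]
  have hpdF : K.pd n m F' = H.pd n m F' := by
    have : K.ein F' = H.ein F' := by
      ext e; simp only [mem_ein]
      exact and_congr_right fun h' => hK.edge_F e h'
    simp only [pd, this]
  have hKE : K.FStrong n m E := fStrong_of_pd_le hK.pos (by
    rw [hpdE, hK.fd_eq _ subset_rfl, hEs.fd_eq hp])
  -- Independence from `E₁` over `X` survived with the full relative dimension, so `F'` cannot have
  -- lost dimension in `K`.
  have hKF : K.FStrong n m F' := fStrong_of_pd_le hK.pos (by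
    have h1 := hKd.submod_of_subset (A := F') (B := E₁) (C := X) (D := F' ∪ E₁) hXF' hXE1
      subset_rfl
    rw [hK.fd_eq _ hE1, hK.fd_eq _ hXE] at h1
    rw [hpdF, ← hF's.fd_eq hp]
    omega)
  obtain ⟨D, hD, -, hDs, -⟩ := exists_hull hK.pos (E ∪ F')
  have hED : E ⊆ D := Finset.subset_union_left.trans hD
  have hF'D : F' ⊆ D := Finset.subset_union_right.trans hD
  -- The modified structure is realized in the generic one over `E`, which was not changed; `F` is
  -- still isomorphic to the resulting copy of `F'`.
  obtain ⟨α, hα, hαE, hαs⟩ := hH.realize (by omega) hEs hK.pos (D := D) (j := id)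
    ⟨Function.injective_id.injOn, fun e he => by rw [Finset.image_id]; exact hK.edge_E e he⟩
    (by rwa [Finset.image_id]) (by rwa [Finset.image_id])
  have himg : ∀ Y ⊆ E, Y.image α = Y := fun Y hY => image_eq_self fun x hx => hαE x (hY hx)
  have hαd : ∀ Y ⊆ D, H.fd n m (Y.image α) = K.fd n m Y := fun Y hY =>
    hα.fd_image hK.pos hp hDs hαs hY
  have hiso : IsoOn H K id F' :=
    ⟨Function.injective_id.injOn, fun e he => by rw [Finset.image_id]; exact hK.edge_F e he⟩
  have hPI : PIso n m H F (α ∘ h) := by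
    refine ⟨hFs, ?_, ?_⟩
    · have h1 : IsoOn H H (α ∘ id) F' :=
        IsoOn.comp (by rw [Finset.image_id]; exact hα.mono hF'D) hiso
      exact h1.comp (ha.isoOn F)
    · rw [← Finset.image_image]
      exact hα.fStrong_image hαs hF'D hKF
  obtain ⟨p, hpa, hpF⟩ := hPI.exists_isAut hH (by omega)
  obtain ⟨h', ha', hh'F, hh'X⟩ := hpa.exists_fix hH (by omega) hm hFs hXF (fun x hx hxX => by
    have h1 : x ∈ F₀ := Finset.mem_filter.2 ⟨hx, hxX⟩
    rw [hpF x hx, Function.comp_apply, hhX x hxX]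
    exact hαE x (hF₀E h1))
  have himg' : F.image h' = F'.image α := by
    rw [hF', Finset.image_image]
    exact Finset.image_congr fun x hx => by rw [hh'F x hx, hpF x hx]
  refine ⟨h', F, E₁, E₂, ha', hh'X, hAF, hXF, hXE1, by grind, by grind, ?_, ?_, ?_⟩
  · rw [hE₂, Finset.image_union]
    grind
  · have h1 := hαd (E₂ ∪ F') (Finset.union_subset (hE2.trans hED) hF'D)
    rw [Finset.image_union, himg E₂ hE2] at h1
    rw [himg', h1, hF'E2]
  · have h1 := hαd (F' ∪ E₁) (Finset.union_subset hF'D (hE1.trans hED))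
    rw [Finset.image_union, himg E₁ hE1] at h1
    rw [himg', h1]
    omega

/-- The copy `B` is independent from `E₁` over `X`, while `g B` is algebraic over `g E₂ ⊆ E₁`; so
`B` is independent from `g B` over `X`. -/
theorem exists_moved_conj (hnm : Nat.Coprime n m) (X A : Finset V) :
    ∃ h : Equiv.Perm V, H.IsAut h ∧ (∀ x ∈ dcl (H.fd n m) X, h x = x) ∧
      DInd (H.fd n m) (A.image h) X (X.image g ∪ (A.image h).image g) ∧
      DInd (H.fd n m) ((A.image h).image g) (X.image g) (X ∪ A.image h) := by
  have hp := hH.pos (by omega)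
  have hd := fd_isDim hp
  obtain ⟨h, F, E₁, E₂, ha, hhX, hAF, hXF, hX1, hgX1, hg'X1, hE21, hcl, hle⟩ :=
    exists_algebraic_conj hH hm hr hg hg1 hnm X A
  refine ⟨h, ha, hhX, ?_⟩
  set B := F.image h with hB
  have hXB : X ⊆ B := fun x hx => by
    rw [← hhX x (subset_dcl _ _ hx)]
    exact Finset.mem_image_of_mem h (hXF hx)
  have hAB : A.image h ⊆ B := Finset.image_subset_image hAF
  have hi : DInd (H.fd n m) B X E₁ := by
    unfold DInd
    rw [Finset.union_eq_left.2 hXB, Finset.union_eq_right.2 hX1, hB, ha.fd_image hp]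
    exact hle
  have hgB : ((B.image g : Finset V) : Set V) ⊆ dcl (H.fd n m) E₁ := by
    have h1 : (B : Set V) ⊆ dcl (H.fd n m) E₂ := hd.subset_dcl_of_le hcl.le
    intro y hy
    obtain ⟨x, hx, rfl⟩ := Finset.mem_image.1 hy
    exact hd.dcl_mono hE21 ((hg.mem_dcl_image hp).2 (h1 hx))
  have hgX : X.image g ⊆ B.image g := Finset.image_subset_image hXB
  have h1 : DInd (H.fd n m) B X (B.image g) :=
    hd.ind_dcl_right hi (hgB.trans (hd.dcl_mono Finset.subset_union_right))
  have h2 : DInd (H.fd n m) B X (X.image g) := hd.ind_mono_right hi (by grind)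
  have h3 : DInd (H.fd n m) B X (X.image ⇑g⁻¹) := hd.ind_mono_right hi (by grind)
  -- The second relation follows numerically from the first and from independence of `B` over `X`
  -- from `g X` and `g⁻¹ X`; applying `g` turns the latter into a formula for the dimension of `g B
  -- ∪ X`.
  have h4 : DInd (H.fd n m) (B.image g) (X.image g) (X ∪ B) := by
    have e1 := hd.ind_eq h1
    have e2 := hd.ind_eq h2
    have e3 := hd.ind_eq h3
    rw [Finset.union_eq_left.2 hXB] at e1 e2 e3
    have e4 : H.fd n m (B ∪ X.image ⇑g⁻¹) = H.fd n m (B.image g ∪ X) := by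
      rw [← hg.fd_image hp, Finset.image_union, image_image_inv]
    have e5 : H.fd n m (X ∪ X.image ⇑g⁻¹) = H.fd n m (X.image g ∪ X) := by
      rw [← hg.fd_image hp, Finset.image_union, image_image_inv]
    unfold DInd
    rw [Finset.union_eq_left.2 hgX, Finset.union_eq_right.2 hXB, Finset.union_comm _ B,
      Finset.union_comm _ B, hg.fd_image hp, hg.fd_image hp]
    rw [e4, e5] at e3
    rw [Finset.union_comm X] at e1 e2
    omega
  exact ⟨hd.ind_mono h1 (hAB.trans Finset.subset_union_left)
      ((Finset.union_subset hgX (Finset.image_subset_image hAB)).trans Finset.subset_union_right),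
    hd.ind_mono h4 ((Finset.image_subset_image hAB).trans Finset.subset_union_left)
      ((Finset.union_subset_union subset_rfl hAB).trans Finset.subset_union_right)⟩

end Moving

/-! ### The automorphism group -/

theorem smul_eq_image {X : Set V} (g : H.autFixing X) (A : Finset V) :
    g • A = A.image (g : Equiv.Perm V) := by
  ext x
  simp only [Finset.mem_smul_finset, Finset.mem_image]
  rfl

theorem isAut_coe {X : Set V} (g : H.autFixing X) : H.IsAut (g : Equiv.Perm V) :=
  isAut_iff.2 g.2.1

theorem exists_coe_eq (hp : H.Pos n m) {p : Equiv.Perm V} (hpa : H.IsAut p) {B : Finset V}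
    (h : ∀ x ∈ dcl (H.fd n m) B, p x = x) :
    ∃ g : H.autFixing (H.clD n m ∅), (g : Equiv.Perm V) = p :=
  ⟨⟨p, isAut_iff.1 hpa, fun x hx => h x ((fd_isDim hp).dcl_mono (Finset.empty_subset B) (by
    rwa [clD_empty hp] at hx))⟩, rfl⟩

theorem dimAction (hH : H.IsGeneric n m) (hnm : Nat.Coprime n m) (hm : 1 ≤ m)
    (hr : (r = 2 ∧ m < n) ∨ (3 ≤ r ∧ m ≤ n)) :
    DimAction (H.autFixing (H.clD n m ∅)) (H.fd n m) := by
  have hr0 : r ≠ 0 := by omega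
  have hp := hH.pos hr0
  have hsm : ∀ (g : H.autFixing (H.clD n m ∅)) (x : V), g • x = (g : Equiv.Perm V) x :=
    fun _ _ => rfl
  have hfix : ∀ (g : H.autFixing (H.clD n m ∅)), ∀ x ∈ dcl (H.fd n m) ∅,
      (g : Equiv.Perm V) x = x := fun g x hx => g.2.2 x (by rwa [clD_empty hp])
  refine ⟨fd_isDim hp, fun g A => ?_, fun A B C => ?_, fun A B C h hBA hBC hfx h₁ h₂ => ?_,
    fun f hf X A => ?_, fun p F hF hcov hpF hinv => ?_, fun g => hfix g, fun g h hgh => ?_⟩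
  · rw [smul_eq_image, (isAut_coe g).fd_image hp]
  · obtain ⟨p, hpa, hpB, hi⟩ := hH.exists_ind hr0 hm A B C
    obtain ⟨g, rfl⟩ := exists_coe_eq hp hpa hpB
    exact ⟨g, hpB, by rwa [smul_eq_image]⟩
  · rw [smul_eq_image] at h₂
    obtain ⟨k, hk, hkA, hkC⟩ := (isAut_coe h).exists_of_ind hH hr0 hm hBA hBC hfx h₁ h₂
    obtain ⟨g, rfl⟩ := exists_coe_eq hp hk hkC
    exact ⟨g, hkA, hkC⟩
  · obtain ⟨p, hpa, hpX, h1, h2⟩ := exists_moved_conj hH hm hr (isAut_coe f)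
      (fun h => hf (Subtype.ext h)) hnm X A
    obtain ⟨g, rfl⟩ := exists_coe_eq hp hpa hpX
    refine ⟨g, hpX, ?_⟩
    simp only [smul_eq_image]
    exact ⟨h1, h2⟩
  · obtain ⟨q, hq, hqF⟩ := exists_isAut_of_chain (H := H) (f := fun i => ⇑(p i : Equiv.Perm V)) hF
      hcov hpF (fun i => (isAut_coe (p i)).isoOn _) (fun y => by
        obtain ⟨i, hi⟩ := hinv y
        exact ⟨i, _, hi, by rw [← hsm, smul_inv_smul]⟩)
    obtain ⟨g, rfl⟩ := exists_coe_eq (B := ∅) hp hq (fun x hx => by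
      obtain ⟨i, hi⟩ := hcov x
      rw [hqF i x hi, hfix _ x hx])
    exact ⟨g, hqF⟩
  · exact Subtype.ext (Equiv.ext hgh)

/-- A point of dimension `n ≥ 1` is not independent from itself, so an element making it independent
from itself must move it. -/
theorem nontrivial_autFixing (hH : H.IsGeneric n m) (hr : r ≠ 0) (hn : 1 ≤ n) (hm : 1 ≤ m) :
    Nontrivial (H.autFixing (H.clD n m ∅)) := by
  have hp := hH.pos hr
  obtain ⟨w, -, hw⟩ := hH.hasFree hr hn hm ∅
  have hw := hw ∅ subset_rfl
  obtain ⟨h, ha, hh, hi⟩ := hH.exists_ind hr hm {w} ∅ {w}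
  obtain ⟨g, rfl⟩ := exists_coe_eq hp ha hh
  refine ⟨g, 1, fun h1 => ?_⟩
  subst h1
  unfold DInd at hi
  rw [OneMemClass.coe_one, Equiv.Perm.coe_one, Finset.image_id, Finset.union_empty,
    Finset.empty_union, Finset.union_self] at hi
  rw [show insert w (∅ : Finset V) = {w} from rfl] at hw
  omega

end UHypergraph

end

/-! ### The simplicity theorem -/

theorem theorem4p15 (r n m : ℕ) (hn : 1 ≤ n) (hm : 1 ≤ m) (hnm : Nat.Coprime n m)
    (hr : (r = 2 ∧ m < n) ∨ (3 ≤ r ∧ m ≤ n))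
    {V : Type*} (M₀ : UHypergraph r V) (hM₀ : M₀.IsGeneric n m) :
    IsSimpleGroup (M₀.autFixing (M₀.clD n m ∅)) ∧
    ∀ g : M₀.autFixing (M₀.clD n m ∅), g ≠ 1 →
      ∀ k : M₀.autFixing (M₀.clD n m ∅),
        ∃ l : List (M₀.autFixing (M₀.clD n m ∅)), l.length = 96 ∧
          (∀ x ∈ l, IsConj g x ∨ IsConj g⁻¹ x) ∧ l.prod = k := by
  have hA := UHypergraph.dimAction hM₀ hnm hm hr
  have := hM₀.countable
  have key : ∀ g : M₀.autFixing (M₀.clD n m ∅), g ≠ 1 →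
      ∀ k : M₀.autFixing (M₀.clD n m ∅),
        ∃ l : List (M₀.autFixing (M₀.clD n m ∅)), l.length = 96 ∧
          (∀ x ∈ l, IsConj g x ∨ IsConj g⁻¹ x) ∧ l.prod = k :=
    -- Eight factors and 44 cancelling pairs: `8 + 2 * 44 = 96`.
    fun g hg k => hA.exists_list hg k 44
  have := UHypergraph.nontrivial_autFixing hM₀ (by omega) hn hm
  refine ⟨⟨fun N hN => ?_⟩, key⟩
  rw [or_iff_not_imp_left, Subgroup.eq_top_iff']
  intro hbot k
  obtain ⟨g, hgN, hg⟩ := N.bot_or_exists_ne_one.resolve_left hbot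
  obtain ⟨l, -, hl, rfl⟩ := key g hg k
  refine N.list_prod_mem fun x hx => ?_
  rcases hl x hx with h | h
  · obtain ⟨c, rfl⟩ := isConj_iff.1 h
    exact hN.conj_mem g hgN c
  · obtain ⟨c, rfl⟩ := isConj_iff.1 h
    exact hN.conj_mem _ (N.inv_mem hgN) c
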